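/- **Setting.** Let $p\in(2,3)$, $q\ge p$, $r>1$ with $\frac2p+\frac1q>1$ and $\frac1r=\frac1p+\frac1q$. Write $S_{s,t}=S_t-S_s$. *Price paths.* A continuous $S:[0,\infty)\to(0,\infty)^d$ is a price path, with partitions $(\mathcal P^n)_{n}$ of $[0,\infty)$ (strictly increasing sequences from $0$ to $\infty$), if for every $T>0$ it satisfies Property (RIE) along the partitions $(\mathcal P^n\cup\{T\})\cap[0,T]=\{0=t^n_0<\dots<t^n_{N_n}=T\}$, i.e. their mesh tends to $0$; the Riemann sums $\int_0^tS^n_u\otimes \mathrm dS_u:=\sum_k S_{t^n_k}\otimes S_{t^n_k\wedge t,\,t^n_{k+1}\wedge t}$ converge uniformly in $t\in[0,T]$, to a limit denoted $\int_0^t S_u\otimes \mathrm dS_u$; and there is a superadditive function $c$ with values in $[0,\infty)$ on $\{0\le s\le t\le T\}$ such that (with $\frac00=0$) $$\sup_{s\le t}\frac{|S_{s,t}|^p}{c(s,t)}+\sup_n\sup_{k<\ell}\frac{\big|\int_{t^n_k}^{t^n_\ell}S^n_u\otimes \mathrm dS_u-S_{t^n_k}\otimes S_{t^n_k,t^n_\ell}\big|^{p/2}}{c(t^n_k,t^n_\ell)}\le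 1 .$$ Put $\mathbb S_{s,t}=\int_s^tS_u\otimes \mathrm dS_u-S_s\otimes S_{s,t}$, $\mathbf S=(S,\mathbb S)$ and $[\mathbf S]_t=S_{0,t}\otimes S_{0,t}-\mathbb S_{0,t}-\mathbb S_{0,t}^\top$. *Controlled paths and integrals.* A pair of continuous paths $F:[0,T]\to\mathbb R^d$, $F':[0,T]\to\mathbb R^{d\times d}$ is an $S$-controlled path on $[0,T]$, with Gubinelli derivative $F'$, if $F'$ has finite $q$-variation and $R^F_{s,t}=F_{s,t}-F'_sS_{s,t}$ has finite $r$-variation. A path $F$ on $[0,\infty)$ is $S$-controlled if on every $[0,T]$ it has such a Gubinelli derivative. The integral of $(F,F')$ against $(G,G')$ is $$\int_0^tF_u\,\mathrm dG_u=\lim_{|\mathcal P|\to0}\sum_{[u,v]\in\mathcal P}\Big(F_u\cdot G_{u,v}+\sum_{i,a,b}(F'_u)^{ia}(G'_u)^{ib}\,\mathbb S^{ab}_{u,v}\Big),$$ the limit being over partitions $\mathcal P$ of $[0,t]$; $\int_0^t F_u\,\mathrm d\mathbf S_u$ is the case $G=S$, $G'=\mathrm{Id}$. *Portfolios.* A portfolio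 $\pi$ is an $S$-controlled path on $[0,\infty)$ with $\sum_i\pi^i_t=1$ for all $t$. Quotients of paths are taken componentwise, $(e_i)$ is the canonical basis of $\mathbb R^d$, and $$\mu^i_t=\frac{S^i_t}{S^1_t+\dots+S^d_t},\qquad W^\pi_t=\exp\Big(\int_0^t\frac{\pi_s}{S_s}\,\mathrm d\mathbf S_s-\frac12\sum_{i,j}\int_0^t\frac{\pi^i_s\pi^j_s}{S^i_sS^j_s}\,\mathrm d[\mathbf S]^{ij}_s\Big),\qquad V^\pi=\frac{W^\pi}{W^\mu},$$ $$a^{ij}(\mathrm ds)=\frac{\mathrm d[\mathbf S]^{ij}_s}{S^i_sS^j_s},\qquad \tau^\mu_{ij}(\mathrm ds)=(\mu_s-e_i)^\top a(\mathrm ds)\,(\mu_s-e_j).$$ **Proposition.** Let $\pi$ be a portfolio for the price path $S$. Then $\mu$ is a portfolio, $\pi/S$ and $\pi/\mu$ are $S$-controlled paths, $[\mathbf S]$ is continuous and of locally finite variation, and the Riemann–Stieltjes integrals against $[\mathbf S]$, $a$ and $\tau^\mu$ occurring here exist. The integrals $\int_0^t\frac{\pi_s}{S_s}\,\mathrm d\mathbf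 S_s$ and $\int_0^t\frac{\pi_s}{\mu_s}\,\mathrm d\mu_s$ exist for all choices of the Gubinelli derivatives of $\pi/S$, and of $\pi/\mu$ and $\mu$, and do not depend on these choices. The latter integral is also the limit of left-point Riemann sums $$\int_0^t\frac{\pi_s}{\mu_s}\,\mathrm d\mu_s=\lim_{n\to\infty}\sum_k\frac{\pi_{t^n_k}}{\mu_{t^n_k}}\cdot\mu_{t^n_k\wedge t,\,t^n_{k+1}\wedge t}$$ along $\mathcal P^n=(t^n_k)_{k\ge0}$, uniformly in $t$ on compact intervals. Moreover, for all $t\ge0$, $$\log V^\pi_t=\int_0^t\frac{\pi_s}{\mu_s}\,\mathrm d\mu_s-\frac12\sum_{i,j=1}^d\int_0^t\pi^i_s\pi^j_s\,\tau^\mu_{ij}(\mathrm ds).$$ -/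

import Mathlib

open Filter Topology Set

namespace PathwisePortfolio

/-! ### Partitions -/

/-- A finite partition `0 = t_0 < t_1 < ⋯ < t_N = T` of `[0, T]`
(the values `pt k` for `k > N` are irrelevant). -/
structure Partition (T : ℝ) where
  N : ℕ
  pt : ℕ → ℝ
  pt_zero : pt 0 = 0
  pt_last : pt N = T
  pt_lt : ∀ k < N, pt k < pt (k + 1)

/-- The mesh size `max_k |t_{k+1} - t_k|` (equal to `0` for the trivial partition of `[0, 0]`). -/
noncomputable def Partition.mesh {T : ℝ} (D : Partition T) : ℝ :=
  ⨆ k : Fin D.N, (D.pt (k + 1) - D.pt k)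

/-- The filter "`|D| → 0`" on the partitions `D` of `[0, T]`. -/
noncomputable def meshFilter (T : ℝ) : Filter (Partition T) :=
  comap Partition.mesh (𝓝 0)

/-- A partition of `[0, ∞)`: a strictly increasing sequence `0 = t_0 < t_1 < ⋯` tending to `∞`. -/
structure HalfLinePartition where
  pt : ℕ → ℝ
  pt_zero : pt 0 = 0
  strictMono : StrictMono pt
  tendsto : Tendsto pt atTop atTop

theorem HalfLinePartition.exists_le (Q : HalfLinePartition) (T : ℝ) : ∃ k, T ≤ Q.pt k :=
  (Q.tendsto.eventually_ge_atTop T).exists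

open Classical in
/-- The partition `(Q ∪ {T}) ∩ [0, T]` of `[0, T]`: if `N` is the first index with `T ≤ t_N`, its
points are `t_0, …, t_{N-1}, T`. -/
noncomputable def HalfLinePartition.restrict (Q : HalfLinePartition) (T : ℝ) (hT : 0 ≤ T) :
    Partition T where
  N := Nat.find (Q.exists_le T)
  pt k := min (Q.pt k) T
  pt_zero := by rw [Q.pt_zero]; exact min_eq_left hT
  pt_last := min_eq_right (Nat.find_spec (Q.exists_le T))
  pt_lt k hk := by
    have h1 : Q.pt k < T := not_le.mp (Nat.find_min (Q.exists_le T) hk)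
    rw [min_eq_left h1.le]
    exact lt_min (Q.strictMono (Nat.lt_succ_self k)) h1

/-! ### Variation and controlled paths -/

/-- The Euclidean (Frobenius) norm of a matrix. -/
noncomputable def frobNorm {d : ℕ} (A : Matrix (Fin d) (Fin d) ℝ) : ℝ :=
  √(∑ i, ∑ j, A i j ^ 2)

/-- A two-parameter function whose norm is `w s t` has finite `ρ`-variation over `[0, T]`. -/
def HasFiniteVariation (ρ T : ℝ) (w : ℝ → ℝ → ℝ) : Prop :=
  ∃ C : ℝ, ∀ D : Partition T, ∑ k ∈ Finset.range D.N, w (D.pt k) (D.pt (k + 1)) ^ ρ ≤ C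

/-- The remainder `R^F_{s,t} = F_t - F_s - F'_s (S_t - S_s)`. -/
noncomputable def remainder {d : ℕ} (S F : ℝ → EuclideanSpace ℝ (Fin d))
    (F' : ℝ → Matrix (Fin d) (Fin d) ℝ) (s t : ℝ) : EuclideanSpace ℝ (Fin d) :=
  F t - F s - Matrix.toEuclideanLin (F' s) (S t - S s)

/-- `(F, F')` is an `S`-controlled path on `[0, T]`, i.e. belongs to `𝒱^q_S([0, T]; ℝ^d)`; here
`1 / r = 1 / p + 1 / q`, and `(F')^{ij}` is the derivative of `F^i` in the direction of `S^j`. -/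
structure IsControlled {d : ℕ} (q r T : ℝ) (S F : ℝ → EuclideanSpace ℝ (Fin d))
    (F' : ℝ → Matrix (Fin d) (Fin d) ℝ) : Prop where
  continuousOn : ContinuousOn F (Icc 0 T)
  continuousOn_deriv : ∀ i j, ContinuousOn (fun t => F' t i j) (Icc 0 T)
  variation_deriv : HasFiniteVariation q T fun s t => frobNorm (F' t - F' s)
  variation_remainder : HasFiniteVariation r T fun s t => ‖remainder S F F' s t‖

/-! ### Property (RIE), price paths and the associated rough path -/

/-- The left-point Riemann sum `∑_k F_{t_k} (G_{t_{k+1} ∧ t} - G_{t_k ∧ t})` of real-valued paths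
along a finite partition. -/
noncomputable def Partition.leftSum {T : ℝ} (D : Partition T) (F G : ℝ → ℝ) (t : ℝ) : ℝ :=
  ∑ k ∈ Finset.range D.N, F (D.pt k) * (G (min (D.pt (k + 1)) t) - G (min (D.pt k) t))

/-- The same Riemann sum along a partition of `[0, ∞)`; only the finitely many `k` with `t_k < t`
contribute. -/
noncomputable def HalfLinePartition.leftSum (Q : HalfLinePartition) (F G : ℝ → ℝ) (t : ℝ) : ℝ :=
  ∑' k : ℕ, F (Q.pt k) * (G (min (Q.pt (k + 1)) t) - G (min (Q.pt k) t))

/-- The matrix `A ⊗ B` with entries `A^i B^j`. -/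
def tensor {d : ℕ} (A B : EuclideanSpace ℝ (Fin d)) : Matrix (Fin d) (Fin d) ℝ :=
  Matrix.of fun i j => A i * B j

/-- The matrix-valued Riemann sum `∫_0^t S^D_u ⊗ dS_u`, where `S^D` is the piecewise constant
left-point approximation of `S` along `D`. -/
noncomputable def Partition.tensorSum {T : ℝ} {d : ℕ} (D : Partition T)
    (S : ℝ → EuclideanSpace ℝ (Fin d)) (t : ℝ) : Matrix (Fin d) (Fin d) ℝ :=
  Matrix.of fun i j => D.leftSum (fun u => S u i) (fun u => S u j) t

/-- A control function on `[0, T]`: nonnegative and superadditive. -/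
def IsControl (T : ℝ) (c : ℝ → ℝ → ℝ) : Prop :=
  (∀ s t, 0 ≤ s → s ≤ t → t ≤ T → 0 ≤ c s t) ∧
  ∀ s u t, 0 ≤ s → s ≤ u → u ≤ t → t ≤ T → c s u + c u t ≤ c s t

/-- Property (RIE) of the path `S` on `[0, T]` with respect to `p` and the partitions `(D n)`.
The bounds with constants `A + B ≤ 1` say that the sum of the two suprema of the quotients
(with `0 / 0 = 0`, and `x / 0 = ∞` for `x > 0`) is at most `1`. -/
structure RIE {d : ℕ} (p T : ℝ) (D : ℕ → Partition T) (S : ℝ → EuclideanSpace ℝ (Fin d)) :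
    Prop where
  continuousOn : ContinuousOn S (Icc 0 T)
  mesh_tendsto : Tendsto (fun n => (D n).mesh) atTop (𝓝 0)
  converges : ∃ I : ℝ → Matrix (Fin d) (Fin d) ℝ, ∀ i j,
    TendstoUniformlyOn (fun n t => (D n).tensorSum S t i j) (fun t => I t i j) atTop (Icc 0 T)
  control : ∃ c : ℝ → ℝ → ℝ, IsControl T c ∧ ∃ A B : ℝ, 0 ≤ A ∧ 0 ≤ B ∧ A + B ≤ 1 ∧
    (∀ s t, 0 ≤ s → s ≤ t → t ≤ T → ‖S t - S s‖ ^ p ≤ A * c s t) ∧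
    ∀ n k l, k < l → l ≤ (D n).N →
      frobNorm ((D n).tensorSum S ((D n).pt l) - (D n).tensorSum S ((D n).pt k)
          - tensor (S ((D n).pt k)) (S ((D n).pt l) - S ((D n).pt k))) ^ (p / 2)
        ≤ B * c ((D n).pt k) ((D n).pt l)

/-- `S` is a price path, with `(P n)` as its sequence of partitions of `[0, ∞)`. -/
structure IsPricePath {d : ℕ} (p : ℝ) (P : ℕ → HalfLinePartition)
    (S : ℝ → EuclideanSpace ℝ (Fin d)) : Prop where
  continuousOn : ContinuousOn S (Ici 0)
  pos : ∀ t, 0 ≤ t → ∀ i, 0 < S t i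
  rie : ∀ (T : ℝ) (hT : 0 < T), RIE p T (fun n => (P n).restrict T hT.le) S

/-- The limit `∫_0^t S_u ⊗ dS_u` of the Riemann sums along `(P n)`. -/
noncomputable def itoIntegral {d : ℕ} (P : ℕ → HalfLinePartition)
    (S : ℝ → EuclideanSpace ℝ (Fin d)) (t : ℝ) : Matrix (Fin d) (Fin d) ℝ :=
  Matrix.of fun i j =>
    limUnder atTop fun n => (P n).leftSum (fun u => S u i) (fun u => S u j) t

/-- The second level `𝕊_{s,t} = ∫_s^t S_u ⊗ dS_u - S_s ⊗ S_{s,t}` of the rough path `(S, 𝕊)`. -/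
noncomputable def secondLevel {d : ℕ} (P : ℕ → HalfLinePartition)
    (S : ℝ → EuclideanSpace ℝ (Fin d)) (s t : ℝ) : Matrix (Fin d) (Fin d) ℝ :=
  itoIntegral P S t - itoIntegral P S s - tensor (S s) (S t - S s)

/-- The bracket `[𝐒]_t = S_{0,t} ⊗ S_{0,t} - 2 Sym(𝕊_{0,t})`. -/
noncomputable def bracket {d : ℕ} (P : ℕ → HalfLinePartition)
    (S : ℝ → EuclideanSpace ℝ (Fin d)) (t : ℝ) : Matrix (Fin d) (Fin d) ℝ :=
  tensor (S t - S 0) (S t - S 0) - (secondLevel P S 0 t + (secondLevel P S 0 t).transpose)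

/-! ### Integrals -/

/-- The compensated Riemann sum `∑ F_s · G_{s,t} + F'_s G'_s 𝕊_{s,t}`, where
`F'_s G'_s 𝕊_{s,t} = ∑_i ∑_{a,b} (F'_s)^{ia} (G'_s)^{ib} 𝕊^{ab}_{s,t}`. -/
noncomputable def compensatedSum {d : ℕ} (X : ℝ → ℝ → Matrix (Fin d) (Fin d) ℝ)
    (F : ℝ → EuclideanSpace ℝ (Fin d)) (F' : ℝ → Matrix (Fin d) (Fin d) ℝ)
    (G : ℝ → EuclideanSpace ℝ (Fin d)) (G' : ℝ → Matrix (Fin d) (Fin d) ℝ)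
    {T : ℝ} (D : Partition T) : ℝ :=
  ∑ k ∈ Finset.range D.N,
    ((∑ i, F (D.pt k) i * (G (D.pt (k + 1)) i - G (D.pt k) i)) +
      ∑ i, ∑ a, ∑ b, F' (D.pt k) i a * G' (D.pt k) i b * X (D.pt k) (D.pt (k + 1)) a b)

/-- `L` is the integral over `[0, t]` of `(F, F')` against `(G, G')`, with second level `X`: the
compensated Riemann sums converge to `L` as the mesh size tends to zero. -/
def HasRoughIntegral {d : ℕ} (X : ℝ → ℝ → Matrix (Fin d) (Fin d) ℝ)
    (F : ℝ → EuclideanSpace ℝ (Fin d)) (F' : ℝ → Matrix (Fin d) (Fin d) ℝ)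
    (G : ℝ → EuclideanSpace ℝ (Fin d)) (G' : ℝ → Matrix (Fin d) (Fin d) ℝ) (t L : ℝ) : Prop :=
  Tendsto (compensatedSum X F F' G G') (meshFilter t) (𝓝 L)

/-- The rough integral `∫_0^t F_u d𝐒_u` of an `S`-controlled path against the rough path
`𝐒 = (S, 𝕊)`, computed with some Gubinelli derivative of `F` on `[0, t]`; as an integrator, `S` has
the identity matrix as its Gubinelli derivative. -/
noncomputable def roughIntegral {d : ℕ} (q r : ℝ) (P : ℕ → HalfLinePartition)
    (S F : ℝ → EuclideanSpace ℝ (Fin d)) (t : ℝ) : ℝ :=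
  Classical.epsilon fun L : ℝ => ∃ F' : ℝ → Matrix (Fin d) (Fin d) ℝ,
    IsControlled q r t S F F' ∧
      HasRoughIntegral (secondLevel P S) F F' S (fun _ => 1) t L

/-- The integral `∫_0^t F_u dG_u` of an `S`-controlled path against another one, computed with some
Gubinelli derivatives of `F` and `G` on `[0, t]`. -/
noncomputable def controlledIntegral {d : ℕ} (q r : ℝ) (P : ℕ → HalfLinePartition)
    (S F G : ℝ → EuclideanSpace ℝ (Fin d)) (t : ℝ) : ℝ :=
  Classical.epsilon fun L : ℝ => ∃ F' G' : ℝ → Matrix (Fin d) (Fin d) ℝ,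
    IsControlled q r t S F F' ∧ IsControlled q r t S G G' ∧
      HasRoughIntegral (secondLevel P S) F F' G G' t L

/-- The Riemann–Stieltjes sum `∑ f_s (g_t - g_s)` along a partition. -/
noncomputable def stieltjesSum (f g : ℝ → ℝ) {T : ℝ} (D : Partition T) : ℝ :=
  ∑ k ∈ Finset.range D.N, f (D.pt k) * (g (D.pt (k + 1)) - g (D.pt k))

/-- The Riemann–Stieltjes integral `∫_0^t f_s dg_s` exists. -/
def StieltjesIntegrable (f g : ℝ → ℝ) (t : ℝ) : Prop :=
  ∃ L : ℝ, Tendsto (stieltjesSum f g) (meshFilter t) (𝓝 L)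

/-- The Riemann–Stieltjes integral `∫_0^t f_s dg_s`; used for continuous `f` and for continuous `g`
of locally finite variation. -/
noncomputable def stieltjesIntegral (f g : ℝ → ℝ) (t : ℝ) : ℝ :=
  limUnder (meshFilter t) (stieltjesSum f g)

/-! ### Portfolios -/

/-- `F` is an admissible strategy for `S`. -/
def IsAdmissible {d : ℕ} (q r : ℝ) (S F : ℝ → EuclideanSpace ℝ (Fin d)) : Prop :=
  ∀ T : ℝ, 0 < T → ∃ F' : ℝ → Matrix (Fin d) (Fin d) ℝ, IsControlled q r T S F F'

/-- `π` is a portfolio for `S`. -/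
def IsPortfolio {d : ℕ} (q r : ℝ) (S π : ℝ → EuclideanSpace ℝ (Fin d)) : Prop :=
  IsAdmissible q r S π ∧ ∀ t, 0 ≤ t → ∑ i, π t i = 1

/-- The componentwise quotient `(F / G)^i = F^i / G^i`. -/
noncomputable def quot {d : ℕ} (F G : ℝ → EuclideanSpace ℝ (Fin d)) :
    ℝ → EuclideanSpace ℝ (Fin d) :=
  fun t => WithLp.toLp 2 fun i => F t i / G t i

/-- The market portfolio `μ^i = S^i / (S^1 + ⋯ + S^d)`. -/
noncomputable def market {d : ℕ} (S : ℝ → EuclideanSpace ℝ (Fin d)) :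
    ℝ → EuclideanSpace ℝ (Fin d) :=
  fun t => WithLp.toLp 2 fun i => S t i / ∑ j, S t j

/-- The wealth process `W^π` with unit initial wealth. -/
noncomputable def wealth {d : ℕ} (q r : ℝ) (P : ℕ → HalfLinePartition)
    (S π : ℝ → EuclideanSpace ℝ (Fin d)) (t : ℝ) : ℝ :=
  Real.exp (roughIntegral q r P S (quot π S) t
    - 1 / 2 * ∑ i, ∑ j, stieltjesIntegral (fun s => π s i * π s j / (S s i * S s j))
        (fun s => bracket P S s i j) t)

/-- The relative wealth `V^π = W^π / W^μ`. -/
noncomputable def relativeWealth {d : ℕ} (q r : ℝ) (P : ℕ → HalfLinePartition)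
    (S π : ℝ → EuclideanSpace ℝ (Fin d)) (t : ℝ) : ℝ :=
  wealth q r P S π t / wealth q r P S (market S) t

/-- The market covariance `a^{ij}(ds) = (S^i_s S^j_s)⁻¹ d[𝐒]^{ij}_s`, represented by its
distribution function `t ↦ a^{ij}([0, t])`. -/
noncomputable def covariance {d : ℕ} (P : ℕ → HalfLinePartition)
    (S : ℝ → EuclideanSpace ℝ (Fin d)) (i j : Fin d) (t : ℝ) : ℝ :=
  stieltjesIntegral (fun s => 1 / (S s i * S s j)) (fun s => bracket P S s i j) t

/-- The `k`-th coordinate of `π_s - e_i`. -/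
noncomputable def excess {d : ℕ} (π : ℝ → EuclideanSpace ℝ (Fin d)) (i k : Fin d) (s : ℝ) : ℝ :=
  π s k - if k = i then 1 else 0

/-- The relative covariance `τ^π_{ij}(ds) = (π_s - e_i)ᵀ a(ds) (π_s - e_j)` of `π`, represented by
its distribution function `t ↦ τ^π_{ij}([0, t])`. -/
noncomputable def relativeCovariance {d : ℕ} (P : ℕ → HalfLinePartition)
    (S π : ℝ → EuclideanSpace ℝ (Fin d)) (i j : Fin d) (t : ℝ) : ℝ :=
  ∑ k, ∑ l, stieltjesIntegral (fun s => excess π i k s * excess π j l s) (covariance P S k l) t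

end PathwisePortfolio

open PathwisePortfolio

/-!
The formula is an exact algebraic identity over a single interval, summed along the given
partitions and passed to the limit. Over an interval with prices `x` and `x'` at its ends, let `y`
be the return of the portfolio and `m` the return of the total capitalization. The second-order
logarithmic returns are `y - y² / 2` and `m - m² / 2`, the return in units of the total
capitalization is `(y - m) / (1 + m)`, and the quadratic form of the relative covariance is
`(y - m)²`; the two sides of the formula differ by `(y - m) m² / (1 + m)`
(`change_of_numeraire_identity`). This is of third order, and does not contribute since `p < 3`
(`IsPricePath.isSewing_third_order`).

To pass to the limit, all integrals have to be limits of the corresponding sums along the given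
partitions. Integrals are constructed from their germs by sewing (`Sewable.exists_isSewing`, based
on `discrete_sewing`); controls are not assumed to be continuous, and smallness over short
intervals is supplied by the continuity of the paths instead. A rough integral is then the limit of
its compensated Riemann sums. Property (RIE) makes the compensating terms vanish along the given
partitions (`IsPricePath.tendstoUniformlyOn_germSum_secondLevel`): there, the second level is the
increment of the difference between `∫ S ⊗ dS` and its Riemann sums, which tends to zero uniformly
and is bounded in `p/2`-variation, so that Young's estimate applies. Hence rough integrals are
limits of left-point Riemann sums. These do not involve Gubinelli derivatives, so that the value of
an integral does not depend on their choice
(`IsPricePath.tendsto_leftSum_of_hasRoughIntegral`). For the same reason integrals against the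
bracket are limits of sums of squared increments (`IsPricePath.tendsto_germSum_sq`), and the bracket
is of finite variation by polarization.

The portfolio `μ` and the quotients are controlled since controlled paths are stable under products
and inverses (`IsScalarControlled.mul`, `IsScalarControlled.inv`).
-/

namespace PathwisePortfolio

/-! ### Controls -/

namespace IsControl

variable {T : ℝ} {c c' : ℝ → ℝ → ℝ}

theorem nonneg (h : IsControl T c) {s t : ℝ} (hs : 0 ≤ s) (hst : s ≤ t) (ht : t ≤ T) :
    0 ≤ c s t := h.1 s t hs hst ht

theorem self_eq_zero (h : IsControl T c) {s : ℝ} (hs : 0 ≤ s) (hT : s ≤ T) : c s s = 0 := by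
  have h1 := h.2 s s s hs le_rfl le_rfl hT
  have h2 := h.1 s s hs le_rfl hT
  linarith

theorem mono (h : IsControl T c) {s s' t' t : ℝ} (hs : 0 ≤ s) (h1 : s ≤ s') (h2 : s' ≤ t')
    (h3 : t' ≤ t) (ht : t ≤ T) : c s' t' ≤ c s t := by
  have a1 := h.2 s s' t hs h1 (h2.trans h3) ht
  have a2 := h.2 s' t' t (hs.trans h1) h2 h3 ht
  have a3 := h.1 s s' hs h1 ((h2.trans h3).trans ht)
  have a4 := h.1 t' t ((hs.trans h1).trans h2) h3 ht
  linarith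

theorem restrict (h : IsControl T c) {T' : ℝ} (hT : T' ≤ T) : IsControl T' c :=
  ⟨fun s t hs hst ht => h.1 s t hs hst (ht.trans hT),
    fun s u t hs hsu hut ht => h.2 s u t hs hsu hut (ht.trans hT)⟩

theorem add (h : IsControl T c) (h' : IsControl T c') :
    IsControl T fun s t => c s t + c' s t :=
  ⟨fun s t hs hst ht => add_nonneg (h.1 s t hs hst ht) (h'.1 s t hs hst ht),
    fun s u t hs hsu hut ht => by
      have h1 := h.2 s u t hs hsu hut ht
      have h2 := h'.2 s u t hs hsu hut ht
      linarith⟩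

theorem const_mul (h : IsControl T c) {C : ℝ} (hC : 0 ≤ C) :
    IsControl T fun s t => C * c s t :=
  ⟨fun s t hs hst ht => mul_nonneg hC (h.1 s t hs hst ht),
    fun s u t hs hsu hut ht => by
      rw [← mul_add]
      exact mul_le_mul_of_nonneg_left (h.2 s u t hs hsu hut ht) hC⟩

theorem rpow (h : IsControl T c) {θ : ℝ} (hθ : 1 ≤ θ) :
    IsControl T fun s t => c s t ^ θ :=
  ⟨fun s t hs hst ht => Real.rpow_nonneg (h.1 s t hs hst ht) _,
    fun s u t hs hsu hut ht => by
      have h1 := h.1 s u hs hsu (hut.trans ht)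
      have h2 := h.1 u t (hs.trans hsu) hut ht
      exact (Real.add_rpow_le_rpow_add h1 h2 hθ).trans
        (Real.rpow_le_rpow (add_nonneg h1 h2) (h.2 s u t hs hsu hut ht) (by linarith))⟩

theorem zero : IsControl T fun _ _ => 0 :=
  ⟨fun _ _ _ _ _ => le_rfl, fun _ _ _ _ _ _ _ => by simp⟩

theorem sum_le (h : IsControl T c) {u : ℕ → ℝ} (hu : Monotone u) (h0 : 0 ≤ u 0) (N : ℕ)
    (hN : u N ≤ T) : ∑ k ∈ Finset.range N, c (u k) (u (k + 1)) ≤ c (u 0) (u N) := by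
  induction N with
  | zero => simpa using h.1 _ _ h0 le_rfl hN
  | succ n ih =>
    rw [Finset.sum_range_succ]
    have hn := hu (Nat.le_succ n)
    have := h.2 _ _ _ h0 (hu (Nat.zero_le n)) hn hN
    linarith [ih (hn.trans hN)]

end IsControl

/-! ### Sewing -/

/-- The increment of a path over each short interval is close to a germ `Ξ`: the error is
`o(1)` times a control. The path `I` is then the integral with germ `Ξ`. -/
def IsSewing (T : ℝ) (Ξ : ℝ → ℝ → ℝ) (I : ℝ → ℝ) : Prop :=
  ∃ c, IsControl T c ∧ ∀ ε > 0, ∃ δ > 0, ∀ s t, 0 ≤ s → s ≤ t → t ≤ T → t - s ≤ δ →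
    |I t - I s - Ξ s t| ≤ ε * c s t

/-- Over short intervals, replacing a germ by its sum along a subdivision produces an error which
is `o(1)` times a control. -/
def Sewable (T : ℝ) (Ξ : ℝ → ℝ → ℝ) : Prop :=
  ∃ c, IsControl T c ∧ ∀ ε > 0, ∃ δ > 0, ∀ (u : ℕ → ℝ) (N : ℕ), Monotone u → 0 ≤ u 0 → u N ≤ T →
    u N - u 0 ≤ δ →
      |∑ k ∈ Finset.range N, Ξ (u k) (u (k + 1)) - Ξ (u 0) (u N)| ≤ ε * c (u 0) (u N)

/-- The constant in the discrete sewing lemma. -/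
noncomputable def sewConst (θ : ℝ) : ℝ := 2 / (1 - 2 ^ (1 - θ))

theorem sewConst_aux {θ : ℝ} (hθ : 1 < θ) : (2 : ℝ) ^ (1 - θ) < 1 :=
  Real.rpow_lt_one_of_one_lt_of_neg (by norm_num) (by linarith)

theorem sewConst_nonneg {θ : ℝ} (hθ : 1 < θ) : 0 ≤ sewConst θ :=
  div_nonneg (by norm_num) (by linarith [sewConst_aux hθ])

/-- The recursion `K 2^{1-θ} + 2 = K` which closes the induction in the discrete sewing lemma. -/
theorem sewConst_spec {θ : ℝ} (hθ : 1 < θ) : sewConst θ * 2 ^ (1 - θ) + 2 = sewConst θ := by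
  have h : (1 : ℝ) - 2 ^ (1 - θ) ≠ 0 := by linarith [sewConst_aux hθ]
  unfold sewConst
  field_simp
  ring

/-- Between `i` and `j` there is an index step which splits off at most half of the control on
either side. -/
theorem exists_bisecting_step {N : ℕ} {ω : ℕ → ℕ → ℝ}
    (hω0 : ∀ i j, i ≤ j → j ≤ N → 0 ≤ ω i j)
    (hω : ∀ i j k, i ≤ j → j ≤ k → k ≤ N → ω i j + ω j k ≤ ω i k) {i j : ℕ} (hij : i < j)
    (hj : j ≤ N) :
    ∃ m, i ≤ m ∧ m < j ∧ ω i m ≤ ω i j / 2 ∧ ω (m + 1) j ≤ ω i j / 2 := by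
  classical
  have hW := hω0 i j hij.le hj
  have hself : ∀ k ≤ N, ω k k = 0 := fun k hk => by
    have h1 := hω k k k le_rfl le_rfl hk
    have h2 := hω0 k k le_rfl hk
    linarith
  have hex : ∃ m, i < m ∧ (ω i j / 2 < ω i m ∨ m = j) := ⟨j, hij, Or.inr rfl⟩
  obtain ⟨h1, h2⟩ := Nat.find_spec hex
  have h3 : Nat.find hex ≤ j := Nat.find_min' hex ⟨hij, Or.inr rfl⟩
  have h4 := fun m (hm : m < Nat.find hex) => Nat.find_min hex hm
  generalize Nat.find hex = n at h1 h2 h3 h4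
  obtain ⟨m, rfl⟩ : ∃ m, n = m + 1 := ⟨n - 1, by omega⟩
  refine ⟨m, by omega, by omega, ?_, ?_⟩
  · rcases eq_or_lt_of_le (show i ≤ m by omega) with rfl | him
    · rw [hself i (by omega)]; linarith
    · by_contra hcon
      exact h4 m (by omega) ⟨him, Or.inl (not_le.mp hcon)⟩
  · rcases h2 with h2 | rfl
    · linarith [hω i (m + 1) j (by omega) h3 hj]
    · rw [hself _ hj]; linarith

/-- The discrete sewing lemma: a two-index germ whose defect of additivity is at most `ε ω^θ`
with `θ > 1` differs from its sum over consecutive indices by at most `K ε ω^θ`. -/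
theorem discrete_sewing {θ : ℝ} (hθ : 1 < θ) {N : ℕ} {Ξ ω : ℕ → ℕ → ℝ} {ε : ℝ} (hε : 0 ≤ ε)
    (hω0 : ∀ i j, i ≤ j → j ≤ N → 0 ≤ ω i j)
    (hω : ∀ i j k, i ≤ j → j ≤ k → k ≤ N → ω i j + ω j k ≤ ω i k)
    (hd : ∀ i ≤ N, Ξ i i = 0)
    (hΞ : ∀ i j k, i ≤ j → j ≤ k → k ≤ N → |Ξ i k - Ξ i j - Ξ j k| ≤ ε * ω i k ^ θ)
    {i j : ℕ} (hij : i ≤ j) (hj : j ≤ N) :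
    |∑ l ∈ Finset.Ico i j, Ξ l (l + 1) - Ξ i j| ≤ sewConst θ * ε * ω i j ^ θ := by
  obtain ⟨n, hn⟩ : ∃ n, n = j - i := ⟨_, rfl⟩
  induction n using Nat.strong_induction_on generalizing i j with
  | _ n ih =>
  have hK := sewConst_nonneg hθ
  have hW := hω0 i j hij hj
  rcases eq_or_lt_of_le hij with rfl | hlt
  · simp only [Finset.Ico_self, Finset.sum_empty, hd i hj, sub_zero, abs_zero]
    exact mul_nonneg (mul_nonneg hK hε) (Real.rpow_nonneg hW _)
  obtain ⟨m, him, hmj, hl, hr⟩ := exists_bisecting_step hω0 hω hlt hj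
  have e1 := ih (m - i) (by omega) him (by omega) rfl
  have e2 := ih (j - (m + 1)) (by omega) (show m + 1 ≤ j by omega) hj rfl
  have e3 := hΞ i m j him hmj.le hj
  have e4 := hΞ m (m + 1) j (by omega) hmj hj
  have e5 : ω m j ≤ ω i j := by linarith [hω i m j him hmj.le hj, hω0 i m him (by omega)]
  have hsum : ∑ l ∈ Finset.Ico i j, Ξ l (l + 1) = ∑ l ∈ Finset.Ico i m, Ξ l (l + 1) + Ξ m (m + 1)
      + ∑ l ∈ Finset.Ico (m + 1) j, Ξ l (l + 1) := by
    rw [← Finset.sum_Ico_consecutive _ him hmj.le, Finset.sum_eq_sum_Ico_succ_bot hmj, add_assoc]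
  have hpow : ∀ x, 0 ≤ x → x ≤ ω i j / 2 → x ^ θ ≤ ω i j ^ θ * 2 ^ (-θ) := fun x hx hx' => by
    refine (Real.rpow_le_rpow hx hx' (by linarith)).trans (le_of_eq ?_)
    rw [Real.div_rpow hW (by norm_num), Real.rpow_neg (by norm_num), div_eq_mul_inv]
  have f1 := hpow _ (hω0 i m him (by omega)) hl
  have f2 := hpow _ (hω0 (m + 1) j (by omega) hj) hr
  have f4 : ω m j ^ θ ≤ ω i j ^ θ := Real.rpow_le_rpow (hω0 m j hmj.le hj) e5 (by linarith)
  have h2 : (2 : ℝ) ^ (1 - θ) = 2 * 2 ^ (-θ) := by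
    rw [sub_eq_add_neg, Real.rpow_add (by norm_num), Real.rpow_one]
  have hKε : 0 ≤ sewConst θ * ε := mul_nonneg hK hε
  have hspec := sewConst_spec hθ
  calc |∑ l ∈ Finset.Ico i j, Ξ l (l + 1) - Ξ i j|
      = |(∑ l ∈ Finset.Ico i m, Ξ l (l + 1) - Ξ i m)
          + (∑ l ∈ Finset.Ico (m + 1) j, Ξ l (l + 1) - Ξ (m + 1) j)
          - (Ξ i j - Ξ i m - Ξ m j) - (Ξ m j - Ξ m (m + 1) - Ξ (m + 1) j)| := by
        rw [hsum]; congr 1; ring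
    _ ≤ sewConst θ * ε * ω i m ^ θ + sewConst θ * ε * ω (m + 1) j ^ θ
          + ε * ω i j ^ θ + ε * ω m j ^ θ := by
        refine (abs_sub _ _).trans (add_le_add ((abs_sub _ _).trans (add_le_add
          ((abs_add_le _ _).trans (add_le_add e1 e2)) e3)) e4)
    _ ≤ sewConst θ * ε * (ω i j ^ θ * 2 ^ (-θ)) + sewConst θ * ε * (ω i j ^ θ * 2 ^ (-θ))
          + ε * ω i j ^ θ + ε * ω i j ^ θ := by
        gcongr
    _ = (sewConst θ * 2 ^ (1 - θ) + 2) * ε * ω i j ^ θ := by rw [h2]; ring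
    _ = sewConst θ * ε * ω i j ^ θ := by rw [hspec]

/-- The projection of `x` onto `[a, b]`. -/
noncomputable def clamp (a b x : ℝ) : ℝ := max a (min b x)

theorem clamp_mono (a b : ℝ) : Monotone (clamp a b) := fun _ _ h =>
  max_le_max le_rfl (min_le_min le_rfl h)

theorem clamp_of_le {a b x : ℝ} (hab : a ≤ b) (h : x ≤ a) : clamp a b x = a := by
  unfold clamp; rw [min_eq_right (h.trans hab), max_eq_left h]

theorem clamp_of_ge {a b x : ℝ} (hab : a ≤ b) (h : b ≤ x) : clamp a b x = b := by
  unfold clamp; rw [min_eq_left h, max_eq_right hab]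

theorem clamp_mem {a b : ℝ} (hab : a ≤ b) (x : ℝ) : clamp a b x ∈ Icc a b :=
  ⟨le_max_left _ _, max_le hab (min_le_left _ _)⟩

/-- A germ vanishing on the diagonal, evaluated on the intersection of two intervals: the
intersection may be obtained by clamping either interval to the other one. -/
theorem germ_clamp_comm {T : ℝ} {Ξ : ℝ → ℝ → ℝ} (hd : ∀ x, 0 ≤ x → x ≤ T → Ξ x x = 0)
    {a b c d : ℝ} (ha : 0 ≤ a) (hab : a ≤ b) (hb : b ≤ T) (hc : 0 ≤ c) (hcd : c ≤ d) (hd' : d ≤ T) :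
    Ξ (clamp a b c) (clamp a b d) = Ξ (clamp c d a) (clamp c d b) := by
  rcases le_total b c with h | h
  · rw [clamp_of_ge hab h, clamp_of_ge hab (h.trans hcd), clamp_of_le hcd (hab.trans h),
      clamp_of_le hcd h, hd b (ha.trans hab) hb, hd c hc (hcd.trans hd')]
  rcases le_total d a with h' | h'
  · rw [clamp_of_le hab h', clamp_of_le hab (hcd.trans h'), clamp_of_ge hcd h',
      clamp_of_ge hcd (h'.trans hab), hd a ha (hab.trans hb), hd d (hc.trans hcd) hd']
  · unfold clamp
    rw [min_eq_right h, min_eq_right h', max_comm a c, max_eq_right (le_min hab h'),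
      max_eq_right (le_min hcd h), min_comm b d]

/-- Refining a sequence `v` of mesh at most `δ` by a sequence `u` changes the sum of a germ by at
most `ε c`. The common refinement is the double sum over the intersections of the intervals. -/
theorem abs_sum_sub_refined_le {T : ℝ} {Ξ c : ℝ → ℝ → ℝ} (hc : IsControl T c) {ε δ : ℝ}
    (hε : 0 ≤ ε)
    (hΞ : ∀ (u : ℕ → ℝ) (N : ℕ), Monotone u → 0 ≤ u 0 → u N ≤ T → u N - u 0 ≤ δ →
      |∑ k ∈ Finset.range N, Ξ (u k) (u (k + 1)) - Ξ (u 0) (u N)| ≤ ε * c (u 0) (u N))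
    {u v : ℕ → ℝ} {N M : ℕ} (hv : Monotone v) (hu : Monotone u) (hv0 : 0 ≤ v 0) (hvM : v M ≤ T)
    (h0 : u 0 ≤ v 0) (hN : v M ≤ u N) (hgap : ∀ k < M, v (k + 1) - v k ≤ δ) :
    |∑ k ∈ Finset.range M, Ξ (v k) (v (k + 1)) - ∑ k ∈ Finset.range M, ∑ i ∈ Finset.range N,
      Ξ (clamp (v k) (v (k + 1)) (u i)) (clamp (v k) (v (k + 1)) (u (i + 1)))|
      ≤ ε * c (v 0) (v M) := by
  rw [← Finset.sum_sub_distrib]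
  refine (Finset.abs_sum_le_sum_abs _ _).trans ?_
  refine (Finset.sum_le_sum (g := fun k => ε * c (v k) (v (k + 1))) fun k hk => ?_).trans ?_
  · have hk : k < M := Finset.mem_range.mp hk
    have hvk := hv (Nat.le_succ k)
    have e0 : clamp (v k) (v (k + 1)) (u 0) = v k :=
      clamp_of_le hvk (h0.trans (hv (Nat.zero_le k)))
    have e1 : clamp (v k) (v (k + 1)) (u N) = v (k + 1) :=
      clamp_of_ge hvk ((hv (show k + 1 ≤ M by omega)).trans hN)
    have := hΞ (fun i => clamp (v k) (v (k + 1)) (u i)) N ((clamp_mono _ _).comp hu)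
      (by rw [e0]; exact hv0.trans (hv (Nat.zero_le k)))
      (by rw [e1]; exact (hv (show k + 1 ≤ M by omega)).trans hvM)
      (by rw [e0, e1]; exact hgap k hk)
    rw [e0, e1] at this
    rwa [abs_sub_comm]
  · rw [← Finset.mul_sum]
    exact mul_le_mul_of_nonneg_left (hc.sum_le hv hv0 M hvM) hε

theorem sum_clamp_comm {T : ℝ} {Ξ : ℝ → ℝ → ℝ} (hd : ∀ x, 0 ≤ x → x ≤ T → Ξ x x = 0)
    {u v : ℕ → ℝ} {N M : ℕ} (hv : Monotone v) (hu : Monotone u) (hv0 : 0 ≤ v 0) (hvM : v M ≤ T)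
    (hu0 : 0 ≤ u 0) (huN : u N ≤ T) :
    ∑ k ∈ Finset.range M, ∑ i ∈ Finset.range N,
      Ξ (clamp (v k) (v (k + 1)) (u i)) (clamp (v k) (v (k + 1)) (u (i + 1))) =
    ∑ i ∈ Finset.range N, ∑ k ∈ Finset.range M,
      Ξ (clamp (u i) (u (i + 1)) (v k)) (clamp (u i) (u (i + 1)) (v (k + 1))) := by
  rw [Finset.sum_comm]
  refine Finset.sum_congr rfl fun i hi => Finset.sum_congr rfl fun k hk => ?_
  rw [Finset.mem_range] at hi hk
  exact germ_clamp_comm hd (hv0.trans (hv (Nat.zero_le _))) (hv (Nat.le_succ _))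
    ((hv (show k + 1 ≤ M by omega)).trans hvM) (hu0.trans (hu (Nat.zero_le _)))
    (hu (Nat.le_succ _)) ((hu (show i + 1 ≤ N by omega)).trans huN)

/-- The points `0, 1/(n+1), 2/(n+1), …`, stopped at `t`. -/
noncomputable def stoppedGrid (n : ℕ) (t : ℝ) (k : ℕ) : ℝ := min ((k : ℝ) / (n + 1)) t

theorem stoppedGrid_mono (n : ℕ) (t : ℝ) : Monotone (stoppedGrid n t) := fun i j h =>
  min_le_min (by gcongr) le_rfl

theorem stoppedGrid_zero (n : ℕ) {t : ℝ} (ht : 0 ≤ t) : stoppedGrid n t 0 = 0 := by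
  simp [stoppedGrid, ht]

theorem stoppedGrid_last (n : ℕ) {t T : ℝ} (ht : t ≤ T) :
    stoppedGrid n t ((n + 1) * ⌈T⌉₊) = t := by
  refine min_eq_right ?_
  have : ((n : ℝ) + 1) ≠ 0 := by positivity
  push_cast
  rw [mul_div_cancel_left₀ _ this]
  exact ht.trans (Nat.le_ceil T)

theorem stoppedGrid_gap (n : ℕ) (t : ℝ) (k : ℕ) :
    stoppedGrid n t (k + 1) - stoppedGrid n t k ≤ 1 / (n + 1) := by
  have h : ((k + 1 : ℕ) : ℝ) / (n + 1) = k / (n + 1) + 1 / (n + 1) := by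
    push_cast; ring
  have h0 : (0 : ℝ) ≤ 1 / (n + 1) := by positivity
  unfold stoppedGrid
  rw [h]
  rcases le_total ((k : ℝ) / (n + 1)) t with h1 | h1
  · rw [min_eq_left h1]
    linarith [min_le_left ((k : ℝ) / (n + 1) + 1 / (n + 1)) t]
  · rw [min_eq_right h1]
    linarith [min_le_right ((k : ℝ) / (n + 1) + 1 / (n + 1)) t]

/-- The sewing lemma: the sums of a sewable germ along fine subdivisions converge, and the limits
are the increments of a path. -/
theorem Sewable.exists_isSewing {T : ℝ} {Ξ : ℝ → ℝ → ℝ} (h : Sewable T Ξ) :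
    ∃ I, I 0 = 0 ∧ IsSewing T Ξ I := by
  obtain ⟨c, hc, hΞ⟩ := h
  have hd : ∀ x, 0 ≤ x → x ≤ T → Ξ x x = 0 := fun x hx hx' => by
    obtain ⟨δ, hδ, h⟩ := hΞ 1 one_pos
    have := h (fun _ => x) 0 (fun _ _ _ => le_rfl) hx hx' (by simpa using hδ.le)
    simpa [hc.self_eq_zero hx hx'] using this
  set M : ℕ → ℕ := fun n => (n + 1) * ⌈T⌉₊ with hM
  set a : ℝ → ℕ → ℝ := fun t n => ∑ k ∈ Finset.range (M n),
    Ξ (stoppedGrid n t k) (stoppedGrid n t (k + 1)) with ha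
  have hsmall : ∀ δ > 0, ∀ᶠ n : ℕ in atTop, 1 / ((n : ℝ) + 1) ≤ δ := fun δ hδ =>
    (tendsto_one_div_add_atTop_nhds_zero_nat.eventually (gt_mem_nhds hδ)).mono fun _ h => h.le
  have hcau : ∀ t, 0 ≤ t → t ≤ T → CauchySeq (a t) := fun t h0 ht => by
    have hct := hc.nonneg le_rfl h0 ht
    refine Metric.cauchySeq_iff'.mpr fun ε hε => ?_
    obtain ⟨δ, hδ, h⟩ := hΞ (ε / (4 * (c 0 t + 1))) (by positivity)
    obtain ⟨n₀, hn₀⟩ := eventually_atTop.mp (hsmall δ hδ)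
    refine ⟨n₀, fun n hn => ?_⟩
    have key : ∀ n m, n₀ ≤ n → |a t n - ∑ k ∈ Finset.range (M n), ∑ i ∈ Finset.range (M m),
        Ξ (clamp (stoppedGrid n t k) (stoppedGrid n t (k + 1)) (stoppedGrid m t i))
          (clamp (stoppedGrid n t k) (stoppedGrid n t (k + 1)) (stoppedGrid m t (i + 1)))|
          ≤ ε / (4 * (c 0 t + 1)) * c 0 t := fun n m hn => by
      have := abs_sum_sub_refined_le hc (by positivity) h (stoppedGrid_mono n t)
        (stoppedGrid_mono m t) (N := M m) (M := M n) (stoppedGrid_zero n h0).ge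
        ((stoppedGrid_last n ht).le.trans ht)
        (by rw [stoppedGrid_zero n h0, stoppedGrid_zero m h0])
        (by rw [stoppedGrid_last n ht, stoppedGrid_last m ht])
        (fun k _ => (stoppedGrid_gap n t k).trans (hn₀ n hn))
      rwa [stoppedGrid_zero n h0, stoppedGrid_last n ht] at this
    have k1 := key n n₀ hn
    have k2 := key n₀ n le_rfl
    rw [← sum_clamp_comm hd (stoppedGrid_mono n t) (stoppedGrid_mono n₀ t)
      (stoppedGrid_zero n h0).ge ((stoppedGrid_last n ht).le.trans ht) (stoppedGrid_zero n₀ h0).ge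
      ((stoppedGrid_last n₀ ht).le.trans ht)] at k2
    have hlt : ε / (4 * (c 0 t + 1)) * c 0 t ≤ ε / 4 := by
      rw [div_mul_eq_mul_div, div_le_div_iff₀ (by positivity) (by norm_num)]
      nlinarith
    rw [Real.dist_eq]
    rw [abs_le] at k1 k2
    rw [abs_lt]
    constructor <;> linarith
  refine ⟨fun t => limUnder atTop (a t), ?_, c, hc, fun ε hε => ?_⟩
  · refine Tendsto.limUnder_eq (tendsto_const_nhds.congr fun n => (Finset.sum_eq_zero
      fun k hk => ?_).symm)
    have : ∀ k, stoppedGrid n 0 k = 0 := fun k => min_eq_right (by positivity)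
    rw [this, this]
    by_cases hT : 0 ≤ T
    · exact hd 0 le_rfl hT
    · simp [hM, Nat.ceil_eq_zero.mpr (not_le.mp hT).le] at hk
  obtain ⟨δ, hδ, h⟩ := hΞ ε hε
  refine ⟨δ, hδ, fun s t hs hst ht hδst => ?_⟩
  have ht0 := hs.trans hst
  have hct := hc.nonneg le_rfl ht0 ht
  have lim := ((hcau t ht0 ht).tendsto_limUnder.sub
    (hcau s hs (hst.trans ht)).tendsto_limUnder).sub_const (Ξ s t)
  refine le_of_forall_pos_le_add fun η hη => ?_
  obtain ⟨δ', hδ', h'⟩ := hΞ (η / (c 0 t + 1)) (by positivity)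
  refine le_of_tendsto lim.abs ((hsmall δ' hδ').mono fun n hn => ?_)
  -- the partition `{0, s, t}` splits the stopped grid at `t` into its parts before and after `s`
  set v : ℕ → ℝ := fun k => if k = 0 then 0 else if k = 1 then s else t with hv
  have hvm : Monotone v := monotone_nat_of_le_succ fun k => by
    rcases k with _ | _ | k <;> simp [hv, hs, hst]
  have e1 := abs_sum_sub_refined_le hc (by positivity) h' (stoppedGrid_mono n t) hvm (N := 2)
    (M := M n) (stoppedGrid_zero n ht0).ge ((stoppedGrid_last n ht).le.trans ht)
    (by rw [stoppedGrid_zero n ht0]; simp [hv]) (by rw [stoppedGrid_last n ht]; simp [hv])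
    (fun k _ => (stoppedGrid_gap n t k).trans hn)
  rw [sum_clamp_comm hd (stoppedGrid_mono n t) hvm
    (stoppedGrid_zero n ht0).ge ((stoppedGrid_last n ht).le.trans ht) (by simp [hv])
    (by simpa [hv] using ht), stoppedGrid_zero n ht0, stoppedGrid_last n ht,
    Finset.sum_range_succ, Finset.sum_range_one] at e1
  have hv0 : v 0 = 0 := by simp [hv]
  have hv1 : v (0 + 1) = s := by simp [hv]
  have hv2 : v (1 + 1) = t := by simp [hv]
  rw [hv0, hv1, hv2] at e1
  have e2 : ∀ k, clamp 0 s (stoppedGrid n t k) = stoppedGrid n s k := fun k => by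
    unfold clamp stoppedGrid
    rw [min_left_comm, min_eq_left hst, max_eq_right (le_min (by positivity) hs)]
  simp only [e2] at e1
  have e3 := h (fun k => clamp s t (stoppedGrid n t k)) (M n)
    ((clamp_mono s t).comp (stoppedGrid_mono n t))
    (hs.trans (clamp_mem hst _).1) ((clamp_mem hst _).2.trans ht)
    (by
      rw [stoppedGrid_last n ht, stoppedGrid_zero n ht0, clamp_of_ge hst le_rfl,
        clamp_of_le hst hs]
      exact hδst)
  rw [stoppedGrid_last n ht, stoppedGrid_zero n ht0, clamp_of_ge hst le_rfl,
        clamp_of_le hst hs] at e3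
  have hlt : η / (c 0 t + 1) * c 0 t ≤ η := by
    rw [div_mul_eq_mul_div, div_le_iff₀ (by positivity)]
    nlinarith
  simp only [ha]
  rw [abs_le] at e1 e3 ⊢
  constructor <;> linarith

end PathwisePortfolio

namespace PathwisePortfolio

/-! ### Sums along partitions -/

/-- The sum of a germ over the intervals of a partition. -/
noncomputable def Partition.germSum {T : ℝ} (D : Partition T) (Ξ : ℝ → ℝ → ℝ) : ℝ :=
  ∑ k ∈ Finset.range D.N, Ξ (D.pt k) (D.pt (k + 1))

/-- The points of a partition, continued by a constant sequence. -/
theorem Partition.monotone_stopped {T : ℝ} (D : Partition T) :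
    Monotone fun k => D.pt (min k D.N) :=
  monotone_nat_of_le_succ fun k => by
    rcases lt_or_ge k D.N with h | h
    · rw [min_eq_left h.le, min_eq_left (Nat.succ_le_of_lt h)]
      exact (D.pt_lt k h).le
    · rw [min_eq_right h, min_eq_right (h.trans (Nat.le_succ k))]

theorem Partition.germSum_eq_stopped {T : ℝ} (D : Partition T) (Ξ : ℝ → ℝ → ℝ) :
    D.germSum Ξ =
      ∑ k ∈ Finset.range D.N, Ξ (D.pt (min k D.N)) (D.pt (min (k + 1) D.N)) :=
  Finset.sum_congr rfl fun k hk => by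
    have hk := Finset.mem_range.mp hk
    rw [min_eq_left hk.le, min_eq_left (Nat.succ_le_of_lt hk)]

theorem Partition.gap_le_mesh {T : ℝ} (D : Partition T) {k : ℕ} (hk : k < D.N) :
    D.pt (k + 1) - D.pt k ≤ D.mesh :=
  le_ciSup (f := fun k : Fin D.N => D.pt (k + 1) - D.pt k) (Set.finite_range _).bddAbove ⟨k, hk⟩

theorem eventually_mesh_le {T δ : ℝ} (hδ : 0 < δ) : ∀ᶠ D in meshFilter T, D.mesh ≤ δ :=
  (tendsto_comap.eventually (gt_mem_nhds hδ)).mono fun _ h => h.le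

/-- The partition of `[0, T]` into `n + 1` intervals of equal length. -/
noncomputable def Partition.uniform {T : ℝ} (hT : 0 < T) (n : ℕ) : Partition T where
  N := n + 1
  pt k := k * (T / (n + 1))
  pt_zero := by simp
  pt_last := by push_cast; field_simp
  pt_lt k _ := by
    have : 0 < T / ((n : ℝ) + 1) := by positivity
    push_cast; linarith

/-- The partition of the degenerate interval `[0, 0]`. -/
def Partition.trivial : Partition 0 where
  N := 0
  pt _ := 0
  pt_zero := rfl
  pt_last := rfl
  pt_lt _ h := absurd h (Nat.not_lt_zero _)

theorem meshFilter_neBot {T : ℝ} (hT : 0 ≤ T) : (meshFilter T).NeBot := by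
  refine comap_neBot_iff_frequently.mpr (Filter.frequently_iff.mpr fun {U} hU => ?_)
  rcases eq_or_lt_of_le hT with rfl | hT
  · refine ⟨0, mem_of_mem_nhds hU, Partition.trivial, ?_⟩
    have : IsEmpty (Fin Partition.trivial.N) := Fin.isEmpty
    exact Real.iSup_of_isEmpty _
  · have hlim : Tendsto (fun n : ℕ => T * (1 / ((n : ℝ) + 1))) atTop (𝓝 0) := by
      simpa using tendsto_one_div_add_atTop_nhds_zero_nat.const_mul T
    obtain ⟨n, hn⟩ := (hlim.eventually hU).exists
    refine ⟨_, hn, Partition.uniform hT n, ?_⟩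
    have : Nonempty (Fin (Partition.uniform hT n).N) := ⟨⟨0, Nat.succ_pos n⟩⟩
    have h : ∀ k : Fin (Partition.uniform hT n).N,
        (Partition.uniform hT n).pt (k + 1) - (Partition.uniform hT n).pt k
          = T * (1 / ((n : ℝ) + 1)) := fun k => by
      simp only [Partition.uniform]; push_cast; ring
    unfold Partition.mesh
    simp_rw [h]
    exact ciSup_const

/-- Sums of a germ along fine subdivisions approximate its integral, at a rate which depends only
on the mesh size. -/
theorem IsSewing.exists_sum_approx {T : ℝ} {Ξ : ℝ → ℝ → ℝ} {I : ℝ → ℝ} (h : IsSewing T Ξ I)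
    {ε : ℝ} (hε : 0 < ε) :
    ∃ δ > 0, ∀ (u : ℕ → ℝ) (N : ℕ), Monotone u → 0 ≤ u 0 → u N ≤ T →
      (∀ k < N, u (k + 1) - u k ≤ δ) →
      |∑ k ∈ Finset.range N, Ξ (u k) (u (k + 1)) - (I (u N) - I (u 0))| ≤ ε := by
  rcases lt_or_ge T 0 with hT | hT
  · exact ⟨1, one_pos, fun u N hu h0 hN _ =>
      absurd (h0.trans ((hu (Nat.zero_le N)).trans hN)) (not_le.mpr hT)⟩
  obtain ⟨c, hc, h⟩ := h
  have hcT := hc.nonneg le_rfl hT le_rfl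
  obtain ⟨δ, hδ, h⟩ := h (ε / (c 0 T + 1)) (by positivity)
  refine ⟨δ, hδ, fun u N hu h0 hN hgap => ?_⟩
  rw [← Finset.sum_range_sub (fun k => I (u k)), ← Finset.sum_sub_distrib]
  calc _ ≤ ∑ k ∈ Finset.range N, ε / (c 0 T + 1) * c (u k) (u (k + 1)) := by
        refine (Finset.abs_sum_le_sum_abs _ _).trans (Finset.sum_le_sum fun k hk => ?_)
        have hk := Finset.mem_range.mp hk
        rw [abs_sub_comm]
        exact h _ _ (h0.trans (hu (Nat.zero_le k))) (hu (Nat.le_succ k))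
          ((hu (Nat.succ_le_of_lt hk)).trans hN) (hgap k hk)
    _ ≤ ε / (c 0 T + 1) * c 0 T := by
        rw [← Finset.mul_sum]
        refine mul_le_mul_of_nonneg_left ((hc.sum_le hu h0 N hN).trans ?_) (by positivity)
        exact hc.mono le_rfl h0 (hu (Nat.zero_le N)) hN le_rfl
    _ ≤ ε := by
        rw [div_mul_eq_mul_div, div_le_iff₀ (by positivity)]
        nlinarith

theorem IsSewing.tendsto {T : ℝ} {Ξ : ℝ → ℝ → ℝ} {I : ℝ → ℝ} (h : IsSewing T Ξ I)
    {t : ℝ} (ht : t ≤ T) :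
    Tendsto (fun D : Partition t => D.germSum Ξ) (meshFilter t) (𝓝 (I t - I 0)) := by
  refine Metric.tendsto_nhds.mpr fun ε hε => ?_
  obtain ⟨δ, hδ, h⟩ := h.exists_sum_approx (half_pos hε)
  refine (eventually_mesh_le hδ).mono fun D hD => ?_
  have := h (fun k => D.pt (min k D.N)) D.N D.monotone_stopped
    (by simp [D.pt_zero]) (by simpa [D.pt_last] using ht) (fun k hk => by
      rw [min_eq_left hk.le, min_eq_left (Nat.succ_le_of_lt hk)]
      exact (D.gap_le_mesh hk).trans hD)
  rw [← D.germSum_eq_stopped Ξ] at this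
  simp only [min_self, D.pt_last, Nat.zero_min, D.pt_zero] at this
  rw [Real.dist_eq]
  linarith

/-- Two germs which differ by `o(1)` times a control have the same integral. -/
theorem IsSewing.congr_germ {T : ℝ} {Ξ Ξ' : ℝ → ℝ → ℝ} {I : ℝ → ℝ} (h : IsSewing T Ξ I)
    (h' : IsSewing T (fun s t => Ξ' s t - Ξ s t) 0) : IsSewing T Ξ' I := by
  obtain ⟨c, hc, h⟩ := h
  obtain ⟨c', hc', h'⟩ := h'
  refine ⟨_, hc.add hc', fun ε hε => ?_⟩
  obtain ⟨δ, hδ, h⟩ := h ε hε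
  obtain ⟨δ', hδ', h'⟩ := h' ε hε
  refine ⟨min δ δ', lt_min hδ hδ', fun s t hs hst ht hd => ?_⟩
  have h1 := h s t hs hst ht (hd.trans (min_le_left _ _))
  have h2 := h' s t hs hst ht (hd.trans (min_le_right _ _))
  simp only [Pi.zero_apply] at h2
  rw [abs_le] at *
  constructor <;> linarith

theorem IsSewing.congr_path {T : ℝ} {Ξ : ℝ → ℝ → ℝ} {I J : ℝ → ℝ} (h : IsSewing T Ξ I)
    (h' : ∀ t, 0 ≤ t → t ≤ T → J t = I t) : IsSewing T Ξ J := by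
  obtain ⟨c, hc, h⟩ := h
  refine ⟨c, hc, fun ε hε => ?_⟩
  obtain ⟨δ, hδ, h⟩ := h ε hε
  refine ⟨δ, hδ, fun s t hs hst ht hd => ?_⟩
  rw [h' t (hs.trans hst) ht, h' s hs (hst.trans ht)]
  exact h s t hs hst ht hd

theorem IsSewing.add {T : ℝ} {Ξ Ξ' : ℝ → ℝ → ℝ} {I I' : ℝ → ℝ} (h : IsSewing T Ξ I)
    (h' : IsSewing T Ξ' I') :
    IsSewing T (fun s t => Ξ s t + Ξ' s t) fun t => I t + I' t := by
  obtain ⟨c, hc, h⟩ := h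
  obtain ⟨c', hc', h'⟩ := h'
  refine ⟨_, hc.add hc', fun ε hε => ?_⟩
  obtain ⟨δ, hδ, h⟩ := h ε hε
  obtain ⟨δ', hδ', h'⟩ := h' ε hε
  refine ⟨min δ δ', lt_min hδ hδ', fun s t hs hst ht hd => ?_⟩
  have h1 := h s t hs hst ht (hd.trans (min_le_left _ _))
  have h2 := h' s t hs hst ht (hd.trans (min_le_right _ _))
  rw [abs_le] at *
  constructor <;> linarith

theorem IsSewing.zero (T : ℝ) : IsSewing T (fun _ _ => 0) 0 :=
  ⟨_, IsControl.zero, fun _ _ => ⟨1, one_pos, fun _ _ _ _ _ _ => by simp⟩⟩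

theorem IsSewing.sum {T : ℝ} {ι : Type*} (s : Finset ι) {Ξ : ι → ℝ → ℝ → ℝ} {I : ι → ℝ → ℝ}
    (h : ∀ i ∈ s, IsSewing T (Ξ i) (I i)) :
    IsSewing T (fun a b => ∑ i ∈ s, Ξ i a b) fun t => ∑ i ∈ s, I i t := by
  classical
  induction s using Finset.induction_on with
  | empty => simp only [Finset.sum_empty]; exact IsSewing.zero T
  | insert i s hi ih =>
    simp only [Finset.sum_insert hi]
    exact (h i (Finset.mem_insert_self i s)).add
      (ih fun j hj => h j (Finset.mem_insert_of_mem hj))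

namespace HalfLinePartition

variable (Q : HalfLinePartition)

open Classical in
/-- The sum of a germ over the intervals of `(Q ∪ {t}) ∩ [0, t]`. -/
noncomputable def germSum (Ξ : ℝ → ℝ → ℝ) (t : ℝ) : ℝ :=
  ∑ k ∈ Finset.range (Nat.find (Q.exists_le t)),
    Ξ (min (Q.pt k) t) (min (Q.pt (k + 1)) t)

theorem germSum_eq_restrict (Ξ : ℝ → ℝ → ℝ) {t : ℝ} (ht : 0 ≤ t) :
    Q.germSum Ξ t = (Q.restrict t ht).germSum Ξ := rfl

open Classical in
theorem pt_lt_of_lt_find {t : ℝ} {k : ℕ} (hk : k < Nat.find (Q.exists_le t)) : Q.pt k < t :=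
  not_le.mp (Nat.find_min (Q.exists_le t) hk)

open Classical in
theorem le_pt_of_find_le {t : ℝ} {k : ℕ} (hk : Nat.find (Q.exists_le t) ≤ k) : t ≤ Q.pt k :=
  (Nat.find_spec (Q.exists_le t)).trans (Q.strictMono.monotone hk)

theorem leftSum_eq_germSum (F G : ℝ → ℝ) (t : ℝ) :
    Q.leftSum F G t = Q.germSum (fun u v => F u * (G v - G u)) t := by
  classical
  unfold leftSum
  rw [tsum_eq_sum (s := Finset.range (Nat.find (Q.exists_le t)))]
  · refine Finset.sum_congr rfl fun k hk => ?_
    rw [min_eq_left (Q.pt_lt_of_lt_find (Finset.mem_range.mp hk)).le]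
  · intro k hk
    have hk : Nat.find (Q.exists_le t) ≤ k := by simpa using hk
    have h1 := Q.le_pt_of_find_le hk
    have h2 := Q.le_pt_of_find_le (hk.trans (Nat.le_succ k))
    rw [min_eq_right h1, min_eq_right h2, sub_self, mul_zero]

/-- A Riemann sum up to time `t` does not see the truncation of the partition at `T ≥ t`. -/
theorem restrict_leftSum (F G : ℝ → ℝ) {T t : ℝ} (hT : 0 ≤ T) (ht : t ≤ T) :
    (Q.restrict T hT).leftSum F G t = Q.leftSum F G t := by
  classical
  unfold leftSum
  rw [tsum_eq_sum (s := Finset.range (Nat.find (Q.exists_le T)))]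
  · refine Finset.sum_congr rfl fun k hk => ?_
    have hk := Finset.mem_range.mp hk
    have h := (Q.pt_lt_of_lt_find hk).le
    simp only [restrict]
    rw [min_assoc, min_eq_right ht, min_assoc, min_eq_right ht, min_eq_left h]
  · intro k hk
    have hk : Nat.find (Q.exists_le T) ≤ k := by simpa using hk
    have h1 := ht.trans (Q.le_pt_of_find_le hk)
    have h2 := ht.trans (Q.le_pt_of_find_le (hk.trans (Nat.le_succ k)))
    rw [min_eq_right h1, min_eq_right h2, sub_self, mul_zero]

theorem monotone_stopped (t : ℝ) : Monotone fun k => min (Q.pt k) t := fun _ _ h =>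
  min_le_min (Q.strictMono.monotone h) le_rfl

theorem germSum_add (Ξ Ξ' : ℝ → ℝ → ℝ) (t : ℝ) :
    Q.germSum (fun u v => Ξ u v + Ξ' u v) t = Q.germSum Ξ t + Q.germSum Ξ' t :=
  Finset.sum_add_distrib

theorem germSum_sum {ι : Type*} (s : Finset ι) (Ξ : ι → ℝ → ℝ → ℝ) (t : ℝ) :
    Q.germSum (fun u v => ∑ i ∈ s, Ξ i u v) t = ∑ i ∈ s, Q.germSum (Ξ i) t :=
  Finset.sum_comm

end HalfLinePartition

/-- A sequence of half-line partitions whose mesh size on compact intervals tends to zero. -/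
def MeshToZero (P : ℕ → HalfLinePartition) : Prop :=
  ∀ T, 0 ≤ T → ∀ δ > 0, ∀ᶠ n in atTop, ∀ k,
    min ((P n).pt (k + 1)) T - min ((P n).pt k) T ≤ δ

theorem IsSewing.tendstoUniformlyOn {T : ℝ} (hT : 0 ≤ T) {Ξ : ℝ → ℝ → ℝ} {I : ℝ → ℝ}
    (h : IsSewing T Ξ I) {P : ℕ → HalfLinePartition} (hP : MeshToZero P) :
    TendstoUniformlyOn (fun n t => (P n).germSum Ξ t) (fun t => I t - I 0) atTop (Icc 0 T) := by
  classical
  refine Metric.tendstoUniformlyOn_iff.mpr fun ε hε => ?_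
  obtain ⟨δ, hδ, h⟩ := h.exists_sum_approx (half_pos hε)
  refine (hP T hT δ hδ).mono fun n hn t ht => ?_
  have := h (fun k => min ((P n).pt k) t) (Nat.find ((P n).exists_le t))
    ((P n).monotone_stopped t) (by simp [(P n).pt_zero, ht.1])
    ((min_le_right _ _).trans ht.2) (fun k _ => by
      refine le_trans ?_ (hn k)
      have hle := (P n).strictMono.monotone (Nat.le_succ k)
      -- stopping earlier shortens the intervals
      rcases le_total ((P n).pt k) t with h1 | h1
      · rw [min_eq_left h1, min_eq_left (h1.trans ht.2)]
        exact sub_le_sub_right (min_le_min le_rfl ht.2) _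
      · rw [min_eq_right h1, min_eq_right (h1.trans hle), sub_self]
        exact sub_nonneg.mpr (min_le_min hle le_rfl))
  simp only [(P n).pt_zero, min_eq_left ht.1,
    min_eq_right ((P n).le_pt_of_find_le (t := t) le_rfl)] at this
  rw [Real.dist_eq, abs_sub_comm]
  exact this.trans_lt (half_lt_self hε)

end PathwisePortfolio

namespace PathwisePortfolio

/-! ### Two-parameter functions bounded by powers of controls -/

/-- `w` is bounded on `[0, T]` by the power `α` of a control; for `α > 0` this means that `w` has
finite `1 / α`-variation. -/
def VarBdd (T α : ℝ) (w : ℝ → ℝ → ℝ) : Prop :=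
  ∃ c, IsControl T c ∧ ∃ C, 0 ≤ C ∧ ∀ s t, 0 ≤ s → s ≤ t → t ≤ T → |w s t| ≤ C * c s t ^ α

/-- `w` tends to zero at the diagonal, uniformly on `[0, T]`. -/
def SmallDiag (T : ℝ) (w : ℝ → ℝ → ℝ) : Prop :=
  ∀ ε > 0, ∃ δ > 0, ∀ s t, 0 ≤ s → s ≤ t → t ≤ T → t - s ≤ δ → |w s t| ≤ ε

namespace VarBdd

variable {T α β : ℝ} {w w' : ℝ → ℝ → ℝ}

theorem of_abs_le (h : VarBdd T α w) {C : ℝ} (hC : 0 ≤ C)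
    (hw : ∀ s t, 0 ≤ s → s ≤ t → t ≤ T → |w' s t| ≤ C * |w s t|) : VarBdd T α w' := by
  obtain ⟨c, hc, K, hK, h⟩ := h
  refine ⟨c, hc, C * K, mul_nonneg hC hK, fun s t hs hst ht => ?_⟩
  rw [mul_assoc]
  exact (hw s t hs hst ht).trans (mul_le_mul_of_nonneg_left (h s t hs hst ht) hC)

theorem congr (h : VarBdd T α w) (hw : ∀ s t, 0 ≤ s → s ≤ t → t ≤ T → w' s t = w s t) :
    VarBdd T α w' :=
  h.of_abs_le zero_le_one fun s t hs hst ht => by rw [hw s t hs hst ht, one_mul]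

theorem abs (h : VarBdd T α w) : VarBdd T α fun s t => |w s t| :=
  h.of_abs_le zero_le_one fun s t _ _ _ => by rw [abs_abs, one_mul]

theorem restrict (h : VarBdd T α w) {T' : ℝ} (hT : T' ≤ T) : VarBdd T' α w := by
  obtain ⟨c, hc, K, hK, h⟩ := h
  exact ⟨c, hc.restrict hT, K, hK, fun s t hs hst ht => h s t hs hst (ht.trans hT)⟩

theorem zero : VarBdd T α fun _ _ => 0 :=
  ⟨_, IsControl.zero, 0, le_rfl, fun _ _ _ _ _ => by simp⟩

theorem add (hα : 0 ≤ α) (h : VarBdd T α w) (h' : VarBdd T α w') :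
    VarBdd T α fun s t => w s t + w' s t := by
  obtain ⟨c, hc, K, hK, h⟩ := h
  obtain ⟨c', hc', K', hK', h'⟩ := h'
  refine ⟨_, hc.add hc', K + K', add_nonneg hK hK', fun s t hs hst ht => ?_⟩
  have h1 := hc.nonneg hs hst ht
  have h2 := hc'.nonneg hs hst ht
  rw [add_mul]
  refine (abs_add_le _ _).trans (add_le_add ((h s t hs hst ht).trans ?_)
    ((h' s t hs hst ht).trans ?_))
  · exact mul_le_mul_of_nonneg_left (Real.rpow_le_rpow h1 (by linarith) hα) hK
  · exact mul_le_mul_of_nonneg_left (Real.rpow_le_rpow h2 (by linarith) hα) hK'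

theorem sum (hα : 0 ≤ α) {ι : Type*} (s : Finset ι) {w : ι → ℝ → ℝ → ℝ}
    (h : ∀ i ∈ s, VarBdd T α (w i)) : VarBdd T α fun a b => ∑ i ∈ s, w i a b := by
  classical
  induction s using Finset.induction_on with
  | empty => simp only [Finset.sum_empty]; exact zero
  | insert i s hi ih =>
    simp only [Finset.sum_insert hi]
    exact (h i (Finset.mem_insert_self i s)).add hα
      (ih fun j hj => h j (Finset.mem_insert_of_mem hj))

theorem mul (hα : 0 ≤ α) (hβ : 0 ≤ β) (h : VarBdd T α w) (h' : VarBdd T β w') :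
    VarBdd T (α + β) fun s t => w s t * w' s t := by
  obtain ⟨c, hc, K, hK, h⟩ := h
  obtain ⟨c', hc', K', hK', h'⟩ := h'
  refine ⟨_, hc.add hc', K * K', mul_nonneg hK hK', fun s t hs hst ht => ?_⟩
  have h1 := hc.nonneg hs hst ht
  have h2 := hc'.nonneg hs hst ht
  rw [abs_mul, Real.rpow_add_of_nonneg (add_nonneg h1 h2) hα hβ]
  calc |w s t| * |w' s t| ≤ (K * c s t ^ α) * (K' * c' s t ^ β) :=
        mul_le_mul (h s t hs hst ht) (h' s t hs hst ht) (abs_nonneg _)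
          (mul_nonneg hK (Real.rpow_nonneg h1 _))
    _ ≤ (K * (c s t + c' s t) ^ α) * (K' * (c s t + c' s t) ^ β) := by
        gcongr <;> linarith
    _ = _ := by ring

/-- A smaller exponent gives a weaker bound, as controls are bounded. -/
theorem mono (h : VarBdd T α w) (hβ : 0 ≤ β) (hβα : β ≤ α) : VarBdd T β w := by
  obtain ⟨c, hc, K, hK, h⟩ := h
  refine ⟨c, hc, K * |c 0 T| ^ (α - β), by positivity, fun s t hs hst ht => ?_⟩
  have h0 := hc.nonneg hs hst ht
  have h1 : c s t ≤ |c 0 T| := (hc.mono le_rfl hs hst ht le_rfl).trans (le_abs_self _)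
  have h2 : c s t ^ α = c s t ^ (α - β) * c s t ^ β := by
    rw [← Real.rpow_add_of_nonneg h0 (by linarith) hβ, sub_add_cancel]
  refine (h s t hs hst ht).trans ?_
  rw [h2, ← mul_assoc]
  gcongr

theorem bounded_mul {f : ℝ → ℝ → ℝ} {M : ℝ} (hf : ∀ s t, 0 ≤ s → s ≤ t → t ≤ T → |f s t| ≤ M)
    (hM : 0 ≤ M) (h : VarBdd T α w) : VarBdd T α fun s t => f s t * w s t :=
  h.of_abs_le hM fun s t hs hst ht => by
    rw [abs_mul]
    exact mul_le_mul_of_nonneg_right (hf s t hs hst ht) (abs_nonneg _)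

theorem neg (h : VarBdd T α w) : VarBdd T α fun s t => -w s t :=
  h.of_abs_le zero_le_one fun s t _ _ _ => by rw [abs_neg, one_mul]

end VarBdd

/-- A partition of `[0, a]` may be extended by the point `b`. -/
theorem Partition.exists_extend {a b : ℝ} (D : Partition a) (hab : a ≤ b) (f : ℝ → ℝ → ℝ)
    (hf : ∀ x, f x x = 0) : ∃ D' : Partition b, D'.germSum f = D.germSum f + f a b := by
  rcases eq_or_lt_of_le hab with rfl | hab
  · exact ⟨D, by rw [hf, add_zero]⟩
  refine ⟨⟨D.N + 1, fun k => if k ≤ D.N then D.pt k else b, by simp [D.pt_zero], by simp,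
    fun k hk => ?_⟩, ?_⟩
  · rcases eq_or_lt_of_le (Nat.lt_succ_iff.mp hk) with rfl | hk
    · simpa [D.pt_last] using hab
    · simpa [hk.le, Nat.succ_le_of_lt hk] using D.pt_lt k hk
  · unfold germSum
    rw [Finset.sum_range_succ]
    simp only [le_refl, if_true, D.pt_last, Nat.not_succ_le_self, if_false]
    congr 1
    refine Finset.sum_congr rfl fun k hk => ?_
    have hk := Finset.mem_range.mp hk
    simp [hk.le, Nat.succ_le_of_lt hk]

/-- A sum along a subdivision of a subinterval, with possibly repeated points, is dominated by a sum
along a partition of `[0, T]`. -/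
theorem exists_partition_germSum_ge {f : ℝ → ℝ → ℝ} (hf : ∀ x, f x x = 0)
    (hf0 : ∀ x y, 0 ≤ f x y) {u : ℕ → ℝ} (hu : Monotone u) (h0 : 0 ≤ u 0) {T : ℝ} (N : ℕ)
    (hN : u N ≤ T) :
    ∃ D : Partition T, ∑ k ∈ Finset.range N, f (u k) (u (k + 1)) ≤ D.germSum f := by
  have key : ∀ N, ∃ D : Partition (u N),
      ∑ k ∈ Finset.range N, f (u k) (u (k + 1)) ≤ D.germSum f := fun N => by
    induction N with
    | zero =>
      obtain ⟨D, hD⟩ := Partition.trivial.exists_extend h0 f hf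
      refine ⟨D, ?_⟩
      rw [hD, Finset.sum_range_zero]
      exact add_nonneg (Finset.sum_nonneg fun _ _ => hf0 _ _) (hf0 _ _)
    | succ n ih =>
      obtain ⟨D, hD⟩ := ih
      obtain ⟨D', hD'⟩ := D.exists_extend (hu (Nat.le_succ n)) f hf
      refine ⟨D', ?_⟩
      rw [Finset.sum_range_succ, hD']
      exact add_le_add_left hD _
  obtain ⟨D, hD⟩ := key N
  obtain ⟨D', hD'⟩ := D.exists_extend hN f hf
  exact ⟨D', by rw [hD']; linarith [hf0 (u N) T]⟩

/-- The `ρ`-variation over subintervals is a control. -/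
theorem HasFiniteVariation.varBdd {ρ T : ℝ} {w : ℝ → ℝ → ℝ} (h : HasFiniteVariation ρ T w)
    (hρ : 0 < ρ) (hw0 : ∀ s t, 0 ≤ w s t) (hw : ∀ s, w s s = 0) : VarBdd T (1 / ρ) w := by
  obtain ⟨C, hC⟩ := h
  set f : ℝ → ℝ → ℝ := fun s t => w s t ^ ρ with hf
  have hfd : ∀ x, f x x = 0 := fun x => by simp [hf, hw, Real.zero_rpow hρ.ne']
  have hf0 : ∀ x y, 0 ≤ f x y := fun x y => Real.rpow_nonneg (hw0 x y) _
  set V : ℝ → ℝ → Set ℝ := fun s t => {x | ∃ (u : ℕ → ℝ) (N : ℕ), Monotone u ∧ s ≤ u 0 ∧ u N ≤ t ∧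
    x = ∑ k ∈ Finset.range N, f (u k) (u (k + 1))} with hV
  have hne : ∀ s t, s ≤ t → (V s t).Nonempty := fun s t hst =>
    ⟨0, fun _ => s, 0, fun _ _ _ => le_rfl, le_rfl, hst, by simp⟩
  have hbdd : ∀ s t, 0 ≤ s → t ≤ T → BddAbove (V s t) := fun s t hs ht => by
    refine ⟨C, ?_⟩
    rintro x ⟨u, N, hu, h0, hN, rfl⟩
    obtain ⟨D, hD⟩ := exists_partition_germSum_ge hfd hf0 hu (hs.trans h0) N (hN.trans ht)
    exact hD.trans (hC D)
  refine ⟨fun s t => sSup (V s t), ⟨fun s t hs hst ht => ?_, fun s m t hs hsm hmt ht => ?_⟩, 1,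
    zero_le_one, fun s t hs hst ht => ?_⟩
  · exact le_csSup (hbdd s t hs ht)
      ⟨fun _ => s, 0, fun _ _ _ => le_rfl, le_rfl, hst, by simp⟩
  · rw [← le_sub_iff_add_le]
    refine csSup_le (hne s m hsm) ?_
    rintro x ⟨u, N, hu, hu0, huN, rfl⟩
    rw [le_sub_comm]
    refine csSup_le (hne m t hmt) ?_
    rintro y ⟨v, M, hv, hv0, hvM, rfl⟩
    rw [le_sub_iff_add_le]
    -- the sequence `u 0, …, u N, v 0, …, v M` subdivides `[s, t]`
    set z : ℕ → ℝ := fun k => if k ≤ N then u k else v (k - (N + 1)) with hz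
    have hzm : Monotone z := monotone_nat_of_le_succ fun k => by
      simp only [hz]
      rcases lt_trichotomy k N with hk | rfl | hk
      · rw [if_pos hk.le, if_pos (Nat.succ_le_of_lt hk)]
        exact hu (Nat.le_succ k)
      · simp only [le_refl, if_true, Nat.not_succ_le_self, if_false, Nat.sub_self]
        exact huN.trans hv0
      · rw [if_neg (by omega), if_neg (by omega)]
        exact hv (by omega)
    have hzN : ∀ k, z (N + 1 + k) = v k := fun k => by
      simp only [hz]
      rw [if_neg (by omega), Nat.add_sub_cancel_left]
    refine le_trans ?_ (le_csSup (hbdd s t hs ht) ⟨z, N + 1 + M, hzm, by simpa [hz] using hu0,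
      by rw [hzN]; exact hvM, rfl⟩)
    rw [Finset.sum_range_add, Finset.sum_range_succ]
    have e1 : ∑ k ∈ Finset.range N, f (z k) (z (k + 1))
        = ∑ k ∈ Finset.range N, f (u k) (u (k + 1)) := Finset.sum_congr rfl fun k hk => by
      have hk := Finset.mem_range.mp hk
      simp only [hz]
      rw [if_pos hk.le, if_pos (Nat.succ_le_of_lt hk)]
    have e2 : ∀ k, f (z (N + 1 + k)) (z (N + 1 + k + 1)) = f (v k) (v (k + 1)) := fun k => by
      rw [hzN, add_assoc, hzN]
    simp only [e1, e2]
    linarith [hf0 (z N) (z (N + 1))]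
  · rw [one_mul, abs_of_nonneg (hw0 s t)]
    have h1 : w s t ^ ρ ≤ sSup (V s t) := by
      refine le_csSup (hbdd s t hs ht) ⟨fun k => if k = 0 then s else t, 1, ?_, by simp, by simp,
        by simp [hf]⟩
      exact monotone_nat_of_le_succ fun k => by
        rcases k with _ | k <;> simp [hst]
    have h2 := Real.rpow_le_rpow (hf0 s t) h1 (one_div_nonneg.mpr hρ.le)
    rwa [hf, ← Real.rpow_mul (hw0 s t), mul_one_div_cancel hρ.ne', Real.rpow_one] at h2

theorem VarBdd.hasFiniteVariation {ρ T : ℝ} {w : ℝ → ℝ → ℝ} (h : VarBdd T (1 / ρ) w) (hρ : 0 < ρ)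
    (hw0 : ∀ s t, 0 ≤ w s t) : HasFiniteVariation ρ T w := by
  obtain ⟨c, hc, C, hC, h⟩ := h
  refine ⟨C ^ ρ * c 0 T, fun D => ?_⟩
  have hm := D.monotone_stopped
  have e0 : D.pt (min 0 D.N) = 0 := by simp [D.pt_zero]
  have e1 : D.pt (min D.N D.N) = T := by simp [D.pt_last]
  calc D.germSum (fun s t => w s t ^ ρ)
      ≤ ∑ k ∈ Finset.range D.N, C ^ ρ * c (D.pt (min k D.N)) (D.pt (min (k + 1) D.N)) := by
        rw [D.germSum_eq_stopped]
        refine Finset.sum_le_sum fun k hk => ?_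
        have hk := Finset.mem_range.mp hk
        have a1 : 0 ≤ D.pt (min k D.N) := e0.ge.trans (hm (Nat.zero_le k))
        have a2 := hm (Nat.le_succ k)
        have a3 : D.pt (min (k + 1) D.N) ≤ T := (hm (Nat.succ_le_of_lt hk)).trans e1.le
        have a4 := hc.nonneg a1 a2 a3
        have := (le_abs_self _).trans (h _ _ a1 a2 a3)
        refine (Real.rpow_le_rpow (hw0 _ _) this hρ.le).trans (le_of_eq ?_)
        rw [Real.mul_rpow hC (Real.rpow_nonneg a4 _), ← Real.rpow_mul a4,
          one_div_mul_cancel hρ.ne', Real.rpow_one]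
    _ ≤ C ^ ρ * c 0 T := by
        rw [← Finset.mul_sum]
        refine mul_le_mul_of_nonneg_left ?_ (Real.rpow_nonneg hC _)
        have := hc.sum_le hm e0.ge D.N e1.le
        rwa [e0, e1] at this

/-! ### Sewing of germs with a superlinear defect of additivity -/

/-- A three-parameter defect which is `o(1)` times a power `θ > 1` of a control. -/
def SmallDefect (T : ℝ) (E : ℝ → ℝ → ℝ → ℝ) : Prop :=
  ∃ θ : ℝ, 1 < θ ∧ ∃ c, IsControl T c ∧ ∀ ε > 0, ∃ δ > 0, ∀ s u t, 0 ≤ s → s ≤ u → u ≤ t → t ≤ T →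
    t - s ≤ δ → |E s u t| ≤ ε * c s t ^ θ

namespace SmallDefect

variable {T : ℝ} {E E' : ℝ → ℝ → ℝ → ℝ}

theorem zero : SmallDefect T fun _ _ _ => 0 :=
  ⟨2, by norm_num, _, IsControl.zero, fun _ _ =>
    ⟨1, one_pos, fun _ _ _ _ _ _ _ _ => by norm_num⟩⟩

/-- A smaller exponent gives a weaker bound, as controls are bounded. -/
theorem mono {θ θ' : ℝ} (hθ : 0 ≤ θ) (hθ' : θ ≤ θ') {c : ℝ → ℝ → ℝ}
    (hc : IsControl T c) (h : ∀ ε > 0, ∃ δ > 0, ∀ s u t, 0 ≤ s → s ≤ u → u ≤ t → t ≤ T →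
      t - s ≤ δ → |E s u t| ≤ ε * c s t ^ θ') :
    ∀ ε > 0, ∃ δ > 0, ∀ s u t, 0 ≤ s → s ≤ u → u ≤ t → t ≤ T →
      t - s ≤ δ → |E s u t| ≤ ε * c s t ^ θ := fun ε hε => by
  set K := |c 0 T| ^ (θ' - θ) + 1 with hK
  have hKpos : 0 < K := by positivity
  obtain ⟨δ, hδ, h⟩ := h (ε / K) (by positivity)
  refine ⟨δ, hδ, fun s u t hs hsu hut ht hd => (h s u t hs hsu hut ht hd).trans ?_⟩
  have h0 := hc.nonneg hs (hsu.trans hut) ht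
  have h1 : c s t ≤ |c 0 T| := (hc.mono le_rfl hs (hsu.trans hut) ht le_rfl).trans (le_abs_self _)
  have h2 : c s t ^ θ' = c s t ^ (θ' - θ) * c s t ^ θ := by
    rw [← Real.rpow_add_of_nonneg h0 (by linarith) hθ, sub_add_cancel]
  have h3 : c s t ^ (θ' - θ) ≤ K :=
    (Real.rpow_le_rpow h0 h1 (by linarith)).trans (by rw [hK]; linarith)
  rw [h2, ← mul_assoc]
  refine mul_le_mul_of_nonneg_right ?_ (Real.rpow_nonneg h0 _)
  rw [div_mul_eq_mul_div, div_le_iff₀ hKpos]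
  exact mul_le_mul_of_nonneg_left h3 hε.le

theorem add (h : SmallDefect T E) (h' : SmallDefect T E') :
    SmallDefect T fun s u t => E s u t + E' s u t := by
  obtain ⟨θ, hθ, c, hc, h⟩ := h
  obtain ⟨θ', hθ', c', hc', h'⟩ := h'
  have hm : 1 < min θ θ' := lt_min hθ hθ'
  refine ⟨min θ θ', hm, _, hc.add hc', fun ε hε => ?_⟩
  obtain ⟨δ, hδ, h⟩ := mono (by linarith) (min_le_left θ θ') hc h (ε / 2) (half_pos hε)
  obtain ⟨δ', hδ', h'⟩ := mono (by linarith) (min_le_right θ θ') hc' h' (ε / 2) (half_pos hε)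
  refine ⟨min δ δ', lt_min hδ hδ', fun s u t hs hsu hut ht hd => ?_⟩
  have h1 := hc.nonneg hs (hsu.trans hut) ht
  have h2 := hc'.nonneg hs (hsu.trans hut) ht
  have e1 := h s u t hs hsu hut ht (hd.trans (min_le_left _ _))
  have e2 := h' s u t hs hsu hut ht (hd.trans (min_le_right _ _))
  have e3 : c s t ^ min θ θ' ≤ (c s t + c' s t) ^ min θ θ' :=
    Real.rpow_le_rpow h1 (by linarith) (by linarith)
  have e4 : c' s t ^ min θ θ' ≤ (c s t + c' s t) ^ min θ θ' :=
    Real.rpow_le_rpow h2 (by linarith) (by linarith)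
  refine (abs_add_le _ _).trans ?_
  nlinarith

theorem sum {ι : Type*} (s : Finset ι) {E : ι → ℝ → ℝ → ℝ → ℝ}
    (h : ∀ i ∈ s, SmallDefect T (E i)) : SmallDefect T fun a b c => ∑ i ∈ s, E i a b c := by
  classical
  induction s using Finset.induction_on with
  | empty => simp only [Finset.sum_empty]; exact zero
  | insert i s hi ih =>
    simp only [Finset.sum_insert hi]
    exact (h i (Finset.mem_insert_self i s)).add
      (ih fun j hj => h j (Finset.mem_insert_of_mem hj))

/-- A product of two increments over adjacent intervals, with exponents adding up to more than
one. The smallness of the second factor is bought with a little of its exponent. -/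
theorem of_mul {a b : ℝ → ℝ → ℝ} {α β : ℝ} (hα : 0 ≤ α) (hβ : 0 < β) (hαβ : 1 < α + β)
    (ha : VarBdd T α a) (hb : VarBdd T β b) (hb' : SmallDiag T b) :
    SmallDefect T fun s u t => a s u * b u t := by
  obtain ⟨c, hc, K, hK, ha⟩ := ha
  obtain ⟨c', hc', K', hK', hb⟩ := hb
  obtain ⟨η, hη0, hη1, hη⟩ : ∃ η, 0 < η ∧ η < 1 ∧ 1 < α + (1 - η) * β := by
    refine ⟨min (1 / 2) ((α + β - 1) / (2 * β)), ?_, ?_, ?_⟩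
    · have : 0 < α + β - 1 := by linarith
      positivity
    · exact (min_le_left _ _).trans_lt (by norm_num)
    · have h1 : min (1 / 2) ((α + β - 1) / (2 * β)) * β ≤ (α + β - 1) / (2 * β) * β :=
        mul_le_mul_of_nonneg_right (min_le_right _ _) hβ.le
      have h2 : (α + β - 1) / (2 * β) * β = (α + β - 1) / 2 := by field_simp
      nlinarith
  refine ⟨α + (1 - η) * β, hη, _, hc.add hc', fun ε hε => ?_⟩
  set L := K * K' ^ (1 - η) + 1 with hL
  have hLpos : 0 < L := by positivity
  obtain ⟨δ, hδ, hsm⟩ := hb' ((ε / L) ^ (1 / η)) (by positivity)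
  refine ⟨δ, hδ, fun s u t hs hsu hut ht hd => ?_⟩
  have c1 := hc.nonneg hs hsu (hut.trans ht)
  have c2 := hc'.nonneg (hs.trans hsu) hut ht
  have c3 : c s u ≤ c s t + c' s t := by
    linarith [hc.mono hs le_rfl hsu hut ht, hc'.nonneg hs (hsu.trans hut) ht]
  have c4 : c' u t ≤ c s t + c' s t := by
    linarith [hc'.mono hs hsu hut le_rfl ht, hc.nonneg hs (hsu.trans hut) ht]
  have c5 := c1.trans c3
  have e1 := ha s u hs hsu (hut.trans ht)
  have e2 := hb u t (hs.trans hsu) hut ht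
  have e3 := hsm u t (hs.trans hsu) hut ht (by linarith)
  have h1η : 0 < 1 - η := by linarith
  have f1 : |b u t| ^ (1 - η) ≤ K' ^ (1 - η) * (c s t + c' s t) ^ ((1 - η) * β) := by
    refine (Real.rpow_le_rpow (abs_nonneg _) e2 h1η.le).trans ?_
    rw [Real.mul_rpow hK' (Real.rpow_nonneg c2 _), ← Real.rpow_mul c2, mul_comm β]
    gcongr
  have f2 : |b u t| ^ η ≤ ε / L := by
    refine (Real.rpow_le_rpow (abs_nonneg _) e3 hη0.le).trans (le_of_eq ?_)
    rw [← Real.rpow_mul (by positivity), one_div_mul_cancel hη0.ne', Real.rpow_one]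
  have f3 : |b u t| = |b u t| ^ η * |b u t| ^ (1 - η) := by
    rw [← Real.rpow_add_of_nonneg (abs_nonneg _) hη0.le h1η.le, add_sub_cancel, Real.rpow_one]
  have f4 : |a s u| ≤ K * (c s t + c' s t) ^ α := e1.trans (by gcongr)
  rw [abs_mul, Real.rpow_add_of_nonneg c5 hα (by positivity), f3]
  calc |a s u| * (|b u t| ^ η * |b u t| ^ (1 - η))
      ≤ (K * (c s t + c' s t) ^ α) *
          (ε / L * (K' ^ (1 - η) * (c s t + c' s t) ^ ((1 - η) * β))) := by
        refine mul_le_mul f4 (mul_le_mul f2 f1 (by positivity) (by positivity)) (by positivity)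
          (by positivity)
    _ = (K * K' ^ (1 - η) / L) *
          (ε * ((c s t + c' s t) ^ α * (c s t + c' s t) ^ ((1 - η) * β))) := by ring
    _ ≤ 1 * (ε * ((c s t + c' s t) ^ α * (c s t + c' s t) ^ ((1 - η) * β))) := by
        refine mul_le_mul_of_nonneg_right ?_ (by positivity)
        rw [div_le_one hLpos, hL]
        linarith
    _ = _ := one_mul _

end SmallDefect

/-- Germs with a superlinear defect of additivity are sewable. -/
theorem SmallDefect.sewable {T : ℝ} {Ξ : ℝ → ℝ → ℝ}
    (h : SmallDefect T fun s u t => Ξ s t - Ξ s u - Ξ u t) : Sewable T Ξ := by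
  obtain ⟨θ, hθ, c, hc, h⟩ := h
  have hd : ∀ x, 0 ≤ x → x ≤ T → Ξ x x = 0 := fun x hx hx' => by
    obtain ⟨δ, hδ, h⟩ := h 1 one_pos
    have := h x x x hx le_rfl le_rfl hx' (by simpa using hδ.le)
    rw [hc.self_eq_zero hx hx', Real.zero_rpow (by linarith)] at this
    simpa using this
  refine ⟨_, hc.rpow hθ.le, fun ε hε => ?_⟩
  have hK := sewConst_nonneg hθ
  obtain ⟨δ, hδ, h⟩ := h (ε / (sewConst θ + 1)) (by positivity)
  refine ⟨δ, hδ, fun u N hu h0 hN hgap => ?_⟩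
  have pos : ∀ i, 0 ≤ u i := fun i => h0.trans (hu (Nat.zero_le i))
  have le : ∀ i ≤ N, u i ≤ T := fun i hi => (hu hi).trans hN
  have := discrete_sewing hθ (N := N) (Ξ := fun i j => Ξ (u i) (u j))
    (ω := fun i j => c (u i) (u j)) (ε := ε / (sewConst θ + 1)) (by positivity)
    (fun i j hij hj => hc.nonneg (pos i) (hu hij) (le j hj))
    (fun i j k hij hjk hk => hc.2 _ _ _ (pos i) (hu hij) (hu hjk) (le k hk))
    (fun i hi => hd _ (pos i) (le i hi))
    (fun i j k hij hjk hk => h _ _ _ (pos i) (hu hij) (hu hjk) (le k hk)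
      (by linarith [hu (Nat.zero_le i), hu hk]))
    (Nat.zero_le N) le_rfl
  rw [Nat.Ico_zero_eq_range] at this
  refine this.trans (mul_le_mul_of_nonneg_right ?_
    (Real.rpow_nonneg (hc.nonneg h0 (hu (Nat.zero_le N)) hN) _))
  rw [mul_div_assoc', div_le_iff₀ (by positivity)]
  nlinarith

end PathwisePortfolio

namespace PathwisePortfolio

/-! ### Scalar controlled paths -/

theorem exists_abs_le_of_continuousOn {T : ℝ} {f : ℝ → ℝ} (hf : ContinuousOn f (Icc 0 T)) :
    ∃ M, 0 ≤ M ∧ ∀ t, 0 ≤ t → t ≤ T → |f t| ≤ M := by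
  obtain ⟨M, hM⟩ := isCompact_Icc.exists_bound_of_continuousOn hf
  exact ⟨|M|, abs_nonneg _, fun t h0 ht => (hM t ⟨h0, ht⟩).trans (le_abs_self M)⟩

theorem smallDiag_of_continuousOn {T : ℝ} {f : ℝ → ℝ} (hf : ContinuousOn f (Icc 0 T)) :
    SmallDiag T fun s t => f t - f s := fun ε hε => by
  obtain ⟨δ, hδ, h⟩ := Metric.uniformContinuousOn_iff.mp
    (isCompact_Icc.uniformContinuousOn_of_continuous hf) ε hε
  refine ⟨δ / 2, half_pos hδ, fun s t hs hst ht hd => ?_⟩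
  have := h t ⟨hs.trans hst, ht⟩ s ⟨hs, hst.trans ht⟩
    (by rw [Real.dist_eq, abs_of_nonneg (sub_nonneg.mpr hst)]; linarith)
  exact this.le

namespace SmallDiag

variable {T : ℝ} {w w' : ℝ → ℝ → ℝ}

theorem zero : SmallDiag T fun _ _ => 0 := fun ε hε =>
  ⟨1, one_pos, fun _ _ _ _ _ _ => by simpa using hε.le⟩

theorem add (h : SmallDiag T w) (h' : SmallDiag T w') : SmallDiag T fun s t => w s t + w' s t :=
  fun ε hε => by
  obtain ⟨δ, hδ, h⟩ := h (ε / 2) (half_pos hε)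
  obtain ⟨δ', hδ', h'⟩ := h' (ε / 2) (half_pos hε)
  refine ⟨min δ δ', lt_min hδ hδ', fun s t hs hst ht hd => ?_⟩
  have h1 := h s t hs hst ht (hd.trans (min_le_left _ _))
  have h2 := h' s t hs hst ht (hd.trans (min_le_right _ _))
  exact (abs_add_le _ _).trans (by linarith)

theorem sum {ι : Type*} (s : Finset ι) {w : ι → ℝ → ℝ → ℝ}
    (h : ∀ i ∈ s, SmallDiag T (w i)) : SmallDiag T fun a b => ∑ i ∈ s, w i a b := by
  classical
  induction s using Finset.induction_on with
  | empty => simp only [Finset.sum_empty]; exact zero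
  | insert i s hi ih =>
    simp only [Finset.sum_insert hi]
    exact (h i (Finset.mem_insert_self i s)).add
      (ih fun j hj => h j (Finset.mem_insert_of_mem hj))

theorem bounded_mul {f : ℝ → ℝ → ℝ} {M : ℝ} (hf : ∀ s t, 0 ≤ s → s ≤ t → t ≤ T → |f s t| ≤ M)
    (hM : 0 ≤ M) (h : SmallDiag T w) : SmallDiag T fun s t => f s t * w s t := fun ε hε => by
  obtain ⟨δ, hδ, h⟩ := h (ε / (M + 1)) (by positivity)
  refine ⟨δ, hδ, fun s t hs hst ht hd => ?_⟩
  rw [abs_mul]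
  calc |f s t| * |w s t| ≤ M * (ε / (M + 1)) :=
        mul_le_mul (hf s t hs hst ht) (h s t hs hst ht hd) (abs_nonneg _) hM
    _ ≤ ε := by
        rw [mul_div_assoc', div_le_iff₀ (by positivity)]
        nlinarith

theorem left_mul {f : ℝ → ℝ} (hf : ContinuousOn f (Icc 0 T)) (h : SmallDiag T w) :
    SmallDiag T fun s t => f s * w s t := by
  obtain ⟨M, hM, hf⟩ := exists_abs_le_of_continuousOn hf
  exact h.bounded_mul (fun s t hs hst ht => hf s hs (hst.trans ht)) hM

end SmallDiag

theorem VarBdd.left_mul {T α : ℝ} {w : ℝ → ℝ → ℝ} {f : ℝ → ℝ} (hf : ContinuousOn f (Icc 0 T))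
    (h : VarBdd T α w) : VarBdd T α fun s t => f s * w s t := by
  obtain ⟨M, hM, hf⟩ := exists_abs_le_of_continuousOn hf
  exact h.bounded_mul (fun s t hs hst ht => hf s hs (hst.trans ht)) hM

theorem VarBdd.right_mul {T α : ℝ} {w : ℝ → ℝ → ℝ} {f : ℝ → ℝ} (hf : ContinuousOn f (Icc 0 T))
    (h : VarBdd T α w) : VarBdd T α fun s t => f t * w s t := by
  obtain ⟨M, hM, hf⟩ := exists_abs_le_of_continuousOn hf
  exact h.bounded_mul (fun s t hs hst ht => hf t (hs.trans hst) ht) hM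

/-- The regularity of the increments of a product of two paths. -/
theorem VarBdd.path_mul {T α : ℝ} (hα : 0 ≤ α) {f g : ℝ → ℝ} (hf : ContinuousOn f (Icc 0 T))
    (hg : ContinuousOn g (Icc 0 T)) (hf' : VarBdd T α fun s t => f t - f s)
    (hg' : VarBdd T α fun s t => g t - g s) : VarBdd T α fun s t => f t * g t - f s * g s :=
  ((hg'.right_mul hf).add hα (hf'.left_mul hg)).congr fun s t _ _ _ => by ring

/-- The conditions on the regularity exponents. -/
structure Exponents (p q r : ℝ) : Prop where
  two_lt : 2 < p
  lt_three : p < 3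
  le : p ≤ q
  young : 1 < 2 / p + 1 / q
  eq : 1 / r = 1 / p + 1 / q

namespace Exponents

variable {p q r : ℝ}

theorem one_div_p_pos (h : Exponents p q r) : 0 < 1 / p := one_div_pos.mpr (by linarith [h.two_lt])

theorem one_div_q_pos (h : Exponents p q r) : 0 < 1 / q := one_div_pos.mpr (by linarith [h.two_lt, h.le])

theorem one_div_q_le (h : Exponents p q r) : 1 / q ≤ 1 / p :=
  one_div_le_one_div_of_le (by linarith [h.two_lt]) h.le

theorem q_pos (h : Exponents p q r) : 0 < q := by linarith [h.two_lt, h.le]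

theorem r_pos (h : Exponents p q r) : 0 < r := by
  have := h.eq
  have h1 := h.one_div_p_pos
  have h2 := h.one_div_q_pos
  exact one_div_pos.mp (by linarith)

end Exponents

variable {d : ℕ}

/-- The data of a rough path on `[0, T]`, of finite `p`-variation. -/
structure IsRoughPath (p T : ℝ) (S : ℝ → EuclideanSpace ℝ (Fin d))
    (X : ℝ → ℝ → Matrix (Fin d) (Fin d) ℝ) : Prop where
  continuousOn : ∀ i, ContinuousOn (fun t => S t i) (Icc 0 T)
  varBdd : ∀ i, VarBdd T (1 / p) fun s t => S t i - S s i
  varBdd_second : ∀ i j, VarBdd T (2 / p) fun s t => X s t i j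
  smallDiag_second : ∀ i j, SmallDiag T fun s t => X s t i j
  chen : ∀ s u t i j, X s t i j = X s u i j + X u t i j + (S u i - S s i) * (S t j - S u j)

/-- A real-valued path `f` controlled by `S` on `[0, T]`, with Gubinelli derivative `f'`. -/
structure IsScalarControlled (q r T : ℝ) (S : ℝ → EuclideanSpace ℝ (Fin d)) (f : ℝ → ℝ)
    (f' : ℝ → Fin d → ℝ) : Prop where
  continuousOn : ContinuousOn f (Icc 0 T)
  continuousOn_deriv : ∀ a, ContinuousOn (fun t => f' t a) (Icc 0 T)
  varBdd_deriv : ∀ a, VarBdd T (1 / q) fun s t => f' t a - f' s a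
  varBdd_remainder : VarBdd T (1 / r) fun s t => f t - f s - ∑ a, f' s a * (S t a - S s a)

namespace IsScalarControlled

variable {p q r T : ℝ} {S : ℝ → EuclideanSpace ℝ (Fin d)}
  {X : ℝ → ℝ → Matrix (Fin d) (Fin d) ℝ} {f g : ℝ → ℝ} {f' g' : ℝ → Fin d → ℝ}

theorem restrict (h : IsScalarControlled q r T S f f') {T' : ℝ} (hT : T' ≤ T) :
    IsScalarControlled q r T' S f f' where
  continuousOn := h.continuousOn.mono (Icc_subset_Icc_right hT)
  continuousOn_deriv a := (h.continuousOn_deriv a).mono (Icc_subset_Icc_right hT)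
  varBdd_deriv a := (h.varBdd_deriv a).restrict hT
  varBdd_remainder := h.varBdd_remainder.restrict hT

theorem varBdd_linear (he : Exponents p q r) (hS : IsRoughPath p T S X)
    (h : IsScalarControlled q r T S f f') :
    VarBdd T (1 / p) fun s t => ∑ a, f' s a * (S t a - S s a) :=
  VarBdd.sum he.one_div_p_pos.le _ fun a _ => (hS.varBdd a).left_mul (h.continuousOn_deriv a)

theorem varBdd (he : Exponents p q r) (hS : IsRoughPath p T S X)
    (h : IsScalarControlled q r T S f f') : VarBdd T (1 / p) fun s t => f t - f s :=
  ((h.varBdd_linear he hS).add he.one_div_p_pos.le (h.varBdd_remainder.mono he.one_div_p_pos.le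
    (by linarith [he.eq, he.one_div_q_pos]))).congr fun s t _ _ _ => by ring

theorem varBdd_q (he : Exponents p q r) (hS : IsRoughPath p T S X)
    (h : IsScalarControlled q r T S f f') : VarBdd T (1 / q) fun s t => f t - f s :=
  (h.varBdd he hS).mono he.one_div_q_pos.le he.one_div_q_le

theorem coord (hS : ∀ i, ContinuousOn (fun t => S t i) (Icc 0 T)) (i : Fin d) :
    IsScalarControlled q r T S (fun t => S t i) fun _ => Pi.single i 1 where
  continuousOn := hS i
  continuousOn_deriv _ := continuousOn_const
  varBdd_deriv a := VarBdd.zero.congr fun s t _ _ _ => sub_self _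
  varBdd_remainder := VarBdd.zero.congr fun s t _ _ _ => by simp [Pi.single_apply]

theorem const (x : ℝ) : IsScalarControlled q r T S (fun _ => x) fun _ _ => 0 where
  continuousOn := continuousOn_const
  continuousOn_deriv _ := continuousOn_const
  varBdd_deriv a := VarBdd.zero.congr fun s t _ _ _ => sub_self _
  varBdd_remainder := VarBdd.zero.congr fun s t _ _ _ => by simp

theorem add (he : Exponents p q r) (hf : IsScalarControlled q r T S f f')
    (hg : IsScalarControlled q r T S g g') :
    IsScalarControlled q r T S (fun t => f t + g t) fun t a => f' t a + g' t a where
  continuousOn := hf.continuousOn.add hg.continuousOn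
  continuousOn_deriv a := (hf.continuousOn_deriv a).add (hg.continuousOn_deriv a)
  varBdd_deriv a := ((hf.varBdd_deriv a).add he.one_div_q_pos.le (hg.varBdd_deriv a)).congr
    fun s t _ _ _ => by ring
  varBdd_remainder := (hf.varBdd_remainder.add (one_div_pos.mpr he.r_pos).le
    hg.varBdd_remainder).congr fun s t _ _ _ => by
      simp only [add_mul, Finset.sum_add_distrib]; ring

theorem sum (he : Exponents p q r) {ι : Type*} (s : Finset ι) {f : ι → ℝ → ℝ}
    {f' : ι → ℝ → Fin d → ℝ} (h : ∀ i ∈ s, IsScalarControlled q r T S (f i) (f' i)) :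
    IsScalarControlled q r T S (fun t => ∑ i ∈ s, f i t) fun t a => ∑ i ∈ s, f' i t a := by
  classical
  induction s using Finset.induction_on with
  | empty => simp only [Finset.sum_empty]; exact const 0
  | insert i s hi ih =>
    simp only [Finset.sum_insert hi]
    exact (h i (Finset.mem_insert_self i s)).add he
      (ih fun j hj => h j (Finset.mem_insert_of_mem hj))

theorem mul (he : Exponents p q r) (hS : IsRoughPath p T S X)
    (hf : IsScalarControlled q r T S f f') (hg : IsScalarControlled q r T S g g') :
    IsScalarControlled q r T S (fun t => f t * g t) fun t a => f t * g' t a + g t * f' t a where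
  continuousOn := hf.continuousOn.mul hg.continuousOn
  continuousOn_deriv a := (hf.continuousOn.mul (hg.continuousOn_deriv a)).add
    (hg.continuousOn.mul (hf.continuousOn_deriv a))
  varBdd_deriv a := ((VarBdd.path_mul he.one_div_q_pos.le hf.continuousOn (hg.continuousOn_deriv a)
      (hf.varBdd_q he hS) (hg.varBdd_deriv a)).add he.one_div_q_pos.le
      (VarBdd.path_mul he.one_div_q_pos.le hg.continuousOn (hf.continuousOn_deriv a)
      (hg.varBdd_q he hS) (hf.varBdd_deriv a))).congr fun s t _ _ _ => by ring
  varBdd_remainder := by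
    have h0 := (one_div_pos.mpr he.r_pos).le
    have h1 : VarBdd T (1 / r) fun s t => (f t - f s) * (g t - g s) :=
      ((hf.varBdd he hS).mul he.one_div_p_pos.le he.one_div_p_pos.le (hg.varBdd he hS)).mono h0
        (by linarith [he.eq, he.one_div_q_le])
    refine ((h1.add h0 (hg.varBdd_remainder.left_mul hf.continuousOn)).add h0
      (hf.varBdd_remainder.left_mul hg.continuousOn)).congr fun s t _ _ _ => ?_
    simp only [add_mul, Finset.sum_add_distrib, mul_assoc, ← Finset.mul_sum]
    ring

theorem inv (he : Exponents p q r) (hS : IsRoughPath p T S X)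
    (hf : IsScalarControlled q r T S f f') (h0 : ∀ t, 0 ≤ t → t ≤ T → f t ≠ 0) :
    IsScalarControlled q r T S (fun t => (f t)⁻¹) fun t a => -((f t)⁻¹ ^ 2) * f' t a := by
  have hinv : ContinuousOn (fun t => (f t)⁻¹) (Icc 0 T) :=
    hf.continuousOn.inv₀ fun t ht => h0 t ht.1 ht.2
  have hsq' : ContinuousOn (fun t => (f t)⁻¹ ^ 2) (Icc 0 T) := hinv.pow 2
  have hsq : ContinuousOn (fun t => -((f t)⁻¹ ^ 2)) (Icc 0 T) := hsq'.neg
  have hvar : VarBdd T (1 / q) fun s t => (f t)⁻¹ - (f s)⁻¹ :=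
    (((hf.varBdd_q he hS).left_mul hinv).right_mul hinv).neg.congr fun s t hs hst ht => by
      have h1 := h0 s hs (hst.trans ht)
      have h2 := h0 t (hs.trans hst) ht
      field_simp
      ring
  refine ⟨hinv, fun a => hsq.mul (hf.continuousOn_deriv a), fun a => ?_, ?_⟩
  · refine VarBdd.path_mul he.one_div_q_pos.le hsq (hf.continuousOn_deriv a) ?_ (hf.varBdd_deriv a)
    exact (VarBdd.path_mul he.one_div_q_pos.le hinv hinv hvar hvar).neg.congr
      fun s t _ _ _ => by ring
  · have hr0 := (one_div_pos.mpr he.r_pos).le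
    have h1 : VarBdd T (1 / r) fun s t => (f t - f s) * (f t - f s) :=
      ((hf.varBdd he hS).mul he.one_div_p_pos.le he.one_div_p_pos.le (hf.varBdd he hS)).mono hr0
        (by linarith [he.eq, he.one_div_q_le])
    refine (((h1.right_mul hinv).left_mul hsq').add hr0
      (hf.varBdd_remainder.left_mul hsq)).congr fun s t hs hst ht => ?_
    have h1 := h0 s hs (hst.trans ht)
    have h2 := h0 t (hs.trans hst) ht
    simp only [mul_assoc, ← Finset.mul_sum]
    generalize ∑ a, f' s a * (S t a - S s a) = z
    field_simp
    ring

/-- The germ of the integral of one controlled path against another has a superlinear defect of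
additivity. -/
theorem sewable_germ (he : Exponents p q r) (hS : IsRoughPath p T S X)
    (hf : IsScalarControlled q r T S f f') (hg : IsScalarControlled q r T S g g') :
    Sewable T fun s t => f s * (g t - g s) + ∑ a, ∑ b, f' s a * g' s b * X s t a b := by
  have hp := he.one_div_p_pos
  have hq := he.one_div_q_pos
  have h2p : 2 / p = 1 / p + 1 / p := by ring
  have hy := he.young
  have hSs := fun a => smallDiag_of_continuousOn (hS.continuousOn a)
  have hRg : SmallDiag T fun s t => g t - g s - ∑ a, g' s a * (S t a - S s a) := by
    have h1 : SmallDiag T fun s t => ∑ a, -g' s a * (S t a - S s a) :=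
      SmallDiag.sum _ fun a _ => (hSs a).left_mul (hg.continuousOn_deriv a).neg
    have h2 := (smallDiag_of_continuousOn hg.continuousOn).add h1
    simpa only [neg_mul, Finset.sum_neg_distrib, ← sub_eq_add_neg] using h2
  have e1 := SmallDefect.of_mul (one_div_pos.mpr he.r_pos).le hp (by linarith [he.eq])
    hf.varBdd_remainder.neg (hg.varBdd he hS) (smallDiag_of_continuousOn hg.continuousOn)
  have e2 := SmallDefect.of_mul hp.le (one_div_pos.mpr he.r_pos) (by linarith [he.eq])
    (hf.varBdd_linear he hS).neg hg.varBdd_remainder hRg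
  have e3 := SmallDefect.sum Finset.univ fun b _ => SmallDefect.of_mul (add_pos hp hq).le hp
    (by linarith) ((hf.varBdd_linear he hS).neg.mul hp.le hq.le (hg.varBdd_deriv b))
    (hS.varBdd b) (hSs b)
  have e4 := SmallDefect.sum Finset.univ fun a _ => SmallDefect.sum Finset.univ fun b _ =>
    SmallDefect.of_mul hq.le (show 0 < 2 / p by linarith) (by linarith)
      (VarBdd.path_mul hq.le (hf.continuousOn_deriv a) (hg.continuousOn_deriv b)
        (hf.varBdd_deriv a) (hg.varBdd_deriv b)).neg (hS.varBdd_second a b)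
      (hS.smallDiag_second a b)
  refine SmallDefect.sewable ?_
  convert ((e1.add e2).add e3).add e4 using 1
  funext s u t
  have hX : ∑ a, ∑ b, f' s a * g' s b * X s t a b = ∑ a, ∑ b, f' s a * g' s b * X s u a b
      + ∑ a, ∑ b, f' s a * g' s b * X u t a b
      + (∑ a, f' s a * (S u a - S s a)) * ∑ b, g' s b * (S t b - S u b) := by
    rw [Finset.sum_mul_sum]
    simp only [← Finset.sum_add_distrib]
    refine Finset.sum_congr rfl fun a _ => Finset.sum_congr rfl fun b _ => ?_
    rw [hS.chen s u t]
    ring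
  have h4 : ∑ a, ∑ b, -(f' u a * g' u b - f' s a * g' s b) * X u t a b
      = ∑ a, ∑ b, f' s a * g' s b * X u t a b - ∑ a, ∑ b, f' u a * g' u b * X u t a b := by
    simp only [← Finset.sum_sub_distrib]
    refine Finset.sum_congr rfl fun a _ => Finset.sum_congr rfl fun b _ => ?_
    ring
  have h3 : ∑ b, -(∑ a, f' s a * (S u a - S s a)) * (g' u b - g' s b) * (S t b - S u b)
      = (∑ a, f' s a * (S u a - S s a)) * (∑ b, g' s b * (S t b - S u b)
        - ∑ b, g' u b * (S t b - S u b)) := by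
    rw [← Finset.sum_sub_distrib, Finset.mul_sum]
    refine Finset.sum_congr rfl fun b _ => ?_
    ring
  rw [hX, h4, h3]
  ring

end IsScalarControlled

/-! ### Vector-valued controlled paths -/

theorem sqrt_sum_sq_le_sum_abs {ι : Type*} (s : Finset ι) (x : ι → ℝ) :
    √(∑ i ∈ s, x i ^ 2) ≤ ∑ i ∈ s, |x i| := by
  refine Real.sqrt_le_iff.mpr ⟨Finset.sum_nonneg fun _ _ => abs_nonneg _, ?_⟩
  simpa only [sq_abs] using
    Finset.sum_sq_le_sq_sum_of_nonneg (s := s) (f := fun i => |x i|) fun _ _ => abs_nonneg _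

theorem frobNorm_nonneg (A : Matrix (Fin d) (Fin d) ℝ) : 0 ≤ frobNorm A := Real.sqrt_nonneg _

theorem frobNorm_zero : frobNorm (0 : Matrix (Fin d) (Fin d) ℝ) = 0 := by simp [frobNorm]

theorem abs_le_frobNorm (A : Matrix (Fin d) (Fin d) ℝ) (i j : Fin d) : |A i j| ≤ frobNorm A := by
  refine Real.abs_le_sqrt ?_
  refine (Finset.single_le_sum (f := fun j => A i j ^ 2) (fun _ _ => sq_nonneg _)
    (Finset.mem_univ j)).trans ?_
  exact Finset.single_le_sum (f := fun i => ∑ j, A i j ^ 2)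
    (fun _ _ => Finset.sum_nonneg fun _ _ => sq_nonneg _) (Finset.mem_univ i)

theorem frobNorm_le_sum (A : Matrix (Fin d) (Fin d) ℝ) : frobNorm A ≤ ∑ i, ∑ j, |A i j| := by
  unfold frobNorm
  rw [← Finset.sum_product', ← Finset.sum_product']
  exact sqrt_sum_sq_le_sum_abs _ fun x : Fin d × Fin d => A x.1 x.2

theorem norm_le_sum_abs (x : EuclideanSpace ℝ (Fin d)) : ‖x‖ ≤ ∑ i, |x i| := by
  rw [EuclideanSpace.norm_eq]
  simpa only [Real.norm_eq_abs, sq_abs] using sqrt_sum_sq_le_sum_abs Finset.univ fun i => x i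

theorem remainder_apply (S F : ℝ → EuclideanSpace ℝ (Fin d)) (F' : ℝ → Matrix (Fin d) (Fin d) ℝ)
    (s t : ℝ) (i : Fin d) :
    remainder S F F' s t i = F t i - F s i - ∑ a, F' s i a * (S t a - S s a) := by
  simp [remainder, Matrix.toLpLin_apply, Matrix.mulVec, dotProduct]

/-- A path is controlled if and only if its components are. -/
theorem isControlled_iff {p q r T : ℝ} (he : Exponents p q r)
    {S F : ℝ → EuclideanSpace ℝ (Fin d)} {F' : ℝ → Matrix (Fin d) (Fin d) ℝ} :
    IsControlled q r T S F F' ↔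
      ∀ i, IsScalarControlled q r T S (fun t => F t i) fun t a => F' t i a := by
  have hq := he.q_pos
  have hr := he.r_pos
  constructor
  · intro h i
    refine ⟨(EuclideanSpace.proj (𝕜 := ℝ) i).continuous.comp_continuousOn h.continuousOn,
      fun a => h.continuousOn_deriv i a, fun a => ?_, ?_⟩
    · refine (h.variation_deriv.varBdd hq (fun _ _ => frobNorm_nonneg _)
        fun _ => by rw [sub_self, frobNorm_zero]).of_abs_le zero_le_one fun s t _ _ _ => ?_
      rw [one_mul, abs_of_nonneg (frobNorm_nonneg _)]
      exact abs_le_frobNorm (F' t - F' s) i a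
    · refine (h.variation_remainder.varBdd hr (fun _ _ => norm_nonneg _)
        fun _ => by simp [remainder]).of_abs_le zero_le_one fun s t _ _ _ => ?_
      rw [one_mul, abs_norm, ← remainder_apply]
      exact PiLp.norm_apply_le (remainder S F F' s t) i
  · intro h
    refine ⟨?_, fun i a => (h i).continuousOn_deriv a, ?_, ?_⟩
    · have : ContinuousOn (fun t => WithLp.ofLp (F t)) (Icc 0 T) :=
        continuousOn_pi.mpr fun i => (h i).continuousOn
      exact (PiLp.continuous_toLp 2 (fun _ : Fin d => ℝ)).comp_continuousOn this
    · refine VarBdd.hasFiniteVariation (VarBdd.of_abs_le (VarBdd.sum (one_div_pos.mpr hq).le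
        Finset.univ fun i _ => VarBdd.sum (one_div_pos.mpr hq).le Finset.univ fun a _ =>
          ((h i).varBdd_deriv a).abs) zero_le_one fun s t _ _ _ => ?_) hq
          fun _ _ => frobNorm_nonneg _
      rw [one_mul, abs_of_nonneg (frobNorm_nonneg _)]
      exact (frobNorm_le_sum _).trans (le_abs_self _)
    · refine VarBdd.hasFiniteVariation (VarBdd.of_abs_le (VarBdd.sum (one_div_pos.mpr hr).le
        Finset.univ fun i _ => (h i).varBdd_remainder.abs) zero_le_one fun s t _ _ _ => ?_) hr
          fun _ _ => norm_nonneg _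
      rw [one_mul, abs_norm]
      refine (norm_le_sum_abs _).trans (le_trans (le_of_eq ?_) (le_abs_self _))
      simp only [remainder_apply]

end PathwisePortfolio

namespace PathwisePortfolio

/-! ### Price paths as rough paths -/

variable {d : ℕ} {p q r : ℝ} {P : ℕ → HalfLinePartition} {S : ℝ → EuclideanSpace ℝ (Fin d)}

namespace HalfLinePartition

variable (Q : HalfLinePartition)

theorem pt_nonneg (k : ℕ) : 0 ≤ Q.pt k :=
  Q.pt_zero.ge.trans (Q.strictMono.monotone (Nat.zero_le k))

theorem exists_floor {x : ℝ} (hx : 0 ≤ x) : ∃ k, Q.pt k ≤ x ∧ x < Q.pt (k + 1) := by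
  classical
  have hex : ∃ k, x < Q.pt k := (Q.tendsto.eventually_gt_atTop x).exists
  have h1 := Nat.find_spec hex
  have h2 := fun m (hm : m < Nat.find hex) => Nat.find_min hex hm
  generalize Nat.find hex = n at h1 h2
  rcases n with _ | k
  · rw [Q.pt_zero] at h1
    exact absurd h1 (not_lt.mpr hx)
  · exact ⟨k, not_lt.mp (h2 k (Nat.lt_succ_self k)), h1⟩

/-- The Riemann sum up to a time `t` in the interval `[t_K, t_{K+1}]`. -/
theorem leftSum_eq_sum_add (F G : ℝ → ℝ) {K : ℕ} {t : ℝ} (h1 : Q.pt K ≤ t)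
    (h2 : t ≤ Q.pt (K + 1)) :
    Q.leftSum F G t = ∑ k ∈ Finset.range K, F (Q.pt k) * (G (Q.pt (k + 1)) - G (Q.pt k))
      + F (Q.pt K) * (G t - G (Q.pt K)) := by
  unfold leftSum
  rw [tsum_eq_sum (s := Finset.range (K + 1)), Finset.sum_range_succ, min_eq_left h1,
    min_eq_right h2]
  · congr 1
    refine Finset.sum_congr rfl fun k hk => ?_
    have hk := Finset.mem_range.mp hk
    rw [min_eq_left ((Q.strictMono.monotone hk.le).trans h1),
      min_eq_left ((Q.strictMono.monotone (Nat.succ_le_of_lt hk)).trans h1)]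
  · intro k hk
    have hk : K + 1 ≤ k := by simpa using hk
    rw [min_eq_right (h2.trans (Q.strictMono.monotone hk)),
      min_eq_right (h2.trans (Q.strictMono.monotone (hk.trans (Nat.le_succ k)))), sub_self,
      mul_zero]

theorem leftSum_pt (F G : ℝ → ℝ) (K : ℕ) : Q.leftSum F G (Q.pt K)
    = ∑ k ∈ Finset.range K, F (Q.pt k) * (G (Q.pt (k + 1)) - G (Q.pt k)) := by
  rw [Q.leftSum_eq_sum_add F G le_rfl (Q.strictMono.monotone (Nat.le_succ K)), sub_self, mul_zero,
    add_zero]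

theorem leftSum_pt_succ (F G : ℝ → ℝ) (K : ℕ) : Q.leftSum F G (Q.pt (K + 1))
    = Q.leftSum F G (Q.pt K) + F (Q.pt K) * (G (Q.pt (K + 1)) - G (Q.pt K)) := by
  rw [leftSum_pt, leftSum_pt, Finset.sum_range_succ]

end HalfLinePartition

theorem le_rpow_of_rpow_le {x c a b : ℝ} (hx : 0 ≤ x) (ha : 0 < a) (hab : a * b = 1)
    (h : x ^ a ≤ c) : x ≤ c ^ b := by
  have hb : 0 ≤ b := by
    by_contra hb
    nlinarith [mul_neg_of_pos_of_neg ha (not_le.mp hb)]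
  have := Real.rpow_le_rpow (Real.rpow_nonneg hx a) h hb
  rwa [← Real.rpow_mul hx, hab, Real.rpow_one] at this

namespace IsPricePath

theorem continuousOn_coord (hS : IsPricePath p P S) (i : Fin d) :
    ContinuousOn (fun t => S t i) (Ici 0) :=
  (EuclideanSpace.proj (𝕜 := ℝ) i).continuous.comp_continuousOn hS.continuousOn

theorem continuousOn_coord_Icc (hS : IsPricePath p P S) (T : ℝ) (i : Fin d) :
    ContinuousOn (fun t => S t i) (Icc 0 T) :=
  (hS.continuousOn_coord i).mono Icc_subset_Ici_self

theorem meshToZero (hS : IsPricePath p P S) : MeshToZero P := fun T hT δ hδ => by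
  classical
  rcases eq_or_lt_of_le hT with rfl | hT
  · refine Eventually.of_forall fun n k => ?_
    rw [min_eq_right ((P n).pt_nonneg _), min_eq_right ((P n).pt_nonneg _), sub_self]
    exact hδ.le
  refine ((hS.rie T hT).mesh_tendsto.eventually (gt_mem_nhds hδ)).mono fun n hn k => ?_
  rcases lt_or_ge k ((P n).restrict T hT.le).N with hk | hk
  · exact (((P n).restrict T hT.le).gap_le_mesh hk).trans hn.le
  · have h1 := (P n).le_pt_of_find_le hk
    have h2 := (P n).le_pt_of_find_le (le_trans hk (Nat.le_succ k))
    rw [min_eq_right h1, min_eq_right h2, sub_self]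
    exact hδ.le

theorem tendstoUniformlyOn_leftSum (hS : IsPricePath p P S) {T : ℝ} (hT : 0 < T) (i j : Fin d) :
    TendstoUniformlyOn (fun n t => (P n).leftSum (fun u => S u i) (fun u => S u j) t)
      (fun t => itoIntegral P S t i j) atTop (Icc 0 T) := by
  obtain ⟨I, hI⟩ := (hS.rie T hT).converges
  have h1 : TendstoUniformlyOn (fun n t => (P n).leftSum (fun u => S u i) (fun u => S u j) t)
      (fun t => I t i j) atTop (Icc 0 T) :=
    (hI i j).congr (Eventually.of_forall fun n t ht =>
      (P n).restrict_leftSum (fun u => S u i) (fun u => S u j) hT.le ht.2)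
  exact h1.congr_right fun t ht => ((h1.tendsto_at ht).limUnder_eq).symm

theorem continuousOn_itoIntegral (hS : IsPricePath p P S) {T : ℝ} (hT : 0 < T) (i j : Fin d) :
    ContinuousOn (fun t => itoIntegral P S t i j) (Icc 0 T) := by
  refine (hS.tendstoUniformlyOn_leftSum hT i j).continuousOn (Frequently.of_forall fun n => ?_)
  have h : ∀ x, 0 ≤ x → ContinuousOn (fun t => S (min x t) j) (Icc 0 T) := fun x hx =>
    (hS.continuousOn_coord j).comp (continuous_const.min continuous_id).continuousOn
      fun t ht => le_min hx ht.1
  have h0 : ∀ k, 0 ≤ ((P n).restrict T hT.le).pt k := fun k => le_min ((P n).pt_nonneg k) hT.le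
  have h2 : ContinuousOn (fun t => ((P n).restrict T hT.le).leftSum (fun u => S u i)
      (fun u => S u j) t) (Icc 0 T) :=
    continuousOn_finsetSum _ fun k _ => continuousOn_const.mul ((h _ (h0 _)).sub (h _ (h0 _)))
  exact h2.congr fun t ht => ((P n).restrict_leftSum _ _ hT.le ht.2).symm

/-- The quantitative part of Property (RIE): the path and the discrete second levels are bounded
by powers of one control. -/
theorem exists_control (hS : IsPricePath p P S) (hp : 0 < p) {T : ℝ} (hT : 0 < T) :
    ∃ c, IsControl T c ∧
      (∀ s t i, 0 ≤ s → s ≤ t → t ≤ T → |S t i - S s i| ≤ c s t ^ (1 / p)) ∧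
      ∀ n k l i j, k ≤ l → (P n).pt l ≤ T →
        |(P n).leftSum (fun u => S u i) (fun u => S u j) ((P n).pt l)
          - (P n).leftSum (fun u => S u i) (fun u => S u j) ((P n).pt k)
          - S ((P n).pt k) i * (S ((P n).pt l) j - S ((P n).pt k) j)|
          ≤ c ((P n).pt k) ((P n).pt l) ^ (2 / p) := by
  classical
  obtain ⟨c, hc, A, B, hA, hB, hAB, h1, h2⟩ := (hS.rie T hT).control
  refine ⟨c, hc, fun s t i hs hst ht => ?_, fun n k l i j hkl hl => ?_⟩
  · have h0 := hc.nonneg hs hst ht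
    refine (PiLp.norm_apply_le (S t - S s) i).trans ?_
    refine le_rpow_of_rpow_le (norm_nonneg _) hp (by field_simp) ((h1 s t hs hst ht).trans ?_)
    exact mul_le_of_le_one_left h0 (by linarith)
  · have hk := ((P n).strictMono.monotone hkl).trans hl
    have h0 := hc.nonneg ((P n).pt_nonneg k) ((P n).strictMono.monotone hkl) hl
    rcases eq_or_lt_of_le hkl with rfl | hkl
    · simpa using Real.rpow_nonneg h0 _
    have hN : l ≤ ((P n).restrict T hT.le).N := by
      by_contra hN
      have := (P n).le_pt_of_find_le (t := T) le_rfl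
      exact absurd (this.trans_lt ((P n).strictMono (not_le.mp hN))) (not_lt.mpr hl)
    have e1 : ((P n).restrict T hT.le).pt l = (P n).pt l := min_eq_left hl
    have e2 : ((P n).restrict T hT.le).pt k = (P n).pt k := min_eq_left hk
    have := h2 n k l hkl hN
    rw [e1, e2] at this
    have key := le_rpow_of_rpow_le (b := 2 / p) (frobNorm_nonneg _) (half_pos hp)
      (by field_simp) (this.trans (mul_le_of_le_one_left h0 (by linarith)))
    refine (le_trans (le_of_eq ?_) (abs_le_frobNorm _ i j)).trans key
    simp only [Partition.tensorSum, tensor, Matrix.sub_apply, Matrix.of_apply, PiLp.sub_apply,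
      (P n).restrict_leftSum _ _ hT.le hl, (P n).restrict_leftSum _ _ hT.le hk]

/-- Every time is approximated from the left by partition points. -/
theorem exists_tendsto_pt (hS : IsPricePath p P S) {T x : ℝ} (hx : 0 ≤ x) (hxT : x ≤ T) :
    ∃ κ : ℕ → ℕ, (∀ n, (P n).pt (κ n) ≤ x) ∧ (∀ n, x < (P n).pt (κ n + 1)) ∧
      Tendsto (fun n => (P n).pt (κ n)) atTop (𝓝[Icc 0 T] x) := by
  choose κ h1 h2 using fun n => (P n).exists_floor hx
  refine ⟨κ, h1, h2, tendsto_nhdsWithin_iff.mpr ⟨?_, Eventually.of_forall fun n =>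
    ⟨(P n).pt_nonneg _, (h1 n).trans hxT⟩⟩⟩
  refine Metric.tendsto_nhds.mpr fun ε hε => ?_
  refine (hS.meshToZero T (hx.trans hxT) (ε / 2) (half_pos hε)).mono fun n hn => ?_
  have h3 := hn (κ n)
  rw [min_eq_left ((h1 n).trans hxT)] at h3
  have h4 := le_min (h2 n).le hxT
  rw [Real.dist_eq, abs_sub_comm, abs_of_nonneg (sub_nonneg.mpr (h1 n))]
  linarith

/-- Every time before `T` is approximated from the right by partition points. -/
theorem exists_tendsto_pt_right (hS : IsPricePath p P S) {T x : ℝ} (hx : 0 ≤ x) (hxT : x < T) :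
    ∃ κ : ℕ → ℕ, (∀ n, x ≤ (P n).pt (κ n)) ∧
      Tendsto (fun n => (P n).pt (κ n)) atTop (𝓝[Icc 0 T] x) := by
  choose κ h1 h2 using fun n => (P n).exists_floor hx
  have key : ∀ ε > 0, ∀ᶠ n in atTop, min ((P n).pt (κ n + 1)) T ≤ x + ε := fun ε hε =>
    (hS.meshToZero T (hx.trans hxT.le) ε hε).mono fun n hn => by
      have h3 := hn (κ n)
      rw [min_eq_left ((h1 n).trans hxT.le)] at h3
      linarith [h1 n]
  have key' : ∀ ε > 0, ∀ᶠ n in atTop, (P n).pt (κ n + 1) ≤ x + ε ∧ (P n).pt (κ n + 1) ≤ T :=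
    fun ε hε => by
      filter_upwards [key ((T - x) / 2) (by linarith), key ε hε] with n hn hn'
      rcases le_total ((P n).pt (κ n + 1)) T with h | h
      · exact ⟨by rwa [min_eq_left h] at hn', h⟩
      · rw [min_eq_right h] at hn
        linarith
  refine ⟨fun n => κ n + 1, fun n => (h2 n).le, tendsto_nhdsWithin_iff.mpr ⟨?_,
    (key' 1 one_pos).mono fun n hn => ⟨(P n).pt_nonneg _, hn.2⟩⟩⟩
  refine Metric.tendsto_nhds.mpr fun ε hε => ?_
  refine (key' (ε / 2) (half_pos hε)).mono fun n hn => ?_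
  rw [Real.dist_eq, abs_of_nonneg (sub_nonneg.mpr (h2 n).le)]
  linarith [hn.1]

theorem tendsto_leftSum_pt (hS : IsPricePath p P S) {T x : ℝ} (hT : 0 < T) (hx : x ∈ Icc 0 T)
    {y : ℕ → ℝ} (hy : Tendsto y atTop (𝓝[Icc 0 T] x)) (i j : Fin d) :
    Tendsto (fun n => (P n).leftSum (fun u => S u i) (fun u => S u j) (y n)) atTop
      (𝓝 (itoIntegral P S x i j)) :=
  (hS.tendstoUniformlyOn_leftSum hT i j).tendstoLocallyUniformlyOn.tendsto_comp
    (hS.continuousOn_itoIntegral hT i j x hx) hx hy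

theorem secondLevel_apply (s t : ℝ) (i j : Fin d) : secondLevel P S s t i j
    = itoIntegral P S t i j - itoIntegral P S s i j - S s i * (S t j - S s j) := by
  simp [secondLevel, tensor]

/-- A price path, with its second level, is a rough path. The bound on the second level passes to
the limit along partition points inside the interval, so that the control need not be
continuous. -/
theorem isRoughPath (hS : IsPricePath p P S) (hp : 0 < p) {T : ℝ} (hT : 0 < T) :
    IsRoughPath p T S (secondLevel P S) := by
  obtain ⟨c, hc, h1, h2⟩ := hS.exists_control hp hT
  have hcont := hS.continuousOn_coord_Icc T
  refine ⟨hcont, fun i => ⟨c, hc, 1, zero_le_one, fun s t hs hst ht => ?_⟩,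
    fun i j => ⟨c, hc, 1, zero_le_one, fun s t hs hst ht => ?_⟩, fun i j => ?_,
    fun s u t i j => ?_⟩
  · rw [one_mul]
    exact h1 s t i hs hst ht
  · beta_reduce
    rw [one_mul]
    rcases eq_or_lt_of_le hst with rfl | hlt
    · rw [secondLevel_apply, sub_self, sub_self, mul_zero, sub_zero, abs_zero]
      exact Real.rpow_nonneg (hc.nonneg hs le_rfl ht) _
    have hsm : s ∈ Icc 0 T := ⟨hs, hst.trans ht⟩
    have htm : t ∈ Icc 0 T := ⟨hs.trans hst, ht⟩
    obtain ⟨k, hk1, hk2⟩ := hS.exists_tendsto_pt_right hs (hlt.trans_le ht)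
    obtain ⟨l, hl1, _, hl2⟩ := hS.exists_tendsto_pt htm.1 ht
    have lim : Tendsto (fun n => (P n).leftSum (fun u => S u i) (fun u => S u j) ((P n).pt (l n))
          - (P n).leftSum (fun u => S u i) (fun u => S u j) ((P n).pt (k n))
          - S ((P n).pt (k n)) i * (S ((P n).pt (l n)) j - S ((P n).pt (k n)) j)) atTop
        (𝓝 (secondLevel P S s t i j)) := by
      rw [secondLevel_apply]
      exact ((hS.tendsto_leftSum_pt hT htm hl2 i j).sub
        (hS.tendsto_leftSum_pt hT hsm hk2 i j)).sub
        (((hcont i s hsm).tendsto.comp hk2).mul (((hcont j t htm).tendsto.comp hl2).sub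
          ((hcont j s hsm).tendsto.comp hk2)))
    refine le_of_tendsto lim.abs ?_
    have hk3 := (tendsto_nhds_of_tendsto_nhdsWithin hk2).eventually
      (gt_mem_nhds (show s < (s + t) / 2 by linarith))
    have hl3 := (tendsto_nhds_of_tendsto_nhdsWithin hl2).eventually
      (lt_mem_nhds (show (s + t) / 2 < t by linarith))
    filter_upwards [hk3, hl3] with n hkn hln
    have hkl : k n ≤ l n := ((P n).strictMono.lt_iff_lt.mp (hkn.trans hln)).le
    have hkl' := (P n).strictMono.monotone hkl
    refine (h2 n (k n) (l n) i j hkl ((hl1 n).trans ht)).trans (Real.rpow_le_rpow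
      (hc.nonneg ((P n).pt_nonneg _) hkl' ((hl1 n).trans ht))
      (hc.mono hs (hk1 n) hkl' (hl1 n) ht) (by positivity))
  · have e1 := smallDiag_of_continuousOn (hS.continuousOn_itoIntegral hT i j)
    have e2 : SmallDiag T fun s t => -S s i * (S t j - S s j) :=
      (smallDiag_of_continuousOn (hcont j)).left_mul (hcont i).neg
    refine fun ε hε => ?_
    obtain ⟨δ, hδ, h⟩ := e1.add e2 ε hε
    refine ⟨δ, hδ, fun s t hs hst ht hd => ?_⟩
    have := h s t hs hst ht hd
    beta_reduce at this ⊢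
    rwa [neg_mul, ← sub_eq_add_neg, ← secondLevel_apply] at this
  · simp only [secondLevel_apply]
    ring

/-! ### Left-point Riemann sums -/

/-- Along the given partitions, the compensating terms in the Riemann sums vanish in the limit:
at partition points `𝕊` is the increment of the difference between the integral `∫ S ⊗ dS` and
its Riemann sums, which tends to zero uniformly and is bounded in `p/2`-variation. The claim is
then a consequence of Young's estimate. -/
theorem tendstoUniformlyOn_germSum_secondLevel (hS : IsPricePath p P S) (he : Exponents p q r)
    {T : ℝ} (hT : 0 < T) {A : ℝ → ℝ} (hA : ContinuousOn A (Icc 0 T))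
    (hA' : VarBdd T (1 / q) fun s t => A t - A s) (i j : Fin d) :
    TendstoUniformlyOn (fun n t => (P n).germSum (fun u v => A u * secondLevel P S u v i j) t)
      (fun _ => 0) atTop (Icc 0 T) := by
  classical
  have hp : 0 < p := by linarith [he.two_lt]
  have hq := he.one_div_q_pos
  have hX := hS.isRoughPath hp hT
  obtain ⟨c₁, hc₁, -, h₁⟩ := hS.exists_control hp hT
  obtain ⟨c₂, hc₂, K₂, hK₂, h₂⟩ := hX.varBdd_second i j
  obtain ⟨c₃, hc₃, K₃, hK₃, h₃⟩ := hA'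
  obtain ⟨MA, hMA, hMA'⟩ := exists_abs_le_of_continuousOn hA
  have hc := (hc₁.add hc₂).add hc₃
  set c : ℝ → ℝ → ℝ := fun s t => c₁ s t + c₂ s t + c₃ s t with hcdef
  obtain ⟨η, hη0, hη1, hη⟩ : ∃ η : ℝ, 0 < η ∧ η < 1 ∧ 1 < 1 / q + 2 / p * (1 - η) := by
    have h2p : 0 < 2 / p := by positivity
    have hy := he.young
    refine ⟨min (1 / 2) ((2 / p + 1 / q - 1) / (2 * (2 / p))), ?_, ?_, ?_⟩
    · have : 0 < 2 / p + 1 / q - 1 := by linarith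
      positivity
    · exact (min_le_left _ _).trans_lt (by norm_num)
    · have h1 := mul_le_mul_of_nonneg_right
        (min_le_right (1 / 2) ((2 / p + 1 / q - 1) / (2 * (2 / p)))) h2p.le
      have h2 : (2 / p + 1 / q - 1) / (2 * (2 / p)) * (2 / p) = (2 / p + 1 / q - 1) / 2 := by
        field_simp
      nlinarith
  set θ := 1 / q + 2 / p * (1 - η) with hθ
  refine Metric.tendstoUniformlyOn_iff.mpr fun ε hε => ?_
  -- the Young bound as a function of the uniform distance of the Riemann sums to their limit
  set Y : ℝ → ℝ := fun ρ => MA * (2 * ρ) +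
    sewConst θ * (K₃ * ((1 + K₂) ^ (1 - η) * (2 * ρ) ^ η)) * c 0 T ^ θ with hY
  obtain ⟨ρ, hρ0, hρ⟩ : ∃ ρ > 0, Y ρ < ε / 2 := by
    have hcont : Continuous Y := by
      have : Continuous fun ρ : ℝ => (2 * ρ) ^ η :=
        (continuous_const.mul continuous_id).rpow_const fun _ => Or.inr hη0.le
      fun_prop
    have h0 : Y 0 < ε / 2 := by
      simp only [hY, mul_zero, Real.zero_rpow hη0.ne', zero_mul, add_zero]
      linarith
    obtain ⟨ρ, hρ1, hρ2⟩ := (((hcont.tendsto 0).mono_left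
      (nhdsWithin_le_nhds (s := Ioi 0))).eventually (gt_mem_nhds h0)).and
      self_mem_nhdsWithin |>.exists
    exact ⟨ρ, hρ2, hρ1⟩
  obtain ⟨δ, hδ, hsm⟩ := hX.smallDiag_second i j (ε / (4 * (MA + 1))) (by positivity)
  filter_upwards [Metric.tendstoUniformlyOn_iff.mp (hS.tendstoUniformlyOn_leftSum hT i j) ρ hρ0,
    hS.meshToZero T hT.le δ hδ] with n hn hmesh t ht
  rw [dist_zero_left, Real.norm_eq_abs]
  set u := (P n).pt with hu
  have hum : Monotone u := (P n).strictMono.monotone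
  unfold HalfLinePartition.germSum
  rcases hN : Nat.find ((P n).exists_le t) with _ | M
  · simpa using hε
  have hlt : u M < t := (P n).pt_lt_of_lt_find (by omega)
  have hle : t ≤ u (M + 1) := (P n).le_pt_of_find_le (by omega)
  have huT : ∀ k ≤ M, u k ≤ T := fun k hk => (hum hk).trans (hlt.le.trans ht.2)
  have hu0 : ∀ k, 0 ≤ u k := (P n).pt_nonneg
  rw [Finset.sum_range_succ, min_eq_left hlt.le, min_eq_right hle]
  have hlast : |A (u M) * secondLevel P S (u M) t i j| ≤ ε / 4 := by
    have h4 : t - u M ≤ δ := by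
      have := hmesh M
      rw [min_eq_left (huT M le_rfl)] at this
      linarith [le_min hle ht.2]
    rw [abs_mul]
    calc _ ≤ MA * (ε / (4 * (MA + 1))) := mul_le_mul (hMA' _ (hu0 M) (huT M le_rfl))
          (hsm _ _ (hu0 M) hlt.le ht.2 h4) (abs_nonneg _) hMA
      _ ≤ ε / 4 := by
          rw [mul_div_assoc', div_le_div_iff₀ (by positivity) (by norm_num)]
          nlinarith
  set Z : ℕ → ℝ := fun k => (P n).leftSum (fun v => S v i) (fun v => S v j) (u k)
    - itoIntegral P S (u k) i j with hZ
  have hZ1 : ∀ k, secondLevel P S (u k) (u (k + 1)) i j = -(Z (k + 1) - Z k) := fun k => by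
    simp only [hZ, secondLevel_apply, hu, (P n).leftSum_pt_succ]
    ring
  have hsum : ∑ k ∈ Finset.range M, A (min (u k) t) *
      secondLevel P S (min (u k) t) (min (u (k + 1)) t) i j
      = -∑ k ∈ Finset.range M, A (u k) * (Z (k + 1) - Z k) := by
    rw [← Finset.sum_neg_distrib]
    refine Finset.sum_congr rfl fun k hk => ?_
    have hk := Finset.mem_range.mp hk
    rw [min_eq_left ((hum hk.le).trans hlt.le),
      min_eq_left ((hum (Nat.succ_le_of_lt hk)).trans hlt.le), hZ1]
    ring
  have hcpos : ∀ k l, k ≤ l → l ≤ M → 0 ≤ c (u k) (u l) := fun k l hkl hl =>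
    hc.nonneg (hu0 k) (hum hkl) (huT l hl)
  have hZρ : ∀ k ≤ M, |Z k| ≤ ρ := fun k hk => by
    have := hn (u k) ⟨hu0 k, huT k hk⟩
    rw [dist_comm, Real.dist_eq] at this
    exact this.le
  have hZsmall : ∀ k l, k ≤ l → l ≤ M → |Z l - Z k| ≤ 2 * ρ := fun k l hkl hl =>
    (abs_sub _ _).trans (by linarith [hZρ k (hkl.trans hl), hZρ l hl])
  have hZvar : ∀ k l, k ≤ l → l ≤ M → |Z l - Z k| ≤ (1 + K₂) * c (u k) (u l) ^ (2 / p) :=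
    fun k l hkl hl => by
      have p1 := hc₁.nonneg (hu0 k) (hum hkl) (huT l hl)
      have p2 := hc₂.nonneg (hu0 k) (hum hkl) (huT l hl)
      have p3 := hc₃.nonneg (hu0 k) (hum hkl) (huT l hl)
      have e1 := h₁ n k l i j hkl (huT l hl)
      have e2 := h₂ _ _ (hu0 k) (hum hkl) (huT l hl)
      beta_reduce at e2
      rw [secondLevel_apply] at e2
      have e3 : c₁ (u k) (u l) ^ (2 / p) ≤ c (u k) (u l) ^ (2 / p) :=
        Real.rpow_le_rpow p1 (by simp only [hcdef]; linarith) (by positivity)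
      have e4 : c₂ (u k) (u l) ^ (2 / p) ≤ c (u k) (u l) ^ (2 / p) :=
        Real.rpow_le_rpow p2 (by simp only [hcdef]; linarith) (by positivity)
      have e5 := mul_le_mul_of_nonneg_left e4 hK₂
      rw [add_mul, one_mul]
      refine le_trans (le_of_eq ?_) ((abs_sub _ _).trans (add_le_add (e1.trans e3) (e2.trans e5)))
      congr 1
      simp only [hZ]
      ring
  have hZint : ∀ k l, k ≤ l → l ≤ M → |Z l - Z k| ≤
      (1 + K₂) ^ (1 - η) * (2 * ρ) ^ η * c (u k) (u l) ^ (2 / p * (1 - η)) := fun k l hkl hl => by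
    have h1η : 0 < 1 - η := by linarith
    have f1 := Real.rpow_le_rpow (abs_nonneg _) (hZsmall k l hkl hl) hη0.le
    have f2 := Real.rpow_le_rpow (abs_nonneg _) (hZvar k l hkl hl) h1η.le
    rw [Real.mul_rpow (by positivity) (Real.rpow_nonneg (hcpos k l hkl hl) _),
      ← Real.rpow_mul (hcpos k l hkl hl)] at f2
    have f3 : |Z l - Z k| = |Z l - Z k| ^ η * |Z l - Z k| ^ (1 - η) := by
      rw [← Real.rpow_add_of_nonneg (abs_nonneg _) hη0.le h1η.le, add_sub_cancel, Real.rpow_one]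
    rw [f3]
    refine (mul_le_mul f1 f2 (by positivity) (by positivity)).trans (le_of_eq (by ring))
  have hyoung := discrete_sewing hη (N := M) (Ξ := fun k l => A (u k) * (Z l - Z k))
    (ω := fun k l => c (u k) (u l)) (ε := K₃ * ((1 + K₂) ^ (1 - η) * (2 * ρ) ^ η))
    (by positivity) hcpos
    (fun k l m hkl hlm hm => hc.2 _ _ _ (hu0 k) (hum hkl) (hum hlm) (huT m hm))
    (fun k _ => by rw [sub_self, mul_zero])
    (fun k l m hkl hlm hm => by
      have p1 := hcpos k l hkl (hlm.trans hm)
      have p2 := hcpos l m hlm hm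
      have p3 := hc.2 _ _ _ (hu0 k) (hum hkl) (hum hlm) (huT m hm)
      have e1 := h₃ _ _ (hu0 k) (hum hkl) (huT l (hlm.trans hm))
      have q1 := hc₁.nonneg (hu0 k) (hum hkl) (huT l (hlm.trans hm))
      have q2 := hc₂.nonneg (hu0 k) (hum hkl) (huT l (hlm.trans hm))
      have q3 := hc₃.nonneg (hu0 k) (hum hkl) (huT l (hlm.trans hm))
      have e2 : |A (u l) - A (u k)| ≤ K₃ * c (u k) (u m) ^ (1 / q) :=
        e1.trans (mul_le_mul_of_nonneg_left (Real.rpow_le_rpow q3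
          (by simp only [hcdef] at p2 p3 ⊢; linarith) hq.le) hK₃)
      have hexp : 0 ≤ 2 / p * (1 - η) := mul_nonneg (by positivity) (by linarith)
      have e3 : |Z m - Z l| ≤ (1 + K₂) ^ (1 - η) * (2 * ρ) ^ η *
          c (u k) (u m) ^ (2 / p * (1 - η)) :=
        (hZint l m hlm hm).trans (mul_le_mul_of_nonneg_left (Real.rpow_le_rpow p2
          (by linarith) hexp) (by positivity))
      have p4 : 0 ≤ c (u k) (u m) := hcpos k m (hkl.trans hlm) hm
      calc |A (u k) * (Z m - Z k) - A (u k) * (Z l - Z k) - A (u l) * (Z m - Z l)|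
          = |A (u l) - A (u k)| * |Z m - Z l| := by rw [← abs_mul, ← abs_neg]; congr 1; ring
        _ ≤ _ := mul_le_mul e2 e3 (abs_nonneg _) (by positivity)
        _ = _ := by rw [Real.rpow_add_of_nonneg p4 hq.le hexp]; ring)
    (Nat.zero_le M) le_rfl
  rw [Nat.Ico_zero_eq_range] at hyoung
  have hfirst : |A (u 0) * (Z M - Z 0)| ≤ MA * (2 * ρ) := by
    rw [abs_mul]
    exact mul_le_mul (hMA' _ (hu0 0) (huT 0 (Nat.zero_le M))) (hZsmall 0 M (Nat.zero_le M) le_rfl)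
      (abs_nonneg _) hMA
  have hcT : c (u 0) (u M) ^ θ ≤ c 0 T ^ θ := Real.rpow_le_rpow (hcpos 0 M (Nat.zero_le M) le_rfl)
    (hc.mono le_rfl (hu0 0) (hum (Nat.zero_le M)) (huT M le_rfl) le_rfl) (by linarith)
  have hK := sewConst_nonneg hη
  have hcT' := mul_le_mul_of_nonneg_left hcT
    (show 0 ≤ sewConst θ * (K₃ * ((1 + K₂) ^ (1 - η) * (2 * ρ) ^ η)) by positivity)
  have hmain : |∑ k ∈ Finset.range M, A (u k) * (Z (k + 1) - Z k)| ≤ Y ρ := by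
    simp only [hY]
    have := abs_add_le (∑ k ∈ Finset.range M, A (u k) * (Z (k + 1) - Z k) - A (u 0) * (Z M - Z 0))
      (A (u 0) * (Z M - Z 0))
    rw [sub_add_cancel] at this
    linarith
  refine (abs_add_le _ _).trans_lt ?_
  rw [hsum, abs_neg]
  linarith

theorem tendstoUniformlyOn_sum {ι : Type*} (s : Finset ι) {F : ι → ℕ → ℝ → ℝ} {f : ι → ℝ → ℝ}
    {K : Set ℝ} (h : ∀ i ∈ s, TendstoUniformlyOn (F i) (f i) atTop K) :
    TendstoUniformlyOn (fun n t => ∑ i ∈ s, F i n t) (fun t => ∑ i ∈ s, f i t) atTop K := by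
  classical
  induction s using Finset.induction_on with
  | empty =>
    simp only [Finset.sum_empty]
    exact Metric.tendstoUniformlyOn_iff.mpr fun ε hε => Eventually.of_forall fun _ _ _ => by
      simpa using hε
  | insert i s hi ih =>
    simp only [Finset.sum_insert hi]
    exact (h i (Finset.mem_insert_self i s)).add
      (ih fun j hj => h j (Finset.mem_insert_of_mem hj))

/-- The integral of a controlled path against another one is a limit of left-point Riemann
sums. -/
theorem tendstoUniformlyOn_leftSum_of_isSewing (hS : IsPricePath p P S) (he : Exponents p q r)
    {T : ℝ} (hT : 0 < T) {f g : ℝ → ℝ} {f' g' : ℝ → Fin d → ℝ}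
    (hf : IsScalarControlled q r T S f f') (hg : IsScalarControlled q r T S g g') {I : ℝ → ℝ}
    (hI : IsSewing T (fun s t => f s * (g t - g s)
      + ∑ a, ∑ b, f' s a * g' s b * secondLevel P S s t a b) I) :
    TendstoUniformlyOn (fun n t => (P n).leftSum f g t) (fun t => I t - I 0) atTop (Icc 0 T) := by
  have hX := hS.isRoughPath (by linarith [he.two_lt]) hT
  have h1 := hI.tendstoUniformlyOn hT.le hS.meshToZero
  have h2 := tendstoUniformlyOn_sum Finset.univ fun a _ => tendstoUniformlyOn_sum Finset.univ
    fun b _ => hS.tendstoUniformlyOn_germSum_secondLevel he hT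
      ((hf.continuousOn_deriv a).mul (hg.continuousOn_deriv b))
      (VarBdd.path_mul he.one_div_q_pos.le (hf.continuousOn_deriv a) (hg.continuousOn_deriv b)
        (hf.varBdd_deriv a) (hg.varBdd_deriv b)) a b
  have h3 := h1.sub h2
  refine (h3.congr (Eventually.of_forall fun n t _ => ?_)).congr_right fun t _ => ?_
  · simp only [Pi.sub_apply, HalfLinePartition.germSum_add, HalfLinePartition.germSum_sum,
      HalfLinePartition.leftSum_eq_germSum, Pi.mul_apply]
    ring
  · simp

end IsPricePath

end PathwisePortfolio

namespace PathwisePortfolio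

variable {d : ℕ} {p q r : ℝ} {P : ℕ → HalfLinePartition} {S : ℝ → EuclideanSpace ℝ (Fin d)}

/-! ### The bracket -/

theorem bracket_apply (t : ℝ) (i j : Fin d) : bracket P S t i j
    = S t i * S t j - itoIntegral P S t i j - itoIntegral P S t j i
      - (S 0 i * S 0 j - itoIntegral P S 0 i j - itoIntegral P S 0 j i) := by
  simp only [bracket, tensor, Matrix.sub_apply, Matrix.add_apply, Matrix.transpose_apply,
    Matrix.of_apply, PiLp.sub_apply, IsPricePath.secondLevel_apply]
  ring

theorem bracket_sub_bracket (s t : ℝ) (i j : Fin d) : bracket P S t i j - bracket P S s i j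
    = (S t i - S s i) * (S t j - S s j) - secondLevel P S s t i j - secondLevel P S s t j i := by
  simp only [bracket_apply, IsPricePath.secondLevel_apply]
  ring

namespace IsPricePath

/-- The bracket of `S^i + σ S^j` is nondecreasing, as a limit of sums of squares. -/
theorem monotoneOn_bracket_quadratic (hS : IsPricePath p P S) {T : ℝ} (hT : 0 < T) (i j : Fin d)
    (σ : ℝ) : MonotoneOn (fun t => bracket P S t i i + 2 * σ * bracket P S t i j
      + σ ^ 2 * bracket P S t j j) (Icc 0 T) := by
  have hcont := hS.continuousOn_coord_Icc T
  -- the discrete brackets, up to additive constants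
  set b : ℕ → ℝ → Fin d → Fin d → ℝ := fun n t i j => S t i * S t j
    - (P n).leftSum (fun u => S u i) (fun u => S u j) t
    - (P n).leftSum (fun u => S u j) (fun u => S u i) t with hb
  have lim : ∀ {x : ℝ} {y : ℕ → ℝ}, x ∈ Icc 0 T → Tendsto y atTop (𝓝[Icc 0 T] x) → ∀ i j,
      Tendsto (fun n => b n (y n) i j) atTop (𝓝 (S x i * S x j - itoIntegral P S x i j
        - itoIntegral P S x j i)) := fun hx hy i j =>
    ((((hcont i _ hx).tendsto.comp hy).mul ((hcont j _ hx).tendsto.comp hy)).sub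
      (hS.tendsto_leftSum_pt hT hx hy i j)).sub (hS.tendsto_leftSum_pt hT hx hy j i)
  have hstep : ∀ n k i j, b n ((P n).pt (k + 1)) i j - b n ((P n).pt k) i j
      = (S ((P n).pt (k + 1)) i - S ((P n).pt k) i) * (S ((P n).pt (k + 1)) j - S ((P n).pt k) j) :=
    fun n k i j => by
      simp only [hb, (P n).leftSum_pt_succ]
      ring
  have hmono : ∀ n, Monotone fun k => b n ((P n).pt k) i i + 2 * σ * b n ((P n).pt k) i j
      + σ ^ 2 * b n ((P n).pt k) j j := fun n => monotone_nat_of_le_succ fun k => by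
    have h1 := hstep n k i i
    have h2 := hstep n k i j
    have h3 := hstep n k j j
    have h4 := sq_nonneg ((S ((P n).pt (k + 1)) i - S ((P n).pt k) i)
      + σ * (S ((P n).pt (k + 1)) j - S ((P n).pt k) j))
    linear_combination h4 - h1 - 2 * σ * h2 - σ ^ 2 * h3
  intro s hs t ht hst
  obtain ⟨k, hk1, hk2, hk3⟩ := hS.exists_tendsto_pt hs.1 hs.2
  obtain ⟨l, hl1, hl2, hl3⟩ := hS.exists_tendsto_pt ht.1 ht.2
  have hkl : ∀ n, k n ≤ l n := fun n => Nat.lt_succ_iff.mp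
    ((P n).strictMono.lt_iff_lt.mp (((hk1 n).trans hst).trans_lt (hl2 n)))
  have key := le_of_tendsto_of_tendsto'
    (((lim hs hk3 i i).add ((lim hs hk3 i j).const_mul (2 * σ))).add
      ((lim hs hk3 j j).const_mul (σ ^ 2)))
    (((lim ht hl3 i i).add ((lim ht hl3 i j).const_mul (2 * σ))).add
      ((lim ht hl3 j j).const_mul (σ ^ 2))) fun n => hmono n (hkl n)
  simp only [bracket_apply]
  linarith

/-- Polarization: the bracket is a difference of monotone functions. -/
theorem exists_bracket_eq_sub (hS : IsPricePath p P S) {T : ℝ} (hT : 0 < T) (i j : Fin d) :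
    ∃ f g : ℝ → ℝ, MonotoneOn f (Icc 0 T) ∧ MonotoneOn g (Icc 0 T) ∧
      ∀ t, bracket P S t i j = f t - g t := by
  refine ⟨fun t => 1 / 4 * (bracket P S t i i + 2 * 1 * bracket P S t i j
      + 1 ^ 2 * bracket P S t j j), fun t => 1 / 4 * (bracket P S t i i
      + 2 * (-1) * bracket P S t i j + (-1) ^ 2 * bracket P S t j j), fun s hs t ht hst => ?_,
      fun s hs t ht hst => ?_, fun t => by ring⟩
  · exact mul_le_mul_of_nonneg_left (hS.monotoneOn_bracket_quadratic hT i j 1 hs ht hst)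
      (by norm_num)
  · exact mul_le_mul_of_nonneg_left (hS.monotoneOn_bracket_quadratic hT i j (-1) hs ht hst)
      (by norm_num)

theorem varBdd_bracket (hS : IsPricePath p P S) {T : ℝ} (hT : 0 < T) (i j : Fin d) :
    VarBdd T 1 fun s t => bracket P S t i j - bracket P S s i j := by
  obtain ⟨f, g, hf, hg, h⟩ := hS.exists_bracket_eq_sub hT i j
  have mono : ∀ s t, 0 ≤ s → s ≤ t → t ≤ T → f s ≤ f t ∧ g s ≤ g t := fun s t hs hst ht =>
    ⟨hf ⟨hs, hst.trans ht⟩ ⟨hs.trans hst, ht⟩ hst, hg ⟨hs, hst.trans ht⟩ ⟨hs.trans hst, ht⟩ hst⟩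
  refine ⟨fun s t => (f t - f s) + (g t - g s), ⟨fun s t hs hst ht => ?_,
    fun s u t _ _ _ _ => by linarith⟩, 1, zero_le_one, fun s t hs hst ht => ?_⟩
  · linarith [mono s t hs hst ht]
  · beta_reduce
    rw [h, h, Real.rpow_one, one_mul, abs_le]
    constructor <;> linarith [mono s t hs hst ht]

theorem boundedVariationOn_bracket (hS : IsPricePath p P S) {T : ℝ} (hT : 0 < T) (i j : Fin d) :
    BoundedVariationOn (fun t => bracket P S t i j) (Icc 0 T) := by
  obtain ⟨c, hc, C, hC, h⟩ := hS.varBdd_bracket hT i j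
  refine ne_top_of_le_ne_top (ENNReal.ofReal_ne_top (r := C * c 0 T)) (iSup_le ?_)
  rintro ⟨N, u, hu, hmem⟩
  calc _ ≤ ∑ k ∈ Finset.range N, ENNReal.ofReal (C * c (u k) (u (k + 1))) := by
        refine Finset.sum_le_sum fun k _ => ?_
        rw [edist_dist, Real.dist_eq]
        have := h _ _ (hmem k).1 (hu (Nat.le_succ k)) (hmem (k + 1)).2
        rw [Real.rpow_one] at this
        exact ENNReal.ofReal_le_ofReal this
    _ = ENNReal.ofReal (∑ k ∈ Finset.range N, C * c (u k) (u (k + 1))) :=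
        (ENNReal.ofReal_sum_of_nonneg fun k _ => mul_nonneg hC
          (hc.nonneg (hmem k).1 (hu (Nat.le_succ k)) (hmem (k + 1)).2)).symm
    _ ≤ ENNReal.ofReal (C * c 0 T) := by
        refine ENNReal.ofReal_le_ofReal ?_
        rw [← Finset.mul_sum]
        exact mul_le_mul_of_nonneg_left ((hc.sum_le hu (hmem 0).1 N (hmem N).2).trans
          (hc.mono le_rfl (hmem 0).1 (hu (Nat.zero_le N)) (hmem N).2 le_rfl)) hC

theorem continuousOn_bracket (hS : IsPricePath p P S) {T : ℝ} (hT : 0 < T) (i j : Fin d) :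
    ContinuousOn (fun t => bracket P S t i j) (Icc 0 T) := by
  have hc := hS.continuousOn_coord_Icc T
  simp only [bracket_apply]
  exact ((((hc i).mul (hc j)).sub (hS.continuousOn_itoIntegral hT i j)).sub
    (hS.continuousOn_itoIntegral hT j i)).sub continuousOn_const

end IsPricePath

/-! ### Riemann–Stieltjes integrals -/

theorem IsSewing.unique {T : ℝ} {Ξ : ℝ → ℝ → ℝ} {I J : ℝ → ℝ} (hI : IsSewing T Ξ I)
    (hJ : IsSewing T Ξ J) {t : ℝ} (h0 : 0 ≤ t) (ht : t ≤ T) : I t - I 0 = J t - J 0 :=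
  have := meshFilter_neBot h0
  tendsto_nhds_unique (hI.tendsto ht) (hJ.tendsto ht)

theorem Partition.N_eq_zero (D : Partition 0) : D.N = 0 := by
  by_contra h
  have h1 := D.pt_lt 0 (Nat.pos_of_ne_zero h)
  have h2 := D.monotone_stopped (Nat.one_le_iff_ne_zero.mpr h)
  simp only [Nat.one_le_iff_ne_zero.mpr h, min_eq_left, min_self, D.pt_last] at h2
  rw [D.pt_zero] at h1
  exact absurd (h1.trans_le h2) (lt_irrefl _)

theorem Partition.germSum_zero (D : Partition 0) (Ξ : ℝ → ℝ → ℝ) : D.germSum Ξ = 0 := by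
  simp [germSum, D.N_eq_zero]

theorem stieltjesIntegral_zero (f g : ℝ → ℝ) : stieltjesIntegral f g 0 = 0 := by
  have := meshFilter_neBot (le_refl (0 : ℝ))
  exact Tendsto.limUnder_eq (tendsto_const_nhds.congr fun D =>
    (D.germSum_zero fun s t => f s * (g t - g s)).symm)

theorem sewable_stieltjes {T : ℝ} {f g : ℝ → ℝ} (hf : ContinuousOn f (Icc 0 T))
    (hg : VarBdd T 1 fun s t => g t - g s) : Sewable T fun s t => f s * (g t - g s) := by
  obtain ⟨c, hc, C, hC, hg⟩ := hg
  refine ⟨_, hc.const_mul hC, fun ε hε => ?_⟩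
  obtain ⟨δ, hδ, hf⟩ := smallDiag_of_continuousOn hf ε hε
  refine ⟨δ, hδ, fun u N hu h0 hN hd => ?_⟩
  have hu0 : ∀ k, 0 ≤ u k := fun k => h0.trans (hu (Nat.zero_le k))
  beta_reduce
  rw [← Finset.sum_range_sub (fun k => g (u k)), Finset.mul_sum, ← Finset.sum_sub_distrib]
  refine (Finset.abs_sum_le_sum_abs _ _).trans ?_
  refine le_trans (Finset.sum_le_sum (g := fun k => ε * (C * c (u k) (u (k + 1)))) fun k hk => ?_)
    ?_
  · have hk := Finset.mem_range.mp hk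
    have huk : u (k + 1) ≤ T := (hu (Nat.succ_le_of_lt hk)).trans hN
    have h1 := hf (u 0) (u k) h0 (hu (Nat.zero_le k)) ((hu (Nat.le_succ k)).trans huk)
      (by linarith [hu hk.le])
    have h2 := hg _ _ (hu0 k) (hu (Nat.le_succ k)) huk
    rw [Real.rpow_one] at h2
    rw [← sub_mul, abs_mul]
    exact mul_le_mul h1 h2 (abs_nonneg _) hε.le
  · rw [← Finset.mul_sum]
    exact mul_le_mul_of_nonneg_left ((hc.const_mul hC).sum_le hu h0 N hN) hε.le

/-- A local bound on increments by a control is a global one. -/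
theorem abs_sub_le_of_local {T δ : ℝ} (hδ : 0 < δ) {J : ℝ → ℝ} {c : ℝ → ℝ → ℝ}
    (hc : IsControl T c)
    (h : ∀ s t, 0 ≤ s → s ≤ t → t ≤ T → t - s ≤ δ → |J t - J s| ≤ c s t) {s t : ℝ} (hs : 0 ≤ s)
    (hst : s ≤ t) (ht : t ≤ T) : |J t - J s| ≤ c s t := by
  have key : ∀ n : ℕ, ∀ t, s ≤ t → t ≤ T → t - s ≤ n * δ → |J t - J s| ≤ c s t := fun n => by
    induction n with
    | zero =>
      intro t hst ht hd
      have : t = s := le_antisymm (by simpa using hd) hst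
      rw [this, sub_self, abs_zero]
      exact hc.nonneg hs le_rfl (hst.trans ht)
    | succ n ih =>
      intro t hst ht hd
      push_cast at hd
      have hm1 : s ≤ max s (t - δ) := le_max_left _ _
      have hm2 : max s (t - δ) ≤ t := max_le hst (by linarith)
      have h1 := ih (max s (t - δ)) hm1 (hm2.trans ht) (by
        rw [sub_le_iff_le_add]
        exact max_le (by have : 0 ≤ n * δ := by positivity
                         linarith) (by linarith))
      have h2 := h (max s (t - δ)) t (hs.trans hm1) hm2 ht (by linarith [le_max_right s (t - δ)])
      have h3 := hc.2 s _ t hs hm1 hm2 ht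
      have h4 := abs_add_le (J (max s (t - δ)) - J s) (J t - J (max s (t - δ)))
      rw [sub_add_sub_cancel'] at h4
      linarith
  obtain ⟨n, hn⟩ := exists_nat_ge ((t - s) / δ)
  exact key n t hst ht ((div_le_iff₀ hδ).mp hn)

/-- Continuous integrands are Riemann–Stieltjes integrable against integrators of finite
variation. -/
theorem isSewing_stieltjesIntegral {T : ℝ} {f g : ℝ → ℝ} (hf : ContinuousOn f (Icc 0 T))
    (hg : VarBdd T 1 fun s t => g t - g s) :
    IsSewing T (fun s t => f s * (g t - g s)) (stieltjesIntegral f g) := by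
  obtain ⟨I, hI0, hI⟩ := (sewable_stieltjes hf hg).exists_isSewing
  refine hI.congr_path fun t h0 ht => ?_
  have := meshFilter_neBot h0
  have := hI.tendsto ht
  rw [hI0, sub_zero] at this
  exact this.limUnder_eq

theorem stieltjesIntegrable {T : ℝ} {f g : ℝ → ℝ} (hf : ContinuousOn f (Icc 0 T))
    (hg : VarBdd T 1 fun s t => g t - g s) {t : ℝ} (ht : t ≤ T) : StieltjesIntegrable f g t :=
  ⟨_, (isSewing_stieltjesIntegral hf hg).tendsto ht⟩

theorem varBdd_stieltjesIntegral {T : ℝ} {f g : ℝ → ℝ} (hf : ContinuousOn f (Icc 0 T))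
    (hg : VarBdd T 1 fun s t => g t - g s) :
    VarBdd T 1 fun s t => stieltjesIntegral f g t - stieltjesIntegral f g s := by
  obtain ⟨c, hc, h⟩ := isSewing_stieltjesIntegral hf hg
  obtain ⟨c', hc', C, hC, hg⟩ := hg
  obtain ⟨M, hM, hf⟩ := exists_abs_le_of_continuousOn hf
  obtain ⟨δ, hδ, h⟩ := h 1 one_pos
  have hcc := hc.add (hc'.const_mul (mul_nonneg hM hC))
  refine ⟨_, hcc, 1, zero_le_one, fun s t hs hst ht => ?_⟩
  rw [Real.rpow_one, one_mul]
  refine abs_sub_le_of_local hδ hcc (fun s t hs hst ht hd => ?_) hs hst ht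
  have h1 := h s t hs hst ht hd
  have h2 := hg s t hs hst ht
  rw [Real.rpow_one] at h2
  have h3 : |f s * (g t - g s)| ≤ M * (C * c' s t) := by
    rw [abs_mul]
    exact mul_le_mul (hf s hs (hst.trans ht)) h2 (abs_nonneg _) hM
  have h4 := abs_add_le (stieltjesIntegral f g t - stieltjesIntegral f g s - f s * (g t - g s))
    (f s * (g t - g s))
  rw [sub_add_cancel] at h4
  rw [mul_assoc]
  linarith

/-- Associativity of integration: a path may be replaced, as an integrator, by its germ. -/
theorem IsSewing.replace_integrator {T : ℝ} {h : ℝ → ℝ} (hh : ContinuousOn h (Icc 0 T))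
    {Ξ : ℝ → ℝ → ℝ} {J K : ℝ → ℝ} (hJ : IsSewing T Ξ J)
    (hK : IsSewing T (fun s t => h s * (J t - J s)) K) : IsSewing T (fun s t => h s * Ξ s t) K := by
  refine hK.congr_germ ?_
  obtain ⟨M, hM, hh⟩ := exists_abs_le_of_continuousOn hh
  obtain ⟨c, hc, hJ⟩ := hJ
  refine ⟨_, hc.const_mul hM, fun ε hε => ?_⟩
  obtain ⟨δ, hδ, hJ⟩ := hJ ε hε
  refine ⟨δ, hδ, fun s t hs hst ht hd => ?_⟩
  beta_reduce
  rw [Pi.zero_apply, Pi.zero_apply, sub_self, zero_sub, abs_neg, ← mul_sub, abs_mul, abs_sub_comm]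
  refine (mul_le_mul (hh s hs (hst.trans ht)) (hJ s t hs hst ht hd) (abs_nonneg _) hM).trans
    (le_of_eq (by ring))

/-- A germ of order higher than one has a vanishing integral. -/
theorem VarBdd.isSewing_zero {T α : ℝ} {w : ℝ → ℝ → ℝ} (h : VarBdd T α w) (hα : 1 < α)
    (hw : SmallDiag T w) : IsSewing T w 0 := by
  obtain ⟨c, hc, C, hC, h⟩ := h
  have hα0 : 0 < α := by linarith
  have hη : 0 < 1 - 1 / α := by
    rw [sub_pos, div_lt_one hα0]; exact hα
  have hK : 0 ≤ C ^ (1 / α) := Real.rpow_nonneg hC _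
  refine ⟨_, hc.const_mul hK, fun ε hε => ?_⟩
  obtain ⟨δ, hδ, hw⟩ := hw (ε ^ (1 / (1 - 1 / α))) (by positivity)
  refine ⟨δ, hδ, fun s t hs hst ht hd => ?_⟩
  have h0 := hc.nonneg hs hst ht
  have h1 := Real.rpow_le_rpow (abs_nonneg _) (hw s t hs hst ht hd) hη.le
  have h2 := Real.rpow_le_rpow (abs_nonneg _) (h s t hs hst ht) (one_div_pos.mpr hα0).le
  rw [← Real.rpow_mul hε.le, one_div_mul_cancel hη.ne', Real.rpow_one] at h1
  rw [Real.mul_rpow hC (Real.rpow_nonneg h0 _), ← Real.rpow_mul h0, mul_one_div_cancel hα0.ne',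
    Real.rpow_one] at h2
  have h3 : |w s t| = |w s t| ^ (1 - 1 / α) * |w s t| ^ (1 / α) := by
    rw [← Real.rpow_add_of_nonneg (abs_nonneg _) hη.le (one_div_pos.mpr hα0).le, sub_add_cancel,
      Real.rpow_one]
  rw [Pi.zero_apply, Pi.zero_apply, sub_self, zero_sub, abs_neg, h3]
  exact mul_le_mul h1 h2 (by positivity) hε.le

/-- Along the given partitions, integrals against the bracket are limits of sums of squared
increments. -/
theorem IsPricePath.tendsto_germSum_sq (hS : IsPricePath p P S) (he : Exponents p q r)
    {T : ℝ} (hT : 0 < T) {f : ℝ → ℝ} (hf : ContinuousOn f (Icc 0 T))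
    (hf' : VarBdd T (1 / q) fun s t => f t - f s) (i j : Fin d) {t : ℝ} (ht : t ∈ Icc 0 T) :
    Tendsto (fun n => (P n).germSum (fun u v => f u * ((S v i - S u i) * (S v j - S u j))) t)
      atTop (𝓝 (stieltjesIntegral f (fun s => bracket P S s i j) t)) := by
  have h1 := ((isSewing_stieltjesIntegral hf (hS.varBdd_bracket hT i j)).tendstoUniformlyOn hT.le
    hS.meshToZero).tendsto_at ht
  rw [stieltjesIntegral_zero, sub_zero] at h1
  have h2 := (hS.tendstoUniformlyOn_germSum_secondLevel he hT hf hf' i j).tendsto_at ht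
  have h3 := (hS.tendstoUniformlyOn_germSum_secondLevel he hT hf hf' j i).tendsto_at ht
  have h4 := (h1.add h2).add h3
  simp only [add_zero] at h4
  refine h4.congr fun n => ?_
  rw [← HalfLinePartition.germSum_add, ← HalfLinePartition.germSum_add]
  refine Finset.sum_congr rfl fun k _ => ?_
  beta_reduce
  rw [bracket_sub_bracket]
  ring

end PathwisePortfolio

namespace PathwisePortfolio

variable {d : ℕ} {p q r : ℝ} {P : ℕ → HalfLinePartition} {S : ℝ → EuclideanSpace ℝ (Fin d)}

/-! ### Rough integrals -/

theorem compensatedSum_eq_germSum (X : ℝ → ℝ → Matrix (Fin d) (Fin d) ℝ)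
    (F : ℝ → EuclideanSpace ℝ (Fin d)) (F' : ℝ → Matrix (Fin d) (Fin d) ℝ)
    (G : ℝ → EuclideanSpace ℝ (Fin d)) (G' : ℝ → Matrix (Fin d) (Fin d) ℝ) {T : ℝ}
    (D : Partition T) : compensatedSum X F F' G G' D = D.germSum fun s t =>
      ∑ i, (F s i * (G t i - G s i) + ∑ a, ∑ b, F' s i a * G' s i b * X s t a b) :=
  Finset.sum_congr rfl fun _ _ => Finset.sum_add_distrib.symm

theorem IsControlled.restrict {T T' : ℝ} {F : ℝ → EuclideanSpace ℝ (Fin d)}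
    {F' : ℝ → Matrix (Fin d) (Fin d) ℝ} (he : Exponents p q r) (h : IsControlled q r T S F F')
    (hT : T' ≤ T) : IsControlled q r T' S F F' :=
  (isControlled_iff he).mpr fun i => ((isControlled_iff he).mp h i).restrict hT

namespace IsPricePath

theorem isControlled_self (hS : IsPricePath p P S) (he : Exponents p q r) (T : ℝ) :
    IsControlled q r T S S fun _ => 1 :=
  (isControlled_iff he).mpr fun i => by
    convert IsScalarControlled.coord (hS.continuousOn_coord_Icc T) i using 3
    simp [Matrix.one_apply, Pi.single_apply, eq_comm]

theorem exists_hasRoughIntegral (hS : IsPricePath p P S) (he : Exponents p q r) {T : ℝ}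
    (hT : 0 < T) {F G : ℝ → EuclideanSpace ℝ (Fin d)} {F' G' : ℝ → Matrix (Fin d) (Fin d) ℝ}
    (hF : IsControlled q r T S F F') (hG : IsControlled q r T S G G') :
    ∃ I : ℝ → ℝ, (∀ t ∈ Icc 0 T, HasRoughIntegral (secondLevel P S) F F' G G' t (I t)) ∧
      TendstoUniformlyOn (fun n t => ∑ i, (P n).leftSum (fun s => F s i) (fun s => G s i) t) I
        atTop (Icc 0 T) := by
  have hX := hS.isRoughPath (by linarith [he.two_lt]) hT
  have hF := (isControlled_iff he).mp hF
  have hG := (isControlled_iff he).mp hG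
  choose I hI0 hI using fun i => ((hF i).sewable_germ he hX (hG i)).exists_isSewing
  refine ⟨fun t => ∑ i, I i t, fun t ht => ?_, ?_⟩
  · have := (IsSewing.sum Finset.univ fun i _ => hI i).tendsto ht.2
    simp only [hI0, Finset.sum_const_zero, sub_zero] at this
    unfold HasRoughIntegral
    exact this.congr fun D => (compensatedSum_eq_germSum _ _ _ _ _ D).symm
  · refine (tendstoUniformlyOn_sum Finset.univ fun i _ =>
      hS.tendstoUniformlyOn_leftSum_of_isSewing he hT (hF i) (hG i) (hI i)).congr_right
        fun t _ => ?_
    simp only [hI0, sub_zero]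

/-- A rough integral is the limit of left-point Riemann sums along the given partitions. As these
do not involve the Gubinelli derivatives, the integral does not depend on them. -/
theorem tendsto_leftSum_of_hasRoughIntegral (hS : IsPricePath p P S) (he : Exponents p q r)
    {t : ℝ} (ht : 0 ≤ t) {F G : ℝ → EuclideanSpace ℝ (Fin d)}
    {F' G' : ℝ → Matrix (Fin d) (Fin d) ℝ} (hF : IsControlled q r t S F F')
    (hG : IsControlled q r t S G G') {L : ℝ}
    (hL : HasRoughIntegral (secondLevel P S) F F' G G' t L) :
    Tendsto (fun n => ∑ i, (P n).leftSum (fun s => F s i) (fun s => G s i) t) atTop (𝓝 L) := by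
  have := meshFilter_neBot ht
  rcases eq_or_lt_of_le ht with rfl | ht'
  · have h0 : L = 0 := tendsto_nhds_unique hL (tendsto_const_nhds.congr fun D => by
      rw [compensatedSum_eq_germSum, D.germSum_zero])
    rw [h0]
    refine tendsto_const_nhds.congr fun n => (Finset.sum_eq_zero fun i _ => ?_).symm
    rw [HalfLinePartition.leftSum_eq_germSum, HalfLinePartition.germSum_eq_restrict _ _ le_rfl,
      Partition.germSum_zero]
  · obtain ⟨I, hI, hI'⟩ := hS.exists_hasRoughIntegral he ht' hF hG
    rw [tendsto_nhds_unique hL (hI t ⟨ht, le_rfl⟩)]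
    exact hI'.tendsto_at ⟨ht, le_rfl⟩

/-- The integral picked by `controlledIntegral` is the one for every choice of the derivatives, and
the uniform limit of left-point Riemann sums. -/
theorem controlledIntegral_spec (hS : IsPricePath p P S) (he : Exponents p q r) {T : ℝ}
    (hT : 0 < T) {F G : ℝ → EuclideanSpace ℝ (Fin d)} {F' G' : ℝ → Matrix (Fin d) (Fin d) ℝ}
    (hF : IsControlled q r T S F F') (hG : IsControlled q r T S G G') :
    (∀ t ∈ Icc 0 T, HasRoughIntegral (secondLevel P S) F F' G G' t
      (controlledIntegral q r P S F G t)) ∧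
    TendstoUniformlyOn (fun n t => ∑ i, (P n).leftSum (fun s => F s i) (fun s => G s i) t)
      (controlledIntegral q r P S F G) atTop (Icc 0 T) := by
  obtain ⟨I, hI, hI'⟩ := hS.exists_hasRoughIntegral he hT hF hG
  have key : EqOn I (controlledIntegral q r P S F G) (Icc 0 T) := fun t ht => by
    obtain ⟨F'', G'', hF'', hG'', h⟩ := Classical.epsilon_spec (p := fun L : ℝ =>
      ∃ F' G' : ℝ → Matrix (Fin d) (Fin d) ℝ,
        IsControlled q r t S F F' ∧ IsControlled q r t S G G' ∧
          HasRoughIntegral (secondLevel P S) F F' G G' t L)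
      ⟨I t, F', G', hF.restrict he ht.2, hG.restrict he ht.2, hI t ht⟩
    exact tendsto_nhds_unique (hI'.tendsto_at ht)
      (hS.tendsto_leftSum_of_hasRoughIntegral he ht.1 hF'' hG'' h)
  exact ⟨fun t ht => key ht ▸ hI t ht, hI'.congr_right key⟩

theorem roughIntegral_spec (hS : IsPricePath p P S) (he : Exponents p q r) {T : ℝ}
    (hT : 0 < T) {F : ℝ → EuclideanSpace ℝ (Fin d)} {F' : ℝ → Matrix (Fin d) (Fin d) ℝ}
    (hF : IsControlled q r T S F F') :
    (∀ t ∈ Icc 0 T, HasRoughIntegral (secondLevel P S) F F' S (fun _ => 1) t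
      (roughIntegral q r P S F t)) ∧
    TendstoUniformlyOn (fun n t => ∑ i, (P n).leftSum (fun s => F s i) (fun s => S s i) t)
      (roughIntegral q r P S F) atTop (Icc 0 T) := by
  obtain ⟨I, hI, hI'⟩ := hS.exists_hasRoughIntegral he hT hF (hS.isControlled_self he T)
  have key : EqOn I (roughIntegral q r P S F) (Icc 0 T) := fun t ht => by
    obtain ⟨F'', hF'', h⟩ := Classical.epsilon_spec (p := fun L : ℝ =>
      ∃ F' : ℝ → Matrix (Fin d) (Fin d) ℝ, IsControlled q r t S F F' ∧
        HasRoughIntegral (secondLevel P S) F F' S (fun _ => 1) t L)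
      ⟨I t, F', hF.restrict he ht.2, hI t ht⟩
    exact tendsto_nhds_unique (hI'.tendsto_at ht)
      (hS.tendsto_leftSum_of_hasRoughIntegral he ht.1 hF'' (hS.isControlled_self he t) h)
  exact ⟨fun t ht => key ht ▸ hI t ht, hI'.congr_right key⟩

end IsPricePath

/-! ### Gubinelli derivatives of products and quotients -/

/-- `f` is controlled by `S` on `[0, T]` with some Gubinelli derivative. -/
def HasGubinelliDeriv (q r T : ℝ) (S : ℝ → EuclideanSpace ℝ (Fin d)) (f : ℝ → ℝ) : Prop :=
  ∃ f', IsScalarControlled q r T S f f'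

namespace HasGubinelliDeriv

variable {T : ℝ} {X : ℝ → ℝ → Matrix (Fin d) (Fin d) ℝ} {f g : ℝ → ℝ}

theorem continuousOn (h : HasGubinelliDeriv q r T S f) : ContinuousOn f (Icc 0 T) := by
  obtain ⟨f', h⟩ := h
  exact h.continuousOn

theorem varBdd (he : Exponents p q r) (hS : IsRoughPath p T S X)
    (h : HasGubinelliDeriv q r T S f) : VarBdd T (1 / p) fun s t => f t - f s := by
  obtain ⟨f', h⟩ := h
  exact h.varBdd he hS

theorem varBdd_q (he : Exponents p q r) (hS : IsRoughPath p T S X)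
    (h : HasGubinelliDeriv q r T S f) : VarBdd T (1 / q) fun s t => f t - f s := by
  obtain ⟨f', h⟩ := h
  exact h.varBdd_q he hS

theorem mul (he : Exponents p q r) (hS : IsRoughPath p T S X) (hf : HasGubinelliDeriv q r T S f)
    (hg : HasGubinelliDeriv q r T S g) : HasGubinelliDeriv q r T S fun t => f t * g t := by
  obtain ⟨f', hf⟩ := hf
  obtain ⟨g', hg⟩ := hg
  exact ⟨_, hf.mul he hS hg⟩

theorem inv (he : Exponents p q r) (hS : IsRoughPath p T S X) (hf : HasGubinelliDeriv q r T S f)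
    (h0 : ∀ t, 0 ≤ t → t ≤ T → f t ≠ 0) : HasGubinelliDeriv q r T S fun t => (f t)⁻¹ := by
  obtain ⟨f', hf⟩ := hf
  exact ⟨_, hf.inv he hS h0⟩

theorem div (he : Exponents p q r) (hS : IsRoughPath p T S X) (hf : HasGubinelliDeriv q r T S f)
    (hg : HasGubinelliDeriv q r T S g) (h0 : ∀ t, 0 ≤ t → t ≤ T → g t ≠ 0) :
    HasGubinelliDeriv q r T S fun t => f t / g t := by
  simpa only [div_eq_mul_inv] using hf.mul he hS (hg.inv he hS h0)

theorem sum (he : Exponents p q r) {ι : Type*} (s : Finset ι) {f : ι → ℝ → ℝ}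
    (h : ∀ i, HasGubinelliDeriv q r T S (f i)) :
    HasGubinelliDeriv q r T S fun t => ∑ i ∈ s, f i t := by
  choose f' h using h
  exact ⟨_, IsScalarControlled.sum he s fun i _ => h i⟩

theorem sub_const (he : Exponents p q r) (h : HasGubinelliDeriv q r T S f) (x : ℝ) :
    HasGubinelliDeriv q r T S fun t => f t - x := by
  obtain ⟨f', h⟩ := h
  simpa only [sub_eq_add_neg] using ⟨_, h.add he (IsScalarControlled.const (-x))⟩

end HasGubinelliDeriv

theorem isAdmissible_iff (he : Exponents p q r) {F : ℝ → EuclideanSpace ℝ (Fin d)} :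
    IsAdmissible q r S F ↔ ∀ T, 0 < T → ∀ i, HasGubinelliDeriv q r T S fun t => F t i := by
  refine forall_congr' fun T => forall_congr' fun _ => ⟨?_, fun h => ?_⟩
  · rintro ⟨F', h⟩ i
    exact ⟨_, (isControlled_iff he).mp h i⟩
  · choose f' h using h
    exact ⟨fun t => Matrix.of fun i a => f' i t a, (isControlled_iff he).mpr h⟩

/-! ### Change of numeraire -/

/-- The identity behind the formula for the relative wealth: over a single interval, the
logarithmic returns up to second order, measured in the old numeraire and in units of the total
capitalization `M`, differ by a term of third order. Here `x`, `x'` are the prices at the ends of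
the interval, `w` the portfolio, `y` its return, and `m` the return of the market. -/
theorem change_of_numeraire_identity {w x x' : Fin d → ℝ} (hw : ∑ i, w i = 1)
    (hx : ∀ i, 0 < x i) (hx' : ∀ i, 0 < x' i) {M M' y m : ℝ} (hM : M = ∑ i, x i)
    (hM' : M' = ∑ i, x' i) (hy : y = ∑ i, w i / x i * (x' i - x i)) (hm : m = (M' - M) / M) :
    ∑ i, w i / x i * (x' i - x i)
      - 1 / 2 * ∑ i, ∑ j, w i * w j / (x i * x j) * ((x' i - x i) * (x' j - x j))
      - (∑ i, x i / M / x i * (x' i - x i)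
        - 1 / 2 * ∑ i, ∑ j, x i / M * (x j / M) / (x i * x j) * ((x' i - x i) * (x' j - x j)))
      - (∑ i, w i / (x i / M) * (x' i / M' - x i / M)
        - 1 / 2 * ∑ i, ∑ j, ∑ k, ∑ l, w i * w j * ((x k / M - if k = i then 1 else 0)
          * (x l / M - if l = j then 1 else 0) * (1 / (x k * x l)))
          * ((x' k - x k) * (x' l - x l)))
    = -((y - m) * (m * (m * (M / M')))) := by
  have hne : (Finset.univ : Finset (Fin d)).Nonempty := by
    by_contra h
    rw [Finset.not_nonempty_iff_eq_empty.mp h] at hw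
    simp at hw
  have hMpos : 0 < M := hM ▸ Finset.sum_pos (fun i _ => hx i) hne
  have hMpos' : 0 < M' := hM' ▸ Finset.sum_pos (fun i _ => hx' i) hne
  have hx0 := fun i => (hx i).ne'
  have hsum : ∑ i, (x' i - x i) = M' - M := by rw [Finset.sum_sub_distrib, ← hM, ← hM']
  have e2 : ∑ i, x i / M / x i * (x' i - x i) = m := by
    rw [hm, ← hsum, Finset.sum_div]
    refine Finset.sum_congr rfl fun i _ => ?_
    have := hx0 i
    field_simp
  have e3 : ∑ i, w i / (x i / M) * (x' i / M' - x i / M) = y * (M / M') + M / M' - 1 := by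
    have : ∀ i, w i / (x i / M) * (x' i / M' - x i / M)
        = w i / x i * (x' i - x i) * (M / M') + w i * (M / M') - w i := fun i => by
      have := hx0 i
      field_simp
      ring
    rw [Finset.sum_congr rfl fun i _ => this i, Finset.sum_sub_distrib, Finset.sum_add_distrib,
      ← Finset.sum_mul, ← Finset.sum_mul, hw, ← hy, one_mul]
  have e4 : ∑ i, ∑ j, w i * w j / (x i * x j) * ((x' i - x i) * (x' j - x j)) = y * y := by
    rw [hy, Finset.sum_mul_sum]
    refine Finset.sum_congr rfl fun i _ => Finset.sum_congr rfl fun j _ => ?_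
    have := hx0 i
    have := hx0 j
    field_simp
  have e5 : ∑ i, ∑ j, x i / M * (x j / M) / (x i * x j) * ((x' i - x i) * (x' j - x j))
      = m * m := by
    rw [← e2, Finset.sum_mul_sum]
    refine Finset.sum_congr rfl fun i _ => Finset.sum_congr rfl fun j _ => ?_
    have := hx0 i
    have := hx0 j
    field_simp
  have e6 : ∀ i, ∑ k, (x k / M - if k = i then 1 else 0) / x k * (x' k - x k)
      = m - (x' i - x i) / x i := fun i => by
    simp only [sub_div, sub_mul, Finset.sum_sub_distrib, e2]
    congr 1
    rw [Finset.sum_eq_single i (fun k _ hk => by simp [hk]) (by simp)]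
    simp only [if_true]
    ring
  have e7 : ∑ i, ∑ j, ∑ k, ∑ l, w i * w j * ((x k / M - if k = i then 1 else 0)
          * (x l / M - if l = j then 1 else 0) * (1 / (x k * x l)))
          * ((x' k - x k) * (x' l - x l)) = (m - y) * (m - y) := by
    have hmy : m - y = ∑ i, w i * (m - (x' i - x i) / x i) := by
      simp only [mul_sub, Finset.sum_sub_distrib, ← Finset.sum_mul, hw, one_mul]
      rw [hy]
      congr 1
      refine Finset.sum_congr rfl fun i _ => ?_
      ring
    rw [hmy, Finset.sum_mul_sum]
    refine Finset.sum_congr rfl fun i _ => Finset.sum_congr rfl fun j _ => ?_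
    rw [← e6 i, ← e6 j, mul_mul_mul_comm, Finset.sum_mul_sum, Finset.mul_sum]
    refine Finset.sum_congr rfl fun k _ => ?_
    rw [Finset.mul_sum]
    refine Finset.sum_congr rfl fun l _ => ?_
    have := hx0 k
    have := hx0 l
    field_simp
  rw [e2, e3, e4, e5, e7, ← hy, hm]
  field_simp
  ring

end PathwisePortfolio

namespace PathwisePortfolio

variable {d : ℕ} {p q r : ℝ} {P : ℕ → HalfLinePartition} {S π : ℝ → EuclideanSpace ℝ (Fin d)}

/-! ### The relative wealth -/

namespace HalfLinePartition

variable (Q : HalfLinePartition)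

theorem germSum_sub (Ξ Ξ' : ℝ → ℝ → ℝ) (t : ℝ) :
    Q.germSum (fun u v => Ξ u v - Ξ' u v) t = Q.germSum Ξ t - Q.germSum Ξ' t :=
  Finset.sum_sub_distrib _ _

theorem germSum_const_mul (x : ℝ) (Ξ : ℝ → ℝ → ℝ) (t : ℝ) :
    Q.germSum (fun u v => x * Ξ u v) t = x * Q.germSum Ξ t :=
  (Finset.mul_sum _ _ _).symm

theorem germSum_congr {Ξ Ξ' : ℝ → ℝ → ℝ} {t : ℝ} (ht : 0 ≤ t)
    (h : ∀ u v, 0 ≤ u → 0 ≤ v → Ξ u v = Ξ' u v) : Q.germSum Ξ t = Q.germSum Ξ' t :=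
  Finset.sum_congr rfl fun k _ =>
    h _ _ (le_min (Q.pt_nonneg k) ht) (le_min (Q.pt_nonneg (k + 1)) ht)

end HalfLinePartition

theorem IsPortfolio.nonempty (hπ : IsPortfolio q r S π) : Nonempty (Fin d) := by
  by_contra h
  rw [not_nonempty_iff] at h
  have := hπ.2 0 le_rfl
  simp at this

theorem market_apply (t : ℝ) (i : Fin d) : market S t i = S t i / ∑ j, S t j := rfl

namespace IsPricePath

theorem sum_pos (hS : IsPricePath p P S) [Nonempty (Fin d)] {t : ℝ} (ht : 0 ≤ t) :
    0 < ∑ j, S t j :=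
  Finset.sum_pos (fun i _ => hS.pos t ht i) Finset.univ_nonempty

section Regularity

variable {T : ℝ}

theorem hasGubinelliDeriv_coord (hS : IsPricePath p P S) (i : Fin d) :
    HasGubinelliDeriv q r T S fun t => S t i :=
  ⟨_, IsScalarControlled.coord (hS.continuousOn_coord_Icc T) i⟩

theorem hasGubinelliDeriv_sum (hS : IsPricePath p P S) (he : Exponents p q r) :
    HasGubinelliDeriv q r T S fun t => ∑ j, S t j :=
  HasGubinelliDeriv.sum he _ fun i => hS.hasGubinelliDeriv_coord i

theorem hasGubinelliDeriv_market (hS : IsPricePath p P S) [Nonempty (Fin d)]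
    (he : Exponents p q r) (hT : 0 < T) (i : Fin d) :
    HasGubinelliDeriv q r T S fun t => market S t i :=
  (hS.hasGubinelliDeriv_coord i).div he (hS.isRoughPath (by linarith [he.two_lt]) hT)
    (hS.hasGubinelliDeriv_sum he) fun _ ht _ => (hS.sum_pos ht).ne'

theorem hasGubinelliDeriv_quot_self (hS : IsPricePath p P S) (he : Exponents p q r) (hT : 0 < T)
    {F : ℝ → EuclideanSpace ℝ (Fin d)} {i : Fin d} (hF : HasGubinelliDeriv q r T S fun t => F t i) :
    HasGubinelliDeriv q r T S fun t => quot F S t i :=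
  hF.div he (hS.isRoughPath (by linarith [he.two_lt]) hT) (hS.hasGubinelliDeriv_coord i)
    fun t ht _ => (hS.pos t ht i).ne'

theorem hasGubinelliDeriv_quot_market (hS : IsPricePath p P S) [Nonempty (Fin d)]
    (he : Exponents p q r) (hT : 0 < T) {F : ℝ → EuclideanSpace ℝ (Fin d)} {i : Fin d}
    (hF : HasGubinelliDeriv q r T S fun t => F t i) :
    HasGubinelliDeriv q r T S fun t => quot F (market S) t i :=
  hF.div he (hS.isRoughPath (by linarith [he.two_lt]) hT) (hS.hasGubinelliDeriv_market he hT i)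
    fun t ht _ => (div_pos (hS.pos t ht i) (hS.sum_pos ht)).ne'

theorem hasGubinelliDeriv_inv_mul (hS : IsPricePath p P S) (he : Exponents p q r) (hT : 0 < T)
    {f : ℝ → ℝ} (hf : HasGubinelliDeriv q r T S f) (i j : Fin d) :
    HasGubinelliDeriv q r T S fun t => f t / (S t i * S t j) :=
  have hX := hS.isRoughPath (by linarith [he.two_lt]) hT
  hf.div he hX ((hS.hasGubinelliDeriv_coord i).mul he hX (hS.hasGubinelliDeriv_coord j))
    fun t ht _ => (mul_pos (hS.pos t ht i) (hS.pos t ht j)).ne'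

theorem hasGubinelliDeriv_inv (hS : IsPricePath p P S) (he : Exponents p q r) (hT : 0 < T)
    (i j : Fin d) : HasGubinelliDeriv q r T S fun t => 1 / (S t i * S t j) :=
  hS.hasGubinelliDeriv_inv_mul he hT ⟨_, IsScalarControlled.const 1⟩ i j

theorem hasGubinelliDeriv_excess (hS : IsPricePath p P S) [Nonempty (Fin d)]
    (he : Exponents p q r) (hT : 0 < T) (i j k l : Fin d) :
    HasGubinelliDeriv q r T S fun t => excess (market S) i k t * excess (market S) j l t :=
  ((hS.hasGubinelliDeriv_market he hT k).sub_const he _).mul he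
    (hS.isRoughPath (by linarith [he.two_lt]) hT)
    ((hS.hasGubinelliDeriv_market he hT l).sub_const he _)

theorem varBdd_covariance (hS : IsPricePath p P S) (he : Exponents p q r) (hT : 0 < T)
    (k l : Fin d) : VarBdd T 1 fun s t => covariance P S k l t - covariance P S k l s :=
  varBdd_stieltjesIntegral (hS.hasGubinelliDeriv_inv (q := q) (r := r) he hT k l).continuousOn
    (hS.varBdd_bracket hT k l)

theorem varBdd_relativeCovariance (hS : IsPricePath p P S) [Nonempty (Fin d)]
    (he : Exponents p q r) (hT : 0 < T) (i j : Fin d) :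
    VarBdd T 1 fun s t => relativeCovariance P S (market S) i j t
      - relativeCovariance P S (market S) i j s := by
  refine (VarBdd.sum zero_le_one Finset.univ fun k _ => VarBdd.sum zero_le_one Finset.univ
    fun l _ => varBdd_stieltjesIntegral (hS.hasGubinelliDeriv_excess he hT i j k l).continuousOn
      (hS.varBdd_covariance he hT k l)).congr fun s t _ _ _ => ?_
  simp only [relativeCovariance, Finset.sum_sub_distrib]

/-- Integrals against the relative covariance, in terms of the bracket. -/
theorem stieltjesIntegral_relativeCovariance (hS : IsPricePath p P S) [Nonempty (Fin d)]
    (he : Exponents p q r) (hT : 0 < T) {f : ℝ → ℝ} (hf : HasGubinelliDeriv q r T S f)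
    (i j : Fin d) {t : ℝ} (ht : t ∈ Icc 0 T) :
    stieltjesIntegral f (relativeCovariance P S (market S) i j) t =
      ∑ k, ∑ l, stieltjesIntegral (fun s => f s * (excess (market S) i k s *
        excess (market S) j l s * (1 / (S s k * S s l)))) (fun s => bracket P S s k l) t := by
  have hX := hS.isRoughPath (by linarith [he.two_lt]) hT
  have hinv := fun k l => hS.hasGubinelliDeriv_inv (q := q) (r := r) he hT k l
  have hexc := hS.hasGubinelliDeriv_excess he hT i j
  have hcov := fun k l => (isSewing_stieltjesIntegral (hexc k l).continuousOn
    (hS.varBdd_covariance he hT k l))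
  have hcov' := fun k l => IsSewing.replace_integrator (hexc k l).continuousOn
    (isSewing_stieltjesIntegral (hinv k l).continuousOn (hS.varBdd_bracket hT k l)) (hcov k l)
  have hrel := IsSewing.sum Finset.univ fun k _ => IsSewing.sum Finset.univ fun l _ => hcov' k l
  have hK := IsSewing.replace_integrator hf.continuousOn hrel
    (isSewing_stieltjesIntegral hf.continuousOn (hS.varBdd_relativeCovariance he hT i j))
  have hN := IsSewing.sum Finset.univ fun k _ => IsSewing.sum Finset.univ fun l _ =>
    isSewing_stieltjesIntegral (hf.mul he hX ((hexc k l).mul he hX (hinv k l))).continuousOn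
      (hS.varBdd_bracket hT k l)
  have hgerm : (fun s t => f s * ∑ k, ∑ l, excess (market S) i k s * excess (market S) j l s *
      (1 / (S s k * S s l) * (bracket P S t k l - bracket P S s k l))) =
      fun s t => ∑ k, ∑ l, f s * (excess (market S) i k s * excess (market S) j l s *
      (1 / (S s k * S s l))) * (bracket P S t k l - bracket P S s k l) := by
    funext s t
    simp only [Finset.mul_sum]
    refine Finset.sum_congr rfl fun k _ => Finset.sum_congr rfl fun l _ => ?_
    ring
  rw [hgerm] at hK
  have := hK.unique hN ht.1 ht.2
  simp only [stieltjesIntegral_zero, Finset.sum_const_zero, sub_zero] at this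
  exact this

/-- The third-order terms in the change of numeraire do not contribute in the limit. -/
theorem isSewing_third_order (hS : IsPricePath p P S) [Nonempty (Fin d)]
    (he : Exponents p q r) (hT : 0 < T) (hπ : ∀ i, HasGubinelliDeriv q r T S fun t => π t i) :
    IsSewing T (fun s t => (∑ i, π s i / S s i * (S t i - S s i)
      - (∑ i, S t i - ∑ i, S s i) / ∑ i, S s i) * ((∑ i, S t i - ∑ i, S s i) / (∑ i, S s i) *
        ((∑ i, S t i - ∑ i, S s i) / (∑ i, S s i) * ((∑ i, S s i) / ∑ i, S t i)))) 0 := by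
  have hX := hS.isRoughPath (by linarith [he.two_lt]) hT
  have hp := he.one_div_p_pos
  have hM := hS.hasGubinelliDeriv_sum (T := T) he
  have hMi := (hM.inv he hX fun t ht _ => (hS.sum_pos ht).ne').continuousOn
  have hquot := fun i => (hS.hasGubinelliDeriv_quot_self he hT (hπ i)).continuousOn
  have hm : VarBdd T (1 / p) fun s t => (∑ i, S t i - ∑ i, S s i) / ∑ i, S s i :=
    ((hM.varBdd he hX).left_mul hMi).congr fun s t _ _ _ => by rw [div_eq_inv_mul]
  have hm' : SmallDiag T fun s t => (∑ i, S t i - ∑ i, S s i) / ∑ i, S s i := by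
    simpa only [div_eq_inv_mul] using (smallDiag_of_continuousOn hM.continuousOn).left_mul hMi
  have hy : VarBdd T (1 / p) fun s t => ∑ i, π s i / S s i * (S t i - S s i) :=
    VarBdd.sum hp.le _ fun i _ => (hX.varBdd i).left_mul (hquot i)
  have hy' : SmallDiag T fun s t => ∑ i, π s i / S s i * (S t i - S s i) :=
    SmallDiag.sum _ fun i _ => (smallDiag_of_continuousOn (hX.continuousOn i)).left_mul (hquot i)
  have hratio : VarBdd T (1 / p) fun s t =>
      (∑ i, S t i - ∑ i, S s i) / (∑ i, S s i) * ((∑ i, S s i) / ∑ i, S t i) :=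
    ((hM.varBdd he hX).right_mul hMi).congr fun s t hs hst ht => by
      have := (hS.sum_pos hs).ne'
      field_simp
  have hym : VarBdd T (1 / p) fun s t => ∑ i, π s i / S s i * (S t i - S s i)
      - (∑ i, S t i - ∑ i, S s i) / ∑ i, S s i :=
    (hy.add hp.le hm.neg).congr fun s t _ _ _ => by rw [sub_eq_add_neg]
  have h3 := hym.mul hp.le (add_pos hp hp).le (hm.mul hp.le hp.le hratio)
  refine h3.isSewing_zero ?_ ?_
  · have hp3 := he.lt_three
    have : 1 / 3 < 1 / p := one_div_lt_one_div_of_lt (by linarith [he.two_lt]) hp3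
    linarith
  · -- one small factor suffices, as the others are bounded
    obtain ⟨c, hc, C, hC, hb⟩ := hym.mul hp.le hp.le hratio
    have hcp := Real.rpow_nonneg (hc.nonneg le_rfl hT.le le_rfl) (1 / p + 1 / p)
    have hb' := hm'.bounded_mul (fun s t hs hst ht => (hb s t hs hst ht).trans
      (mul_le_mul_of_nonneg_left (Real.rpow_le_rpow (hc.nonneg hs hst ht)
        (hc.mono le_rfl hs hst ht le_rfl) (add_pos hp hp).le) hC)) (mul_nonneg hC hcp)
    refine fun ε hε => ?_
    obtain ⟨δ, hδ, h⟩ := hb' ε hε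
    refine ⟨δ, hδ, fun s t hs hst ht hd => le_trans (le_of_eq ?_) (h s t hs hst ht hd)⟩
    congr 1
    ring

end Regularity

/-- The formula for the relative wealth, by passing to the limit in the change of numeraire along
the given partitions. -/
theorem log_relativeWealth_eq (hS : IsPricePath p P S) (he : Exponents p q r)
    (hπ : IsPortfolio q r S π) {t : ℝ} (ht : 0 ≤ t) :
    Real.log (relativeWealth q r P S π t) =
      controlledIntegral q r P S (quot π (market S)) (market S) t
        - 1 / 2 * ∑ i, ∑ j, stieltjesIntegral (fun s => π s i * π s j)
            (relativeCovariance P S (market S) i j) t := by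
  have := hπ.nonempty
  have hT : 0 < t + 1 := by linarith
  have htT : t ∈ Icc 0 (t + 1) := ⟨ht, by linarith⟩
  have hX := hS.isRoughPath (by linarith [he.two_lt]) hT
  have hπd := (isAdmissible_iff he).mp hπ.1 _ hT
  have hμd := hS.hasGubinelliDeriv_market he hT
  obtain ⟨Y, hY⟩ := (isAdmissible_iff (S := S) (F := quot π S) he).mpr
    (fun T hT i => hS.hasGubinelliDeriv_quot_self he hT ((isAdmissible_iff he).mp hπ.1 T hT i))
    _ hT
  obtain ⟨Y', hY'⟩ := (isAdmissible_iff (S := S) (F := quot (market S) S) he).mpr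
    (fun T hT i => hS.hasGubinelliDeriv_quot_self he hT (hS.hasGubinelliDeriv_market he hT i)) _ hT
  obtain ⟨Z, hZ⟩ := (isAdmissible_iff (S := S) (F := quot π (market S)) he).mpr
    (fun T hT i => hS.hasGubinelliDeriv_quot_market he hT ((isAdmissible_iff he).mp hπ.1 T hT i))
    _ hT
  obtain ⟨M', hM'⟩ := (isAdmissible_iff (S := S) (F := market S) he).mpr
    (fun T hT i => hS.hasGubinelliDeriv_market he hT i) _ hT
  have lim1 := (hS.roughIntegral_spec he hT hY).2.tendsto_at htT
  have lim2 := (hS.roughIntegral_spec he hT hY').2.tendsto_at htT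
  have lim3 := (hS.controlledIntegral_spec he hT hZ hM').2.tendsto_at htT
  have sq := fun {f : ℝ → ℝ} (hf : HasGubinelliDeriv q r (t + 1) S f) i j =>
    hS.tendsto_germSum_sq he hT hf.continuousOn (hf.varBdd_q he hX) i j htT
  have hlim4 : ∀ F : ℝ → EuclideanSpace ℝ (Fin d),
      (∀ i, HasGubinelliDeriv q r (t + 1) S fun t => F t i) → Tendsto (fun n => ∑ i, ∑ j,
        (P n).germSum (fun u v => F u i * F u j / (S u i * S u j) *
          ((S v i - S u i) * (S v j - S u j))) t) atTop
        (𝓝 (∑ i, ∑ j, stieltjesIntegral (fun s => F s i * F s j / (S s i * S s j))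
          (fun s => bracket P S s i j) t)) := fun F hF =>
    tendsto_finsetSum _ fun i _ => tendsto_finsetSum _ fun j _ =>
      sq (hS.hasGubinelliDeriv_inv_mul he hT ((hF i).mul he hX (hF j)) i j) i j
  have lim4 := hlim4 π hπd
  have lim5 := hlim4 (market S) hμd
  have lim6 : Tendsto (fun n => ∑ i, ∑ j, ∑ k, ∑ l, (P n).germSum (fun u v => π u i * π u j *
      (excess (market S) i k u * excess (market S) j l u * (1 / (S u k * S u l))) *
      ((S v k - S u k) * (S v l - S u l))) t) atTop (𝓝 (∑ i, ∑ j,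
      stieltjesIntegral (fun s => π s i * π s j) (relativeCovariance P S (market S) i j) t)) := by
    refine tendsto_finsetSum _ fun i _ => tendsto_finsetSum _ fun j _ => ?_
    rw [hS.stieltjesIntegral_relativeCovariance he hT ((hπd i).mul he hX (hπd j)) i j htT]
    exact tendsto_finsetSum _ fun k _ => tendsto_finsetSum _ fun l _ =>
      sq (((hπd i).mul he hX (hπd j)).mul he hX ((hS.hasGubinelliDeriv_excess he hT i j k l).mul
        he hX (hS.hasGubinelliDeriv_inv he hT k l))) k l
  have lim7 := ((hS.isSewing_third_order he hT hπd).tendstoUniformlyOn hT.le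
    hS.meshToZero).tendsto_at htT
  have lim := ((lim1.sub (lim4.const_mul (1 / 2))).sub (lim2.sub (lim5.const_mul (1 / 2)))).sub
    (lim3.sub (lim6.const_mul (1 / 2)))
  have hzero := tendsto_nhds_unique lim (((lim7.neg).congr fun n => ?_))
  · rw [Pi.zero_apply, Pi.zero_apply, sub_self, neg_zero] at hzero
    unfold relativeWealth wealth
    rw [← Real.exp_sub, Real.log_exp]
    linarith
  · simp only [HalfLinePartition.leftSum_eq_germSum, ← HalfLinePartition.germSum_sum,
      ← HalfLinePartition.germSum_const_mul, ← HalfLinePartition.germSum_sub]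
    rw [← neg_one_mul, ← HalfLinePartition.germSum_const_mul]
    refine (P n).germSum_congr ht fun u v hu hv => ?_
    rw [neg_one_mul]
    exact (change_of_numeraire_identity (hπ.2 u hu) (hS.pos u hu) (hS.pos v hv) rfl rfl rfl
      rfl).symm

end IsPricePath

end PathwisePortfolio

theorem mainTheorem1 {d : ℕ} (p q r : ℝ) (hp2 : 2 < p) (hp3 : p < 3) (hpq : p ≤ q)
    (hpq' : 1 < 2 / p + 1 / q) (hr : 1 < r) (hr' : 1 / r = 1 / p + 1 / q)
    (P : ℕ → HalfLinePartition) (S : ℝ → EuclideanSpace ℝ (Fin d)) (hS : IsPricePath p P S)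
    (π : ℝ → EuclideanSpace ℝ (Fin d)) (hπ : IsPortfolio q r S π) :
    -- the market portfolio is a portfolio, and the quotients are controlled paths
    IsPortfolio q r S (market S) ∧
    IsAdmissible q r S (quot π S) ∧
    IsAdmissible q r S (quot π (market S)) ∧
    -- the bracket is continuous and of locally finite variation
    (∀ T, 0 < T → ∀ i j, ContinuousOn (fun s => bracket P S s i j) (Icc 0 T) ∧
      BoundedVariationOn (fun s => bracket P S s i j) (Icc 0 T)) ∧
    -- the Riemann–Stieltjes integrals exist
    (∀ t, 0 ≤ t → ∀ i j,
      StieltjesIntegrable (fun s => π s i * π s j / (S s i * S s j))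
        (fun s => bracket P S s i j) t ∧
      StieltjesIntegrable (fun s => 1 / (S s i * S s j)) (fun s => bracket P S s i j) t ∧
      (∀ k l, StieltjesIntegrable
        (fun s => excess (market S) i k s * excess (market S) j l s) (covariance P S k l) t) ∧
      StieltjesIntegrable (fun s => π s i * π s j)
        (relativeCovariance P S (market S) i j) t) ∧
    -- the rough integrals exist, for every choice of the Gubinelli derivatives, with one value
    (∀ T, 0 < T → ∀ Y', IsControlled q r T S (quot π S) Y' → ∀ t ∈ Icc 0 T,
      HasRoughIntegral (secondLevel P S) (quot π S) Y' S (fun _ => 1) t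
        (roughIntegral q r P S (quot π S) t)) ∧
    (∀ T, 0 < T → ∀ Z' M', IsControlled q r T S (quot π (market S)) Z' →
      IsControlled q r T S (market S) M' → ∀ t ∈ Icc 0 T,
      HasRoughIntegral (secondLevel P S) (quot π (market S)) Z' (market S) M' t
        (controlledIntegral q r P S (quot π (market S)) (market S) t)) ∧
    -- the integral against the market portfolio is a limit of left-point Riemann sums
    (∀ T, 0 < T → TendstoUniformlyOn
      (fun n t => ∑ i, (P n).leftSum (fun s => quot π (market S) s i) (fun s => market S s i) t)
      (controlledIntegral q r P S (quot π (market S)) (market S)) atTop (Icc 0 T)) ∧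
    -- the formula for the log relative wealth
    (∀ t, 0 ≤ t →
      Real.log (relativeWealth q r P S π t) =
        controlledIntegral q r P S (quot π (market S)) (market S) t
          - 1 / 2 * ∑ i, ∑ j, stieltjesIntegral (fun s => π s i * π s j)
              (relativeCovariance P S (market S) i j) t) := by

  have he : Exponents p q r := ⟨hp2, hp3, hpq, hpq', hr'⟩
  have := hπ.nonempty
  have hπd := (isAdmissible_iff he).mp hπ.1
  have hμ := fun (T : ℝ) (hT : 0 < T) => hS.hasGubinelliDeriv_market he hT
  have hμ' : IsAdmissible q r S (market S) := (isAdmissible_iff he).mpr hμ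
  have hπμ : IsAdmissible q r S (quot π (market S)) := (isAdmissible_iff he).mpr
    fun T hT i => hS.hasGubinelliDeriv_quot_market he hT (hπd T hT i)
  refine ⟨⟨hμ', fun t ht => ?_⟩, (isAdmissible_iff he).mpr fun T hT i =>
      hS.hasGubinelliDeriv_quot_self he hT (hπd T hT i), hπμ,
    fun T hT i j => ⟨hS.continuousOn_bracket hT i j, hS.boundedVariationOn_bracket hT i j⟩,
    fun t ht i j => ?_, fun T hT Y' hY => (hS.roughIntegral_spec he hT hY).1,
    fun T hT Z' M' hZ hM => (hS.controlledIntegral_spec he hT hZ hM).1, fun T hT => ?_,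
    fun t ht => hS.log_relativeWealth_eq he hπ ht⟩
  · simp only [market_apply]
    rw [← Finset.sum_div, div_self (hS.sum_pos ht).ne']
  · have hT : 0 < t + 1 := by linarith
    have htT : t ≤ t + 1 := by linarith
    have hX := hS.isRoughPath (by linarith) hT
    have hππ := (hπd _ hT i).mul he hX (hπd _ hT j)
    exact ⟨stieltjesIntegrable (hS.hasGubinelliDeriv_inv_mul he hT hππ i j).continuousOn
        (hS.varBdd_bracket hT i j) htT,
      stieltjesIntegrable (hS.hasGubinelliDeriv_inv (q := q) (r := r) he hT i j).continuousOn
        (hS.varBdd_bracket hT i j) htT,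
      fun k l => stieltjesIntegrable (hS.hasGubinelliDeriv_excess he hT i j k l).continuousOn
        (hS.varBdd_covariance he hT k l) htT,
      stieltjesIntegrable hππ.continuousOn (hS.varBdd_relativeCovariance he hT i j) htT⟩
  · obtain ⟨Z', hZ⟩ := hπμ T hT
    obtain ⟨M', hM⟩ := hμ' T hT
    exact (hS.controlledIntegral_spec he hT hZ hM).2
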